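/- Let $\mathcal M$ be an arbitrary monoidal bicategory, with tensor product written as juxtaposition and unit object $I$; the associativity, unit and interchange constraints of $\mathcal M$ are suppressed from the notation, and $\cong$ denotes an isomorphism built from them. Composition of arrows is written $\circ$ (or by juxtaposition with parentheses), and identity arrows are written $1$. **Squares.** For arrows $s:SR\to S$, $t:TS\to T$, $v:TR\to T$, a *square* $\alpha:(s,t)\Rightarrow v$ is a cell $\alpha: t\circ(1s)\Rightarrow v\circ(t1)$ between arrows $TSR\to T$. Given squares $\alpha:(s,t)\Rightarrow v$, $\beta:(s,x)\Rightarrow w$, $\gamma:(v,u)\Rightarrow w$, $\zeta:(t,u)\Rightarrow x$, where $u:UT\to U$, $x:US\to U$, $w:UR\to U$, say that $(\alpha,\beta,\gamma,\zeta)$ is a *tetrahedron* if the two composites of cells $$u(1t)(11s)\xrightarrow{\,1\alpha\,}u(1v)(1t1)\xrightarrow{\,\gamma\,}w(u1)(1t1)\xrightarrow{\,\zeta1\,}w(x1)(u11),$$ $$u(1t)(11s)\xrightarrow{\,\zeta\,}x(u1)(11s)\cong x(1s)(u11)\xrightarrow{\,\beta\,}w(x1)(u11)$$ are equal. Given $i:I\to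 R$, $\sigma:s(1i)\Rightarrow1$ and $\nu:v(1i)\Rightarrow 1$, say that $\alpha$ is *right unital* for $(i,\sigma,\nu)$ if $1\sigma:t(1s)(11i)\Rightarrow t$ equals $t(1s)(11i)\xrightarrow{\alpha}v(t1)(11i)\cong v(1i)t\xrightarrow{\nu}t$. When $S=R$, and given $\lambda:1\Rightarrow s(i1)$ and $\tau:t(1i)\Rightarrow1$, let $$\langle\lambda,\alpha,\tau\rangle:\ t\xrightarrow{\,1\lambda\,}t(1s)(1i1)\xrightarrow{\,\alpha\,}v(t1)(1i1)\xrightarrow{\,\tau1\,}v .$$ **Right skew monoidales.** A *right skew monoidale* $(M,u,m,\alpha,\lambda,\rho)$ in $\mathcal M$ consists of an object $M$, arrows $m:MM\to M$ and $u:I\to M$, and (not necessarily invertible) cells $\alpha:m(1m)\Rightarrow m(m1)$, $\lambda:1\Rightarrow m(u1)$, $\rho:m(1u)\Rightarrow1$ such that: (1) $(\alpha,\alpha,\alpha,\alpha)$ is a tetrahedron; (2) $\langle\lambda,\alpha,\rho\rangle=1_m$; (3) $m\xrightarrow{\lambda1}m(m1)(u11)$ equals $m\xrightarrow{\lambda}m(u1)m\cong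 m(1m)(u11)\xrightarrow{\alpha}m(m1)(u11)$; (4) $\alpha$ is right unital for $(u,\rho,\rho)$; (5) $u\xrightarrow{\lambda}m(u1)u\cong m(1u)u\xrightarrow{\rho}u$ is the identity. **Oplax actions.** An *oplax right $M$-action* $(a,a^2,a^0)$ on an object $A$, for a right skew monoidale $M$, consists of $a:AM\to A$ and cells $a^2:a(1m)\Rightarrow a(a1)$ and $a^0:a(1u)\Rightarrow1$ such that $(\alpha,a^2,a^2,a^2)$ is a tetrahedron, $a^2$ is right unital for $(u,\rho,a^0)$, and $\langle\lambda,a^2,a^0\rangle=1_a$. **Simplices.** Every adjunction $i\dashv i^*$ with $i:I\to R$, unit $\eta:1\Rightarrow i^*i$ and counit $\varepsilon:ii^*\Rightarrow1$, makes $R$ a right skew monoidale with product $i^*1:RR\to R$, unit $i$, associator the canonical isomorphism $(i^*1)(1i^*1)\cong(i^*1)(i^*11)$, left unitor $\lambda^*:=\eta1:1\Rightarrow(i^*1)(i1)$ and right unitor $\rho^*:(i^*1)(1i)\cong ii^*\xrightarrow{\varepsilon}1$. All actions below are with respect to structures of this form; the regular action of $R$ on itself is $(i^*1,\cong,\rho^*)$.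 For $t:TS\to T$ and an adjunction $k\dashv k^*$ with $k:I\to T$, let $c_t:(t,k^*1)\Rightarrow t$ denote the canonical isomorphism $(k^*1)(1t)\cong t(k^*11)$. Given adjunctions $i\dashv i^*$ on $R$, $j\dashv j^*$ on $S$, $k\dashv k^*$ on $T$, and oplax actions $s:SR\to S$, $t:TS\to T$, $v:TR\to T$ of $R$, $S$, $R$ respectively, a *2-simplex* is a square $\alpha:(s,t)\Rightarrow v$ such that $(c_s,\alpha,\alpha,t^2)$ and $(s^2,v^2,\alpha,\alpha)$ are tetrahedra and $\alpha$ is right unital for $(i,s^0,v^0)$. **Monads of oplax actions.** A *monad of oplax actions* $(R,i\dashv i^*,r,\mu_0,\mu_2)$ consists of an object $R$ with an adjunction $i\dashv i^*$, $i:I\to R$; an oplax right $R$-action $(r,r^2,r^0)$ on $R$; a 2-simplex $\mu_2:r(1r)\Rightarrow r(r1)$ with edges $r,r,r$; and a 2-simplex $\mu_0:(i^*1)(1i^*1)\Rightarrow r(i^*11)$ from two copies of the regular action $i^*1$ to $r$; such that $(\mu_2,\mu_2,\mu_2,\mu_2)$, $(\mu_0,r^2,\mu_2,r^2)$ and $(c_r,\mu_2,c_r,\mu_0)$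 are tetrahedra. **Proposition.** For every monad of oplax actions $(R,i\dashv i^*,r,\mu_0,\mu_2)$ in $\mathcal M$, the object $R$ with product $r$, unit $i$, associator $\mu_2$, right unitor $r^0$ and left unitor $\lambda$ is a right skew monoidale, where $\lambda$ is the mate, under the adjunction $i1\dashv i^*1$, of the cell $$\kappa:=\langle\lambda^*,\mu_0,\rho^*\rangle:\ i^*1\xrightarrow{1\eta1}(i^*1)(1i^*1)(1i1)\xrightarrow{\mu_0}r(i^*11)(1i1)\cong r(i1)(i^*1)\xrightarrow{\varepsilon1}r,$$ that is, $\lambda:\ 1\xrightarrow{\eta1}(i^*1)(i1)\xrightarrow{\kappa}r(i1)$. -/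

import Mathlib

open CategoryTheory Bicategory
open scoped Pseudofunctor.StrongTrans

universe w v u

namespace MonBicat

/-! ### Products of pseudofunctors -/

section Products

variable {A B C D : Type u} [Bicategory.{w, v} A] [Bicategory.{w, v} B]
  [Bicategory.{w, v} C] [Bicategory.{w, v} D]

/-- The product `F × G : A × C ⥤ᵖ B × D` of two pseudofunctors. -/
def prodFunctor (F : A ⥤ᵖ B) (G : C ⥤ᵖ D) : (A × C) ⥤ᵖ (B × D) where
  obj p := (F.obj p.1, G.obj p.2)
  map f := (F.map f.1, G.map f.2)
  map₂ η := (F.map₂ η.1, G.map₂ η.2)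
  map₂_id _ := Prod.ext (F.map₂_id _) (G.map₂_id _)
  map₂_comp _ _ := Prod.ext (F.map₂_comp _ _) (G.map₂_comp _ _)
  mapId p := Iso.prod (F.mapId p.1) (G.mapId p.2)
  mapComp f g := Iso.prod (F.mapComp f.1 g.1) (G.mapComp f.2 g.2)
  map₂_whisker_left f _ _ η :=
    Prod.ext (F.map₂_whisker_left f.1 η.1) (G.map₂_whisker_left f.2 η.2)
  map₂_whisker_right η h :=
    Prod.ext (F.map₂_whisker_right η.1 h.1) (G.map₂_whisker_right η.2 h.2)
  map₂_associator f g h :=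
    Prod.ext (F.map₂_associator f.1 g.1 h.1) (G.map₂_associator f.2 g.2 h.2)
  map₂_left_unitor f := Prod.ext (F.map₂_left_unitor f.1) (G.map₂_left_unitor f.2)
  map₂_right_unitor f := Prod.ext (F.map₂_right_unitor f.1) (G.map₂_right_unitor f.2)

/-- The rebracketing pseudofunctor `(A × B) × C ⥤ᵖ A × (B × C)`. -/
def prodAssoc (A B C : Type u) [Bicategory.{w, v} A] [Bicategory.{w, v} B]
    [Bicategory.{w, v} C] : ((A × B) × C) ⥤ᵖ (A × (B × C)) where
  obj p := (p.1.1, (p.1.2, p.2))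
  map f := (f.1.1, (f.1.2, f.2))
  map₂ η := (η.1.1, (η.1.2, η.2))
  map₂_id _ := rfl
  map₂_comp _ _ := rfl
  mapId _ := Iso.refl _
  mapComp _ _ := Iso.refl _
  map₂_whisker_left _ _ _ _ := by
    refine Prod.ext ?_ (Prod.ext ?_ ?_) <;> simp
  map₂_whisker_right _ _ := by
    refine Prod.ext ?_ (Prod.ext ?_ ?_) <;> simp
  map₂_associator _ _ _ := by
    refine Prod.ext ?_ (Prod.ext ?_ ?_) <;> simp
  map₂_left_unitor _ := by
    refine Prod.ext ?_ (Prod.ext ?_ ?_) <;> simp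
  map₂_right_unitor _ := by
    refine Prod.ext ?_ (Prod.ext ?_ ?_) <;> simp

variable (T : (B × B) ⥤ᵖ B)

/-- `((X, Y), Z) ↦ (X ⊗ Y) ⊗ Z` -/
def tripleLeft : ((B × B) × B) ⥤ᵖ B :=
  (prodFunctor T (Pseudofunctor.id B)).comp T

/-- `((X, Y), Z) ↦ X ⊗ (Y ⊗ Z)` -/
def tripleRight : ((B × B) × B) ⥤ᵖ B :=
  (prodAssoc B B B).comp ((prodFunctor (Pseudofunctor.id B) T).comp T)

/-- `X ↦ U ⊗ X` -/
def tensorOnLeft (U : B) : B ⥤ᵖ B :=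
  (Bicategory.Prod.sectR U B).toPseudofunctor.comp T

/-- `X ↦ X ⊗ U` -/
def tensorOnRight (U : B) : B ⥤ᵖ B :=
  (Bicategory.Prod.sectL B U).toPseudofunctor.comp T

end Products

/-! ### Monoidal bicategories -/

/-- The data of a monoidal bicategory up to dimension two: a tensor product pseudofunctor, a unit
object, and pseudonatural adjoint equivalences `(X ⊗ Y) ⊗ Z ≌ X ⊗ (Y ⊗ Z)`, `I ⊗ X ≌ X` and
`X ⊗ I ≌ X` (adjoint equivalences in the bicategory of pseudofunctors, pseudonatural
transformations and modifications). -/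
class TensorStruct (B : Type u) [Bicategory.{w, v} B] where
  tensor : (B × B) ⥤ᵖ B
  unit : B
  assoc : tripleLeft tensor ≌ tripleRight tensor
  leftUnitor : tensorOnLeft tensor unit ≌ Pseudofunctor.id B
  rightUnitor : tensorOnRight tensor unit ≌ Pseudofunctor.id B

section Notation

variable {B : Type u} [Bicategory.{w, v} B] [TensorStruct B]

/-- tensor product of objects -/
abbrev tensorObj (X Y : B) : B := (TensorStruct.tensor (B := B)).obj (X, Y)

/-- tensor product of 1-cells -/
abbrev tensorHom {X X' Y Y' : B} (f : X ⟶ X') (g : Y ⟶ Y') :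
    tensorObj X Y ⟶ tensorObj X' Y' :=
  (TensorStruct.tensor (B := B)).map (X := (X, Y)) (Y := (X', Y')) (Prod.mkHom f g)

/-- tensor product of 2-cells -/
abbrev tensorHom₂ {X X' Y Y' : B} {f f' : X ⟶ X'} {g g' : Y ⟶ Y'} (η : f ⟶ f') (θ : g ⟶ g') :
    tensorHom f g ⟶ tensorHom f' g' :=
  (TensorStruct.tensor (B := B)).map₂ (a := (X, Y)) (b := (X', Y')) (f := Prod.mkHom f g)
    (g := Prod.mkHom f' g') (Prod.mkHom η θ)

end Notation

infixr:70 " ⊠ " => MonBicat.tensorObj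
infixr:85 " ⊠₁ " => MonBicat.tensorHom
infixr:85 " ⊠₂ " => MonBicat.tensorHom₂

section Structural

variable {B : Type u} [Bicategory.{w, v} B] [TensorStruct B]

variable (B) in
/-- the unit object `I` -/
abbrev I : B := TensorStruct.unit

/-- tensor product of invertible 2-cells -/
def tensorIso {X X' Y Y' : B} {f f' : X ⟶ X'} {g g' : Y ⟶ Y'} (η : f ≅ f') (θ : g ≅ g') :
    f ⊠₁ g ≅ f' ⊠₁ g' :=
  (TensorStruct.tensor (B := B)).map₂Iso (a := (X, Y)) (b := (X', Y'))
    (f := Prod.mkHom f g) (g := Prod.mkHom f' g') (Iso.prod η θ)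

/-- `1 ⊗ 1 ≅ 1` -/
def tensorId (X Y : B) : 𝟙 X ⊠₁ 𝟙 Y ≅ 𝟙 (X ⊠ Y) :=
  (TensorStruct.tensor (B := B)).mapId (X, Y)

/-- `(f ≫ f') ⊗ (g ≫ g') ≅ (f ⊗ g) ≫ (f' ⊗ g')` -/
def tensorComp {X X' X'' Y Y' Y'' : B} (f : X ⟶ X') (f' : X' ⟶ X'') (g : Y ⟶ Y') (g' : Y' ⟶ Y'') :
    (f ≫ f') ⊠₁ (g ≫ g') ≅ (f ⊠₁ g) ≫ (f' ⊠₁ g') :=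
  (TensorStruct.tensor (B := B)).mapComp (a := (X, Y)) (b := (X', Y')) (c := (X'', Y''))
    (Prod.mkHom f g) (Prod.mkHom f' g')

/-- `(f ≫ f') ⊗ Y ≅ (f ⊗ Y) ≫ (f' ⊗ Y)` -/
def compR {X X' X'' : B} (f : X ⟶ X') (f' : X' ⟶ X'') (Y : B) :
    (f ≫ f') ⊠₁ 𝟙 Y ≅ (f ⊠₁ 𝟙 Y) ≫ (f' ⊠₁ 𝟙 Y) :=
  tensorIso (Iso.refl _) (λ_ (𝟙 Y)).symm ≪≫ tensorComp f f' (𝟙 Y) (𝟙 Y)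

/-- `X ⊗ (g ≫ g') ≅ (X ⊗ g) ≫ (X ⊗ g')` -/
def compL (X : B) {Y Y' Y'' : B} (g : Y ⟶ Y') (g' : Y' ⟶ Y'') :
    𝟙 X ⊠₁ (g ≫ g') ≅ (𝟙 X ⊠₁ g) ≫ (𝟙 X ⊠₁ g') :=
  tensorIso (λ_ (𝟙 X)).symm (Iso.refl _) ≪≫ tensorComp (𝟙 X) (𝟙 X) g g'

/-- the interchange isomorphism `(f ⊗ Y) ≫ (X' ⊗ g) ≅ (X ⊗ g) ≫ (f ⊗ Y')` -/
def interchange {X X' Y Y' : B} (f : X ⟶ X') (g : Y ⟶ Y') :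
    (f ⊠₁ 𝟙 Y) ≫ (𝟙 X' ⊠₁ g) ≅ (𝟙 X ⊠₁ g) ≫ (f ⊠₁ 𝟙 Y') :=
  (tensorComp f (𝟙 X') (𝟙 Y) g).symm ≪≫
    tensorIso (ρ_ f ≪≫ (λ_ f).symm) (λ_ g ≪≫ (ρ_ g).symm) ≪≫
    tensorComp (𝟙 X) f g (𝟙 Y')

/-- the component `(X ⊗ Y) ⊗ Z ⟶ X ⊗ (Y ⊗ Z)` of the associativity equivalence -/
def a (X Y Z : B) : (X ⊠ Y) ⊠ Z ⟶ X ⊠ (Y ⊠ Z) :=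
  (TensorStruct.assoc (B := B)).hom.app ((X, Y), Z)

/-- pseudonaturality of the associativity equivalence -/
def aNat {X X' Y Y' Z Z' : B} (f : X ⟶ X') (g : Y ⟶ Y') (h : Z ⟶ Z') :
    ((f ⊠₁ g) ⊠₁ h) ≫ a X' Y' Z' ≅ a X Y Z ≫ (f ⊠₁ (g ⊠₁ h)) :=
  (TensorStruct.assoc (B := B)).hom.naturality (a := ((X, Y), Z)) (b := ((X', Y'), Z'))
    (Prod.mkHom (Prod.mkHom f g) h)

/-- pseudonaturality of the associativity equivalence in the first variable -/
def aNat₁ {X X' : B} (f : X ⟶ X') (Y Z : B) :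
    ((f ⊠₁ 𝟙 Y) ⊠₁ 𝟙 Z) ≫ a X' Y Z ≅ a X Y Z ≫ (f ⊠₁ 𝟙 (Y ⊠ Z)) :=
  aNat f (𝟙 Y) (𝟙 Z) ≪≫ whiskerLeftIso (a X Y Z) (tensorIso (Iso.refl f) (tensorId Y Z))

/-- pseudonaturality of the associativity equivalence in the second variable -/
def aNat₂ (X : B) {Y Y' : B} (g : Y ⟶ Y') (Z : B) :
    ((𝟙 X ⊠₁ g) ⊠₁ 𝟙 Z) ≫ a X Y' Z ≅ a X Y Z ≫ (𝟙 X ⊠₁ (g ⊠₁ 𝟙 Z)) :=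
  aNat (𝟙 X) g (𝟙 Z)

/-- pseudonaturality of the associativity equivalence in the third variable -/
def aNat₃ (X Y : B) {Z Z' : B} (h : Z ⟶ Z') :
    (𝟙 (X ⊠ Y) ⊠₁ h) ≫ a X Y Z' ≅ a X Y Z ≫ (𝟙 X ⊠₁ (𝟙 Y ⊠₁ h)) :=
  whiskerRightIso (tensorIso (tensorId X Y).symm (Iso.refl h)) (a X Y Z') ≪≫
    aNat (𝟙 X) (𝟙 Y) h

/-- the component `I ⊗ X ⟶ X` of the left unit equivalence -/
def l (X : B) : I B ⊠ X ⟶ X := (TensorStruct.leftUnitor (B := B)).hom.app X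

/-- the component `X ⟶ I ⊗ X` of the inverse of the left unit equivalence -/
def lInv (X : B) : X ⟶ I B ⊠ X := (TensorStruct.leftUnitor (B := B)).inv.app X

/-- `1 ≅ l ≫ l⁻¹` -/
def lUnit (X : B) : 𝟙 (I B ⊠ X) ≅ l X ≫ lInv X where
  hom := (TensorStruct.leftUnitor (B := B)).unit.hom.as.app X
  inv := (TensorStruct.leftUnitor (B := B)).unit.inv.as.app X
  hom_inv_id := congrArg (fun m => m.as.app X) (TensorStruct.leftUnitor (B := B)).unit.hom_inv_id
  inv_hom_id := congrArg (fun m => m.as.app X) (TensorStruct.leftUnitor (B := B)).unit.inv_hom_id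

/-- pseudonaturality of the left unit equivalence -/
def lNat {X X' : B} (f : X ⟶ X') : (𝟙 (I B) ⊠₁ f) ≫ l X' ≅ l X ≫ f :=
  (TensorStruct.leftUnitor (B := B)).hom.naturality f

/-- the component `X ⊗ I ⟶ X` of the right unit equivalence -/
def r (X : B) : X ⊠ I B ⟶ X := (TensorStruct.rightUnitor (B := B)).hom.app X

/-- the component `X ⟶ X ⊗ I` of the inverse of the right unit equivalence -/
def rInv (X : B) : X ⟶ X ⊠ I B := (TensorStruct.rightUnitor (B := B)).inv.app X

/-- `r⁻¹ ≫ r ≅ 1` -/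
def rCounit (X : B) : rInv X ≫ r X ≅ 𝟙 X where
  hom := (TensorStruct.rightUnitor (B := B)).counit.hom.as.app X
  inv := (TensorStruct.rightUnitor (B := B)).counit.inv.as.app X
  hom_inv_id :=
    congrArg (fun m => m.as.app X) (TensorStruct.rightUnitor (B := B)).counit.hom_inv_id
  inv_hom_id :=
    congrArg (fun m => m.as.app X) (TensorStruct.rightUnitor (B := B)).counit.inv_hom_id

/-- pseudonaturality of the right unit equivalence -/
def rNat {X X' : B} (f : X ⟶ X') : (f ⊠₁ 𝟙 (I B)) ≫ r X' ≅ r X ≫ f :=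
  (TensorStruct.rightUnitor (B := B)).hom.naturality f

/-- The square `f ≫ b ≅ p ≫ f'` tensored with the square `g ≫ d ≅ q ≫ g'`. -/
def tensorSq {X X' Y Y' Z Z' W W' : B} {f : X ⟶ X'} {b : X' ⟶ Y'} {p : X ⟶ Y} {f' : Y ⟶ Y'}
    {g : Z ⟶ Z'} {d : Z' ⟶ W'} {q : Z ⟶ W} {g' : W ⟶ W'}
    (σ : f ≫ b ≅ p ≫ f') (τ : g ≫ d ≅ q ≫ g') :
    (f ⊠₁ g) ≫ (b ⊠₁ d) ≅ (p ⊠₁ q) ≫ (f' ⊠₁ g') :=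
  (tensorComp f b g d).symm ≪≫ tensorIso σ τ ≪≫ tensorComp p f' q g'

end Structural

section Pasting

variable {B : Type u} [Bicategory.{w, v} B]

/-- The identity square `f ≫ 1 ≅ 1 ≫ f`. -/
def idSq {X X' : B} (f : X ⟶ X') : f ≫ 𝟙 X' ≅ 𝟙 X ≫ f := ρ_ f ≪≫ (λ_ f).symm

/-- Pasting of two squares. -/
def pasteSq {X X' Y Y' Z Z' : B} {f : X ⟶ X'} {b : X' ⟶ Y'} {p : X ⟶ Y} {f' : Y ⟶ Y'}
    {d : Y' ⟶ Z'} {q : Y ⟶ Z} {f'' : Z ⟶ Z'}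
    (σ : f ≫ b ≅ p ≫ f') (τ : f' ≫ d ≅ q ≫ f'') : f ≫ (b ≫ d) ≅ (p ≫ q) ≫ f'' :=
  (α_ f b d).symm ≪≫ whiskerRightIso σ d ≪≫ α_ p f' d ≪≫ whiskerLeftIso p τ ≪≫ (α_ p q f'').symm

end Pasting

/-- A monoidal bicategory (a one-object tricategory): the structure above together with
invertible modifications `π`, `μ`, `lam`, `rho`, subject to the associahedron axiom and the two
normalisation axioms. -/
class MonoidalBicategory (B : Type u) [Bicategory.{w, v} B] extends TensorStruct B where
  π (W X Y Z : B) :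
    (a W X Y ⊠₁ 𝟙 Z) ≫ a W (X ⊠ Y) Z ≫ (𝟙 W ⊠₁ a X Y Z) ≅ a (W ⊠ X) Y Z ≫ a W X (Y ⊠ Z)
  μ (X Y : B) : a X (I B) Y ≫ (𝟙 X ⊠₁ l Y) ≅ r X ⊠₁ 𝟙 Y
  lam (X Y : B) : a (I B) X Y ≫ l (X ⊠ Y) ≅ l X ⊠₁ 𝟙 Y
  rho (X Y : B) : a X Y (I B) ≫ (𝟙 X ⊠₁ r Y) ≅ r (X ⊠ Y)
  /-- `π` is a modification. -/
  π_naturality {W W' X X' Y Y' Z Z' : B} (f : W ⟶ W') (g : X ⟶ X') (h : Y ⟶ Y') (k : Z ⟶ Z') :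
    (((f ⊠₁ g) ⊠₁ h) ⊠₁ k) ◁ (π W' X' Y' Z').hom ≫
        (pasteSq (aNat (f ⊠₁ g) h k) (aNat f g (h ⊠₁ k))).hom =
      (pasteSq (tensorSq (aNat f g h) (idSq k))
          (pasteSq (aNat f (g ⊠₁ h) k) (tensorSq (idSq f) (aNat g h k)))).hom ≫
        (π W X Y Z).hom ▷ (f ⊠₁ (g ⊠₁ (h ⊠₁ k)))
  /-- `μ` is a modification. -/
  μ_naturality {X X' Y Y' : B} (f : X ⟶ X') (g : Y ⟶ Y') :
    ((f ⊠₁ 𝟙 (I B)) ⊠₁ g) ◁ (μ X' Y').hom ≫ (tensorSq (rNat f) (idSq g)).hom =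
      (pasteSq (aNat f (𝟙 (I B)) g) (tensorSq (idSq f) (lNat g))).hom ≫
        (μ X Y).hom ▷ (f ⊠₁ g)
  /-- `lam` is a modification. -/
  lam_naturality {X X' Y Y' : B} (f : X ⟶ X') (g : Y ⟶ Y') :
    ((𝟙 (I B) ⊠₁ f) ⊠₁ g) ◁ (lam X' Y').hom ≫ (tensorSq (lNat f) (idSq g)).hom =
      (pasteSq (aNat (𝟙 (I B)) f g) (lNat (f ⊠₁ g))).hom ≫ (lam X Y).hom ▷ (f ⊠₁ g)
  /-- `rho` is a modification. -/
  rho_naturality {X X' Y Y' : B} (f : X ⟶ X') (g : Y ⟶ Y') :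
    ((f ⊠₁ g) ⊠₁ 𝟙 (I B)) ◁ (rho X' Y').hom ≫ (rNat (f ⊠₁ g)).hom =
      (pasteSq (aNat f g (𝟙 (I B))) (tensorSq (idSq f) (rNat g))).hom ≫
        (rho X Y).hom ▷ (f ⊠₁ g)
  /-- The associahedron axiom (nonabelian 4-cocycle condition). -/
  associahedron (V W X Y Z : B) :
    (𝟙 _ ⊗≫
      (((a V W X ⊠₁ 𝟙 Y) ⊠₁ 𝟙 Z) ◁ (compR _ _ Z).inv ≫ (compR _ _ Z).inv ≫
          ((π V W X Y).hom ⊠₂ 𝟙 (𝟙 Z)) ≫ (compR _ _ Z).hom) ▷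
        (a V (W ⊠ X ⊠ Y) Z ≫ (𝟙 V ⊠₁ a W (X ⊠ Y) Z) ≫ (𝟙 V ⊠₁ (𝟙 W ⊠₁ a X Y Z))) ⊗≫
      (a (V ⊠ W) X Y ⊠₁ 𝟙 Z) ◁ (π V W (X ⊠ Y) Z).hom ▷ (𝟙 V ⊠₁ (𝟙 W ⊠₁ a X Y Z)) ⊗≫
      ((a (V ⊠ W) X Y ⊠₁ 𝟙 Z) ≫ a (V ⊠ W) (X ⊠ Y) Z) ◁ (aNat₃ V W (a X Y Z)).inv ⊗≫
      (π (V ⊠ W) X Y Z).hom ▷ a V W (X ⊠ Y ⊠ Z) ⊗≫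
      𝟙 _ :
        ((a V W X ⊠₁ 𝟙 Y) ⊠₁ 𝟙 Z) ≫ (a V (W ⊠ X) Y ⊠₁ 𝟙 Z) ≫ ((𝟙 V ⊠₁ a W X Y) ⊠₁ 𝟙 Z) ≫
          a V (W ⊠ X ⊠ Y) Z ≫ (𝟙 V ⊠₁ a W (X ⊠ Y) Z) ≫ (𝟙 V ⊠₁ (𝟙 W ⊠₁ a X Y Z)) ⟶
        a ((V ⊠ W) ⊠ X) Y Z ≫ a (V ⊠ W) X (Y ⊠ Z) ≫ a V W (X ⊠ Y ⊠ Z)) =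
    (𝟙 _ ⊗≫
      (((a V W X ⊠₁ 𝟙 Y) ⊠₁ 𝟙 Z) ≫ (a V (W ⊠ X) Y ⊠₁ 𝟙 Z)) ◁ (aNat₂ V (a W X Y) Z).hom ▷
        ((𝟙 V ⊠₁ a W (X ⊠ Y) Z) ≫ (𝟙 V ⊠₁ (𝟙 W ⊠₁ a X Y Z))) ⊗≫
      (((a V W X ⊠₁ 𝟙 Y) ⊠₁ 𝟙 Z) ≫ (a V (W ⊠ X) Y ⊠₁ 𝟙 Z) ≫ a V ((W ⊠ X) ⊠ Y) Z) ◁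
        ((𝟙 V ⊠₁ (a W X Y ⊠₁ 𝟙 Z)) ◁ (compL V _ _).inv ≫ (compL V _ _).inv ≫
          (𝟙 (𝟙 V) ⊠₂ (π W X Y Z).hom) ≫ (compL V _ _).hom) ⊗≫
      ((a V W X ⊠₁ 𝟙 Y) ⊠₁ 𝟙 Z) ◁ (π V (W ⊠ X) Y Z).hom ▷ (𝟙 V ⊠₁ a W X (Y ⊠ Z)) ⊗≫
      (aNat₁ (a V W X) Y Z).hom ▷ (a V (W ⊠ X) (Y ⊠ Z) ≫ (𝟙 V ⊠₁ a W X (Y ⊠ Z))) ⊗≫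
      a ((V ⊠ W) ⊠ X) Y Z ◁ (π V W X (Y ⊠ Z)).hom ⊗≫
      𝟙 _)
  /-- The left normalisation axiom. -/
  left_normalisation (X Y Z : B) :
    (𝟙 _ ⊗≫
      (π X (I B) Y Z).hom ▷ (𝟙 X ⊠₁ l (Y ⊠ Z)) ⊗≫
      a (X ⊠ I B) Y Z ◁ (μ X (Y ⊠ Z)).hom ⊗≫
      (aNat₁ (r X) Y Z).inv :
        (a X (I B) Y ⊠₁ 𝟙 Z) ≫ a X (I B ⊠ Y) Z ≫ (𝟙 X ⊠₁ a (I B) Y Z) ≫ (𝟙 X ⊠₁ l (Y ⊠ Z)) ⟶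
        ((r X ⊠₁ 𝟙 Y) ⊠₁ 𝟙 Z) ≫ a X Y Z) =
    (𝟙 _ ⊗≫
      ((a X (I B) Y ⊠₁ 𝟙 Z) ≫ a X (I B ⊠ Y) Z) ◁
        ((compL X _ _).inv ≫ (𝟙 (𝟙 X) ⊠₂ (lam Y Z).hom)) ⊗≫
      (a X (I B) Y ⊠₁ 𝟙 Z) ◁ (aNat₂ X (l Y) Z).inv ⊗≫
      ((compR _ _ Z).inv ≫ ((μ X Y).hom ⊠₂ 𝟙 (𝟙 Z))) ▷ a X Y Z)
  /-- The right normalisation axiom. -/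
  right_normalisation (X Y Z : B) :
    (𝟙 _ ⊗≫
      (π X Y (I B) Z).hom ▷ (𝟙 X ⊠₁ (𝟙 Y ⊠₁ l Z)) ⊗≫
      a (X ⊠ Y) (I B) Z ◁ (aNat₃ X Y (l Z)).inv ⊗≫
      (μ (X ⊠ Y) Z).hom ▷ a X Y Z :
        (a X Y (I B) ⊠₁ 𝟙 Z) ≫ a X (Y ⊠ I B) Z ≫ (𝟙 X ⊠₁ a Y (I B) Z) ≫ (𝟙 X ⊠₁ (𝟙 Y ⊠₁ l Z)) ⟶
        (r (X ⊠ Y) ⊠₁ 𝟙 Z) ≫ a X Y Z) =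
    (𝟙 _ ⊗≫
      ((a X Y (I B) ⊠₁ 𝟙 Z) ≫ a X (Y ⊠ I B) Z) ◁
        ((compL X _ _).inv ≫ (𝟙 (𝟙 X) ⊠₂ (μ Y Z).hom)) ⊗≫
      (a X Y (I B) ⊠₁ 𝟙 Z) ◁ (aNat₂ X (r Y) Z).inv ⊗≫
      ((compR _ _ Z).inv ≫ ((rho X Y).hom ⊠₂ 𝟙 (𝟙 Z))) ▷ a X Y Z)

open MonoidalBicategory

section UnitObject

variable {B : Type u} [Bicategory.{w, v} B] [MonoidalBicategory B]

/-- The canonical isomorphism `I ⊗ l_X ≅ l_{I ⊗ X}`, obtained from pseudonaturality of `l` at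
`l_X` by cancelling the equivalence `l_X`. -/
def lWhisker (X : B) : 𝟙 (I B) ⊠₁ l X ≅ l (I B ⊠ X) :=
  (ρ_ _).symm ≪≫ whiskerLeftIso (𝟙 (I B) ⊠₁ l X) (lUnit X) ≪≫ (α_ _ _ _).symm ≪≫
    whiskerRightIso (lNat (l X)) (lInv X) ≪≫ α_ _ _ _ ≪≫
    whiskerLeftIso (l (I B ⊠ X)) (lUnit X).symm ≪≫ ρ_ _

variable (B) in
/-- The canonical isomorphism `l_I ⊗ I ≅ r_I ⊗ I`. -/
def unitWhisker : l (I B) ⊠₁ 𝟙 (I B) ≅ r (I B) ⊠₁ 𝟙 (I B) :=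
  (lam (I B) (I B)).symm ≪≫ whiskerLeftIso (a (I B) (I B) (I B)) (lWhisker (I B)).symm ≪≫
    μ (I B) (I B)

variable (B) in
/-- The canonical isomorphism `l_I ≅ r_I`, obtained from `l_I ⊗ I ≅ r_I ⊗ I` by pseudonaturality
of `r` and by cancelling the equivalence `r_{I ⊗ I}`. -/
def unitIso : l (I B) ≅ r (I B) :=
  (λ_ _).symm ≪≫ whiskerRightIso (rCounit (I B ⊠ I B)).symm (l (I B)) ≪≫ α_ _ _ _ ≪≫
    whiskerLeftIso (rInv (I B ⊠ I B))
      ((rNat (l (I B))).symm ≪≫ whiskerRightIso (unitWhisker B) (r (I B)) ≪≫ rNat (r (I B))) ≪≫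
    (α_ _ _ _).symm ≪≫ whiskerRightIso (rCounit (I B ⊠ I B)) (r (I B)) ≪≫ λ_ _

end UnitObject

/-! ### Squares and their pasting conditions

In the comments `1` stands for identities and juxtaposition for the tensor product. -/

section Cells

variable {B : Type u} [Bicategory.{w, v} B] [MonoidalBicategory B]

/-- A square from `t ∘ 1s` to `v ∘ t1`, for `s : SR ⟶ S`, `t : TS ⟶ T` and `v : TR ⟶ T`. -/
abbrev Square {R S T : B} (s : S ⊠ R ⟶ S) (t : T ⊠ S ⟶ T) (v : T ⊠ R ⟶ T) :=
  a T S R ≫ (𝟙 T ⊠₁ s) ≫ t ⟶ (t ⊠₁ 𝟙 R) ≫ v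

/-- The cell `1α`. -/
def Square.whiskerL (U : B) {R S T : B} {s : S ⊠ R ⟶ S} {t : T ⊠ S ⟶ T} {v : T ⊠ R ⟶ T}
    (α : Square s t v) :
    (𝟙 U ⊠₁ a T S R) ≫ (𝟙 U ⊠₁ (𝟙 T ⊠₁ s)) ≫ (𝟙 U ⊠₁ t) ⟶
      (𝟙 U ⊠₁ (t ⊠₁ 𝟙 R)) ≫ (𝟙 U ⊠₁ v) :=
  (𝟙 U ⊠₁ a T S R) ◁ (compL U _ _).inv ≫ (compL U _ _).inv ≫ (𝟙 (𝟙 U) ⊠₂ α) ≫ (compL U _ _).hom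

/-- The cell `α1`. -/
def Square.whiskerR {R S T : B} {s : S ⊠ R ⟶ S} {t : T ⊠ S ⟶ T} {v : T ⊠ R ⟶ T}
    (α : Square s t v) (U : B) :
    (a T S R ⊠₁ 𝟙 U) ≫ ((𝟙 T ⊠₁ s) ⊠₁ 𝟙 U) ≫ (t ⊠₁ 𝟙 U) ⟶
      ((t ⊠₁ 𝟙 R) ⊠₁ 𝟙 U) ≫ (v ⊠₁ 𝟙 U) :=
  (a T S R ⊠₁ 𝟙 U) ◁ (compR _ _ U).inv ≫ (compR _ _ U).inv ≫ (α ⊠₂ 𝟙 (𝟙 U)) ≫ (compR _ _ U).hom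

/-- The tetrahedron condition: for squares
`α : v ⟸ (s, t)`, `β : w ⟸ (s, x)`, `γ : w ⟸ (v, u)`, `ζ : x ⟸ (t, u)`, pasting `1α`, `γ` and `ζ1`
agrees with pasting `ζ`, interchange and `β`, as 2-cells between arrows `((UT)S)R ⟶ U`. -/
def IsTetrahedron {R S T U : B} {s : S ⊠ R ⟶ S} {t : T ⊠ S ⟶ T} {u : U ⊠ T ⟶ U}
    {v : T ⊠ R ⟶ T} {x : U ⊠ S ⟶ U} {w : U ⊠ R ⟶ U}
    (α : Square s t v) (β : Square s x w) (γ : Square v u w) (ζ : Square t u x) : Prop :=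
  (𝟙 _ ⊗≫
    a (U ⊠ T) S R ◁ (aNat₃ U T s).hom ▷ ((𝟙 U ⊠₁ t) ≫ u) ⊗≫
    (π U T S R).inv ▷ ((𝟙 U ⊠₁ (𝟙 T ⊠₁ s)) ≫ (𝟙 U ⊠₁ t) ≫ u) ⊗≫
    ((a U T S ⊠₁ 𝟙 R) ≫ a U (T ⊠ S) R) ◁ (α.whiskerL U) ▷ u ⊗≫
    (a U T S ⊠₁ 𝟙 R) ◁ (aNat₂ U t R).inv ▷ ((𝟙 U ⊠₁ v) ≫ u) ⊗≫
    ((a U T S ⊠₁ 𝟙 R) ≫ ((𝟙 U ⊠₁ t) ⊠₁ 𝟙 R)) ◁ γ ⊗≫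
    (ζ.whiskerR R) ▷ w ⊗≫
    𝟙 _ :
        a (U ⊠ T) S R ≫ (𝟙 (U ⊠ T) ⊠₁ s) ≫ a U T S ≫ (𝟙 U ⊠₁ t) ≫ u ⟶
        ((u ⊠₁ 𝟙 S) ⊠₁ 𝟙 R) ≫ (x ⊠₁ 𝟙 R) ≫ w) =
  (𝟙 _ ⊗≫
    (a (U ⊠ T) S R ≫ (𝟙 (U ⊠ T) ⊠₁ s)) ◁ ζ ⊗≫
    a (U ⊠ T) S R ◁ (interchange u s).inv ▷ x ⊗≫
    (aNat₁ u S R).inv ▷ ((𝟙 U ⊠₁ s) ≫ x) ⊗≫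
    ((u ⊠₁ 𝟙 S) ⊠₁ 𝟙 R) ◁ β ⊗≫
    𝟙 _)

/-- The right unit condition for a square `α : v ⟸ (s, t)` with respect to an arrow `i : I ⟶ R` and
cells `s⁰ : s ∘ 1i ⟹ 1`, `v⁰ : v ∘ 1i ⟹ 1` (written over the equivalences `r : XI ⟶ X`):
`1s⁰` agrees with the pasting of `α`, interchange and `v⁰`. -/
def IsRightUnital {R S T : B} (i : I B ⟶ R) {s : S ⊠ R ⟶ S} {t : T ⊠ S ⟶ T} {v : T ⊠ R ⟶ T}
    (s₀ : (𝟙 S ⊠₁ i) ≫ s ⟶ r S) (v₀ : (𝟙 T ⊠₁ i) ≫ v ⟶ r T) (α : Square s t v) : Prop :=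
  (𝟙 _ ⊗≫
    (aNat₃ T S i).hom ▷ ((𝟙 T ⊠₁ s) ≫ t) ⊗≫
    a T S (I B) ◁ ((compL T _ _).inv ≫ (𝟙 (𝟙 T) ⊠₂ s₀)) ▷ t ⊗≫
    (rho T S).hom ▷ t :
        (𝟙 (T ⊠ S) ⊠₁ i) ≫ a T S R ≫ (𝟙 T ⊠₁ s) ≫ t ⟶ r (T ⊠ S) ≫ t) =
  (𝟙 _ ⊗≫
    (𝟙 (T ⊠ S) ⊠₁ i) ◁ α ⊗≫
    (interchange t i).inv ▷ v ⊗≫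
    (t ⊠₁ 𝟙 (I B)) ◁ v₀ ⊗≫
    (rNat t).hom)

/-- The pasting of `1λ`, a square `α : v ⟸ (s, t)` and `ρ1`, for cells `λ : 1 ⟹ s ∘ i1` and
`ρ : t ∘ 1i ⟹ 1` (written over the equivalences `l : IX ⟶ X` and `r : XI ⟶ X`); it is a cell from
`t` to `v`, written over the equivalence `r1 : (TI)R ⟶ TR`. -/
def middleUnit {R T : B} {i : I B ⟶ R} {s : R ⊠ R ⟶ R} {t v : T ⊠ R ⟶ T}
    (lamb : l R ⟶ (i ⊠₁ 𝟙 R) ≫ s) (α : Square s t v) (rh : (𝟙 T ⊠₁ i) ≫ t ⟶ r T) :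
    (r T ⊠₁ 𝟙 R) ≫ t ⟶ (r T ⊠₁ 𝟙 R) ≫ v :=
  𝟙 _ ⊗≫
  (μ T R).inv ▷ t ⊗≫
  a T (I B) R ◁ ((𝟙 (𝟙 T) ⊠₂ lamb) ≫ (compL T _ _).hom) ▷ t ⊗≫
  (aNat₂ T i R).inv ▷ ((𝟙 T ⊠₁ s) ≫ t) ⊗≫
  ((𝟙 T ⊠₁ i) ⊠₁ 𝟙 R) ◁ α ⊗≫
  ((compR _ _ R).inv ≫ (rh ⊠₂ 𝟙 (𝟙 R))) ▷ v

/-- Cancelling the equivalence `r1 : (TI)R ⟶ TR` from a 2-cell. -/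
def cancelUnit {R T X : B} {f g : T ⊠ R ⟶ X}
    (φ : (r T ⊠₁ 𝟙 R) ≫ f ⟶ (r T ⊠₁ 𝟙 R) ≫ g) : f ⟶ g :=
  let e : (rInv T ⊠₁ 𝟙 R) ≫ (r T ⊠₁ 𝟙 R) ≅ 𝟙 (T ⊠ R) :=
    (compR (rInv T) (r T) R).symm ≪≫ tensorIso (rCounit T) (Iso.refl _) ≪≫ tensorId T R
  (λ_ f).inv ≫ e.inv ▷ f ≫ (α_ _ _ _).hom ≫ (rInv T ⊠₁ 𝟙 R) ◁ φ ≫ (α_ _ _ _).inv ≫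
    e.hom ▷ g ≫ (λ_ g).hom

end Cells

/-! ### Right skew monoidales -/

/-- The data of a right skew monoidale. The unitors `λ : 1 ⟹ m ∘ u1` and `ρ : m ∘ 1u ⟹ 1` are
written over the equivalences `l : IM ⟶ M` and `r : MI ⟶ M`. -/
structure SkewMonoidaleData (B : Type u) [Bicategory.{w, v} B] [MonoidalBicategory B] where
  obj : B
  mul : obj ⊠ obj ⟶ obj
  unit : I B ⟶ obj
  assoc : Square mul mul mul
  leftUnitor : l obj ⟶ (unit ⊠₁ 𝟙 obj) ≫ mul
  rightUnitor : (𝟙 obj ⊠₁ unit) ≫ mul ⟶ r obj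

/-- The five axioms of a right skew monoidale. -/
structure IsRightSkewMonoidale {B : Type u} [Bicategory.{w, v} B] [MonoidalBicategory B]
    (M : SkewMonoidaleData B) : Prop where
  /-- the pentagon -/
  pentagon : IsTetrahedron M.assoc M.assoc M.assoc M.assoc
  /-- the triangle -/
  triangle : middleUnit M.leftUnitor M.assoc M.rightUnitor = 𝟙 _
  /-- compatibility of the associator and the left unitor -/
  assoc_leftUnitor :
    (𝟙 _ ⊗≫
      a (I B) M.obj M.obj ◁ (lNat M.mul).hom ⊗≫
      (lam M.obj M.obj).hom ▷ M.mul ⊗≫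
      ((M.leftUnitor ⊠₂ 𝟙 (𝟙 M.obj)) ≫ (compR _ _ M.obj).hom) ▷ M.mul ⊗≫
      𝟙 _ :
        a (I B) M.obj M.obj ≫ (𝟙 (I B) ⊠₁ M.mul) ≫ l M.obj ⟶
        ((M.unit ⊠₁ 𝟙 M.obj) ⊠₁ 𝟙 M.obj) ≫ (M.mul ⊠₁ 𝟙 M.obj) ≫ M.mul) =
    (𝟙 _ ⊗≫
      (a (I B) M.obj M.obj ≫ (𝟙 (I B) ⊠₁ M.mul)) ◁ M.leftUnitor ⊗≫
      a (I B) M.obj M.obj ◁ (interchange M.unit M.mul).inv ▷ M.mul ⊗≫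
      (aNat₁ M.unit M.obj M.obj).inv ▷ ((𝟙 M.obj ⊠₁ M.mul) ≫ M.mul) ⊗≫
      ((M.unit ⊠₁ 𝟙 M.obj) ⊠₁ 𝟙 M.obj) ◁ M.assoc)
  /-- compatibility of the associator and the right unitor -/
  assoc_rightUnitor : IsRightUnital M.unit M.rightUnitor M.rightUnitor M.assoc
  /-- compatibility of the unitors -/
  leftUnitor_rightUnitor :
    (𝟙 _ ⊗≫
      (𝟙 (I B) ⊠₁ M.unit) ◁ M.leftUnitor ⊗≫
      (interchange M.unit M.unit).inv ▷ M.mul ⊗≫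
      (M.unit ⊠₁ 𝟙 (I B)) ◁ M.rightUnitor :
        (𝟙 (I B) ⊠₁ M.unit) ≫ l M.obj ⟶ (M.unit ⊠₁ 𝟙 (I B)) ≫ r M.obj) =
    (lNat M.unit).hom ≫ (unitIso B).hom ▷ M.unit ≫ (rNat M.unit).inv

/-! ### Oplax actions -/

/-- The data of an oplax right `M`-action on `A`; the unitor `a⁰ : a ∘ 1u ⟹ 1` is written over the
equivalence `r : AI ⟶ A`. -/
structure OplaxActionData {B : Type u} [Bicategory.{w, v} B] [MonoidalBicategory B]
    (M : SkewMonoidaleData B) (A : B) where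
  act : A ⊠ M.obj ⟶ A
  assoc : Square M.mul act act
  unitor : (𝟙 A ⊠₁ M.unit) ≫ act ⟶ r A

/-- The three axioms of an oplax right `M`-action on `A`. -/
structure IsOplaxAction {B : Type u} [Bicategory.{w, v} B] [MonoidalBicategory B]
    {M : SkewMonoidaleData B} {A : B} (x : OplaxActionData M A) : Prop where
  pentagon : IsTetrahedron M.assoc x.assoc x.assoc x.assoc
  assoc_unitor : IsRightUnital M.unit M.rightUnitor x.unitor x.assoc
  triangle : middleUnit M.leftUnitor x.assoc x.unitor = 𝟙 _

/-! ### The simplices of oplax actions -/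

/-- A 0-simplex of oplax actions: an object `R` with an adjunction `i ⊣ i*`, where `i : I ⟶ R`. -/
structure ZeroSimplex (B : Type u) [Bicategory.{w, v} B] [MonoidalBicategory B] where
  obj : B
  i : I B ⟶ obj
  iStar : obj ⟶ I B
  adj : i ⊣ iStar

namespace ZeroSimplex

variable {B : Type u} [Bicategory.{w, v} B] [MonoidalBicategory B] (R S T : ZeroSimplex B)

/-- The arrow `i*1 : RX ⟶ X`. -/
abbrev mul (X : B) : R.obj ⊠ X ⟶ X := (R.iStar ⊠₁ 𝟙 X) ≫ l X

/-- The adjunction `i1 ⊣ i*1` between `IX` and `RX`. -/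
def adjR (X : B) : (R.i ⊠₁ 𝟙 X) ⊣ (R.iStar ⊠₁ 𝟙 X) :=
  (tensorOnRight (TensorStruct.tensor (B := B)) X).mapAdjunction R.adj

/-- The canonical isomorphism `i*1 ∘ 1t ≅ t ∘ i*11`, for `t : RX ⟶ R`. -/
def slide {X : B} (t : R.obj ⊠ X ⟶ R.obj) : Square t (R.mul R.obj) t :=
  𝟙 _ ⊗≫
  a R.obj R.obj X ◁ (interchange R.iStar t).inv ▷ l R.obj ⊗≫
  (aNat₁ R.iStar R.obj X).inv ▷ ((𝟙 (I B) ⊠₁ t) ≫ l R.obj) ⊗≫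
  (((R.iStar ⊠₁ 𝟙 R.obj) ⊠₁ 𝟙 X) ≫ a (I B) R.obj X) ◁ (lNat t).hom ⊗≫
  ((R.iStar ⊠₁ 𝟙 R.obj) ⊠₁ 𝟙 X) ◁ (lam R.obj X).hom ▷ t ⊗≫
  (compR _ _ X).inv ▷ t

/-- The right skew monoidale with product `i*1 : RR ⟶ R` and unit `i` induced by `i ⊣ i*`. -/
def skew : SkewMonoidaleData B where
  obj := R.obj
  mul := R.mul R.obj
  unit := R.i
  assoc := R.slide (R.mul R.obj)
  leftUnitor := (λ_ _).inv ≫ (R.adjR R.obj).unit ▷ l R.obj ≫ (α_ _ _ _).hom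
  rightUnitor :=
    𝟙 _ ⊗≫
    (interchange R.iStar R.i).inv ▷ l R.obj ⊗≫
    (R.iStar ⊠₁ 𝟙 (I B)) ◁ (lNat R.i).hom ⊗≫
    (R.iStar ⊠₁ 𝟙 (I B)) ◁ (unitIso B).hom ▷ R.i ⊗≫
    (rNat R.iStar).hom ▷ R.i ⊗≫
    r R.obj ◁ R.adj.counit ⊗≫
    𝟙 _

/-- The degenerate 1-simplex on a 0-simplex: the regular action of the induced right skew monoidale
on itself. -/
def degenerate : OplaxActionData R.skew R.obj where
  act := R.mul R.obj
  assoc := R.skew.assoc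
  unitor := R.skew.rightUnitor

end ZeroSimplex

/-- The axioms for a square `α : t ∘ 1s ⟹ v ∘ t1` to be a 2-simplex of oplax actions with faces
`s : R ⇸ S`, `t : S ⇸ T`, `v : R ⇸ T`. -/
structure IsTwoSimplex {B : Type u} [Bicategory.{w, v} B] [MonoidalBicategory B]
    {R S T : ZeroSimplex B} (s : OplaxActionData R.skew S.obj) (t : OplaxActionData S.skew T.obj)
    (v : OplaxActionData R.skew T.obj) (α : Square s.act t.act v.act) : Prop where
  left : IsTetrahedron (S.slide s.act) α α t.assoc
  right : IsTetrahedron s.assoc v.assoc α α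
  unital : IsRightUnital R.i s.unitor v.unitor α

/-- A monad of oplax actions `(R, i ⊣ i*, r, μ₀, μ₂)`: one 0-simplex, one 1-simplex, two 2-simplices
and three 3-simplices of oplax actions. -/
structure MonadOfOplaxActions (B : Type u) [Bicategory.{w, v} B] [MonoidalBicategory B] where
  base : ZeroSimplex B
  act : OplaxActionData base.skew base.obj
  isOplaxAction : IsOplaxAction act
  μ₀ : Square base.degenerate.act base.degenerate.act act.act
  isTwoSimplex₀ : IsTwoSimplex (R := base) (S := base) (T := base)
    base.degenerate base.degenerate act μ₀
  μ₂ : Square act.act act.act act.act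
  isTwoSimplex₂ : IsTwoSimplex (R := base) (S := base) (T := base) act act act μ₂
  assoc : IsTetrahedron μ₂ μ₂ μ₂ μ₂
  right_unit : IsTetrahedron μ₀ act.assoc μ₂ act.assoc
  left_unit : IsTetrahedron (base.slide act.act) μ₂ (base.slide act.act) μ₀

namespace MonadOfOplaxActions

variable {B : Type u} [Bicategory.{w, v} B] [MonoidalBicategory B] (M : MonadOfOplaxActions B)

/-- The cell `κ : i*1 ⟹ r` corresponding to `μ₀`: the pasting of `1η1`, `μ₀` and `ε1`. -/
def κ : M.base.mul M.base.obj ⟶ M.act.act :=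
  cancelUnit (middleUnit M.base.skew.leftUnitor M.μ₀ M.base.skew.rightUnitor)

/-- The cell `λ : 1 ⟹ r ∘ i1`, the mate of `κ` under the adjunction `i1 ⊣ i*1`. -/
def leftUnitor : l M.base.obj ⟶ (M.base.i ⊠₁ 𝟙 M.base.obj) ≫ M.act.act :=
  (M.base.adjR M.base.obj).homEquiv₁.symm M.κ

end MonadOfOplaxActions

end MonBicat

/-! Two of the five axioms are hypotheses: the pentagon is the tetrahedron `(μ₂, μ₂, μ₂, μ₂)`, and
right unitality of `μ₂` is part of its being a 2-simplex. The other three involve `λ`, which is `λ*`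
followed by `κ`, and come from three properties of `κ = ⟨λ*, μ₀, ρ*⟩`.

Triangle. In a tetrahedron `(α, β, γ, ζ)` with `ζ` right unital, `1⟨λ, α, ρ⟩` followed by `γ` equals
`ζ` followed by `⟨λ, β, ρ'⟩1` (`IsTetrahedron.midCell_comm`). Apply this to `(μ₀, r², μ₂, r²)`: as
`⟨λ*, r², r⁰⟩ = 1` for an action, `1κ` followed by `μ₂` is `r²`. Absorbing the `κ` of `λ` into `μ₂`
therefore gives `⟨λ, μ₂, r⁰⟩ = ⟨λ*, r², r⁰⟩ = 1`.

Associator and left unitor. In a tetrahedron with `α` left unital, `⟨λ, ζ, ρ⟩` carries `γ` to `β`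
(`IsTetrahedron.comp_midCell`). The canonical isomorphism `c_r` is left unital for `λ*` by
naturality of `η`, so `(c_r, μ₂, c_r, μ₀)` shows that `c_r` followed by `κ1` is `κ` followed by
`μ₂`. Left unitality of `c_r` for `λ*` thus becomes left unitality of `μ₂` for `λ`.

The two unitors. For `λ*` and `ρ*` the axiom is a triangle identity of `i ⊣ i*`. If `α` is right
unital, `⟨λ*, α, τ⟩` restricted along `1i` and followed by the right unitor of the target is `τ`, up
to an automorphism `unitLoop` of `r_R` made of constraints (`whiskerLeft_midCell_comp`). With `α =
μ₀` this replaces `r⁰` by `ρ*`; with `α = r²` it gives enough to eliminate `unitLoop` without a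
coherence theorem.

Since the monoidal bicategory is not strictified, each of these arguments is a long pasting in which
the constraints are explicit. Pastings are kept as right-bracketed composites: cells act on the head
of a path of 1-cells and leave its tail alone (`t02`, ..., `t23`). The constraints then enter only
through one-variable naturality rules, the normalisation axioms and the exchange law. -/

namespace MonBicat

/-! ### Two-cells followed by a 1-cell, between right-bracketed composites -/

section Trailing

variable {B : Type u} [Bicategory.{w, v} B] {X Y Y' Z W W' V V' : B}

/-- `η ▷ z` for `η : 𝟙 ⟶ f ≫ g`. -/
def t02 {f : X ⟶ Y} {g : Y ⟶ X} (η : 𝟙 X ⟶ f ≫ g) (z : X ⟶ V) : z ⟶ f ≫ g ≫ z :=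
  (λ_ z).inv ≫ η ▷ z ≫ (α_ f g z).hom

/-- `η ▷ z` for `η : h ⟶ f ≫ g`. -/
def t12 {f : X ⟶ Y} {g : Y ⟶ Z} {h : X ⟶ Z} (η : h ⟶ f ≫ g) (z : Z ⟶ V) :
    h ≫ z ⟶ f ≫ g ≫ z :=
  η ▷ z ≫ (α_ f g z).hom

/-- `η ▷ z` for `η : f ≫ g ⟶ h`. -/
def t21 {f : X ⟶ Y} {g : Y ⟶ Z} {h : X ⟶ Z} (η : f ≫ g ⟶ h) (z : Z ⟶ V) :
    f ≫ g ≫ z ⟶ h ≫ z :=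
  (α_ f g z).inv ≫ η ▷ z

/-- `η ▷ z` for `η : f ≫ g ⟶ h ≫ k`. -/
def t22 {f : X ⟶ Y} {g : Y ⟶ Z} {h : X ⟶ W} {k : W ⟶ Z} (η : f ≫ g ⟶ h ≫ k) (z : Z ⟶ V) :
    f ≫ g ≫ z ⟶ h ≫ k ≫ z :=
  (α_ f g z).inv ≫ η ▷ z ≫ (α_ h k z).hom

/-- `η ▷ z` for `η : f ≫ g ≫ h ⟶ k ≫ l`. -/
def t32 {f : X ⟶ Y} {g : Y ⟶ Y'} {h : Y' ⟶ Z} {k : X ⟶ W} {l : W ⟶ Z}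
    (η : f ≫ g ≫ h ⟶ k ≫ l) (z : Z ⟶ V) : f ≫ g ≫ h ≫ z ⟶ k ≫ l ≫ z :=
  f ◁ (α_ g h z).inv ≫ (α_ f (g ≫ h) z).inv ≫ η ▷ z ≫ (α_ k l z).hom

/-- `η ▷ z` for `η : k ≫ l ⟶ f ≫ g ≫ h`. -/
def t23 {f : X ⟶ Y} {g : Y ⟶ Y'} {h : Y' ⟶ Z} {k : X ⟶ W} {l : W ⟶ Z}
    (η : k ≫ l ⟶ f ≫ g ≫ h) (z : Z ⟶ V) : k ≫ l ≫ z ⟶ f ≫ g ≫ h ≫ z :=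
  (α_ k l z).inv ≫ η ▷ z ≫ (α_ f (g ≫ h) z).hom ≫ f ◁ (α_ g h z).hom

variable {z z' : Z ⟶ V} (φ : z ⟶ z')

/-- This and the next five lemmas are the interchange law in right-bracketed form: a cell on the
head of a path commutes with a cell `φ` on its tail. They are the moves by which cells pass each
other in the long computations, with no associator in sight. -/
theorem t02_exchange {f : Z ⟶ Y} {g : Y ⟶ Z} (η : 𝟙 Z ⟶ f ≫ g) :
    t02 η z ≫ f ◁ g ◁ φ = φ ≫ t02 η z' := by
  simp only [t02, Category.assoc, ← associator_naturality_right, ← whisker_exchange_assoc]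
  simp

theorem t12_exchange {f : X ⟶ Y} {g : Y ⟶ Z} {h : X ⟶ Z} (η : h ⟶ f ≫ g) :
    t12 η z ≫ f ◁ g ◁ φ = h ◁ φ ≫ t12 η z' := by
  simp only [t12, Category.assoc, ← associator_naturality_right, ← whisker_exchange_assoc]

theorem t21_exchange {f : X ⟶ Y} {g : Y ⟶ Z} {h : X ⟶ Z} (η : f ≫ g ⟶ h) :
    t21 η z ≫ h ◁ φ = f ◁ g ◁ φ ≫ t21 η z' := by
  simp only [t21, Category.assoc, ← whisker_exchange]
  simp

theorem t22_exchange {f : X ⟶ Y} {g : Y ⟶ Z} {h : X ⟶ W} {k : W ⟶ Z} (η : f ≫ g ⟶ h ≫ k) :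
    t22 η z ≫ h ◁ k ◁ φ = f ◁ g ◁ φ ≫ t22 η z' := by
  simp only [t22, Category.assoc, ← associator_naturality_right, ← whisker_exchange_assoc]
  simp

theorem t32_exchange {f : X ⟶ Y} {g : Y ⟶ Y'} {h : Y' ⟶ Z} {k : X ⟶ W} {l : W ⟶ Z}
    (η : f ≫ g ≫ h ⟶ k ≫ l) :
    t32 η z ≫ k ◁ l ◁ φ = f ◁ g ◁ h ◁ φ ≫ t32 η z' := by
  simp only [t32, Category.assoc, ← associator_naturality_right, ← whisker_exchange_assoc]
  simp

theorem t23_exchange {f : X ⟶ Y} {g : Y ⟶ Y'} {h : Y' ⟶ Z} {k : X ⟶ W} {l : W ⟶ Z}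
    (η : k ≫ l ⟶ f ≫ g ≫ h) :
    t23 η z ≫ f ◁ g ◁ h ◁ φ = k ◁ l ◁ φ ≫ t23 η z' := by
  simp only [t23, Category.assoc, ← whiskerLeft_comp, ← associator_naturality_right]
  simp only [whiskerLeft_comp, ← associator_naturality_right_assoc, ← whisker_exchange_assoc]
  simp

theorem whiskerRight_exchange {f g : X ⟶ Z} (η : f ⟶ g) :
    η ▷ z ≫ g ◁ φ = f ◁ φ ≫ η ▷ z' := (whisker_exchange η φ).symm

theorem t22_comp {f : X ⟶ Y} {g : Y ⟶ Z} {h : X ⟶ W} {k : W ⟶ Z} {p : X ⟶ W'} {q : W' ⟶ Z}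
    (η : f ≫ g ⟶ h ≫ k) (θ : h ≫ k ⟶ p ≫ q) (z : Z ⟶ V) :
    t22 (η ≫ θ) z = t22 η z ≫ t22 θ z := by simp [t22]

theorem t22_id (f : X ⟶ Y) (g : Y ⟶ Z) (z : Z ⟶ V) :
    t22 (𝟙 (f ≫ g)) z = 𝟙 (f ≫ g ≫ z) := by simp [t22]

theorem t22_hom_inv {f : X ⟶ Y} {g : Y ⟶ Z} {h : X ⟶ W} {k : W ⟶ Z} (e : f ≫ g ≅ h ≫ k)
    (z : Z ⟶ V) : t22 e.hom z ≫ t22 e.inv z = 𝟙 _ := by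
  rw [← t22_comp, e.hom_inv_id, t22_id]

theorem t22_inv_hom {f : X ⟶ Y} {g : Y ⟶ Z} {h : X ⟶ W} {k : W ⟶ Z} (e : f ≫ g ≅ h ≫ k)
    (z : Z ⟶ V) : t22 e.inv z ≫ t22 e.hom z = 𝟙 _ := by
  rw [← t22_comp, e.inv_hom_id, t22_id]

theorem t21_t12 {f : X ⟶ Y} {g : Y ⟶ Z} {h : X ⟶ Z} {p : X ⟶ W} {q : W ⟶ Z}
    (η : f ≫ g ⟶ h) (θ : h ⟶ p ≫ q) (z : Z ⟶ V) :
    t21 η z ≫ t12 θ z = t22 (η ≫ θ) z := by simp [t21, t12, t22]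

theorem t12_t21 {f : X ⟶ Y} {g : Y ⟶ Z} {h h' : X ⟶ Z}
    (η : h ⟶ f ≫ g) (θ : f ≫ g ⟶ h') (z : Z ⟶ V) :
    t12 η z ≫ t21 θ z = (η ≫ θ) ▷ z := by simp [t21, t12]

theorem t21_hom_inv {f : X ⟶ Y} {g : Y ⟶ Z} {h : X ⟶ Z} (e : f ≫ g ≅ h) (z : Z ⟶ V) :
    t21 e.hom z ≫ t12 e.inv z = 𝟙 _ := by
  rw [t21_t12, e.hom_inv_id, t22_id]

theorem t21_inv_hom {f : X ⟶ Y} {g : Y ⟶ Z} {h : X ⟶ Z} (e : f ≫ g ≅ h) (z : Z ⟶ V) :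
    t12 e.inv z ≫ t21 e.hom z = 𝟙 _ := by
  rw [t12_t21, e.inv_hom_id, id_whiskerRight]

theorem t32_hom_inv {f : X ⟶ Y} {g : Y ⟶ Y'} {h : Y' ⟶ Z} {k : X ⟶ W} {l : W ⟶ Z}
    (e : f ≫ g ≫ h ≅ k ≫ l) (z : Z ⟶ V) : t32 e.hom z ≫ t23 e.inv z = 𝟙 _ := by
  simp [t32, t23, hom_inv_whiskerRight_assoc]

theorem t32_inv_hom {f : X ⟶ Y} {g : Y ⟶ Y'} {h : Y' ⟶ Z} {k : X ⟶ W} {l : W ⟶ Z}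
    (e : f ≫ g ≫ h ≅ k ≫ l) (z : Z ⟶ V) : t23 e.inv z ≫ t32 e.hom z = 𝟙 _ := by
  simp [t32, t23, inv_hom_whiskerRight_assoc]

end Trailing

end MonBicat

namespace MonBicat

/-! ### Images of 2-cells between composites under a pseudofunctor -/

section Image

variable {B C : Type u} [Bicategory.{w, v} B] [Bicategory.{w, v} C] (F : B ⥤ᵖ C)
  {X Y Y' Z W W' V V' : B}

/-- The image of `η : 𝟙 ⟶ f ≫ g` as a cell `𝟙 ⟶ F f ≫ F g`. -/
def pf02 {f : X ⟶ Y} {g : Y ⟶ X} (η : 𝟙 X ⟶ f ≫ g) : 𝟙 (F.obj X) ⟶ F.map f ≫ F.map g :=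
  (F.mapId X).inv ≫ F.map₂ η ≫ (F.mapComp f g).hom

/-- The image of `η : h ⟶ f ≫ g` as a cell `F h ⟶ F f ≫ F g`. -/
def pf12 {f : X ⟶ Y} {g : Y ⟶ Z} {h : X ⟶ Z} (η : h ⟶ f ≫ g) : F.map h ⟶ F.map f ≫ F.map g :=
  F.map₂ η ≫ (F.mapComp f g).hom

/-- The image of `η : f ≫ g ⟶ h` as a cell `F f ≫ F g ⟶ F h`. -/
def pf21 {f : X ⟶ Y} {g : Y ⟶ Z} {h : X ⟶ Z} (η : f ≫ g ⟶ h) : F.map f ≫ F.map g ⟶ F.map h :=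
  (F.mapComp f g).inv ≫ F.map₂ η

/-- The image of `η : f ≫ g ⟶ h ≫ k` as a cell `F f ≫ F g ⟶ F h ≫ F k`. -/
def pf22 {f : X ⟶ Y} {g : Y ⟶ Z} {h : X ⟶ W} {k : W ⟶ Z} (η : f ≫ g ⟶ h ≫ k) :
    F.map f ≫ F.map g ⟶ F.map h ≫ F.map k :=
  (F.mapComp f g).inv ≫ F.map₂ η ≫ (F.mapComp h k).hom

/-- The image of `η : f ≫ g ≫ h ⟶ k ≫ l` as a cell `F f ≫ F g ≫ F h ⟶ F k ≫ F l`. -/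
def pf32 {f : X ⟶ Y} {g : Y ⟶ Y'} {h : Y' ⟶ Z} {k : X ⟶ W} {l : W ⟶ Z}
    (η : f ≫ g ≫ h ⟶ k ≫ l) : F.map f ≫ F.map g ≫ F.map h ⟶ F.map k ≫ F.map l :=
  F.map f ◁ (F.mapComp g h).inv ≫ (F.mapComp f (g ≫ h)).inv ≫ F.map₂ η ≫ (F.mapComp k l).hom

theorem pf22_hom_inv {f : X ⟶ Y} {g : Y ⟶ Z} {h : X ⟶ W} {k : W ⟶ Z} (e : f ≫ g ≅ h ≫ k) :
    pf22 F e.hom ≫ pf22 F e.inv = 𝟙 _ := by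
  simp [pf22, ← PrelaxFunctor.map₂_comp_assoc]

theorem pf12_inv_hom {f : X ⟶ Y} {g : Y ⟶ Z} {h : X ⟶ Z} (e : f ≫ g ≅ h) :
    pf12 F e.inv ≫ pf21 F e.hom = 𝟙 _ := by
  simp [pf12, pf21, ← PrelaxFunctor.map₂_comp]

theorem pf21_hom_inv {f : X ⟶ Y} {g : Y ⟶ Z} {h : X ⟶ Z} (e : f ≫ g ≅ h) :
    pf21 F e.hom ≫ pf12 F e.inv = 𝟙 _ := by
  simp [pf12, pf21, ← PrelaxFunctor.map₂_comp_assoc]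

/-- A pseudofunctor respects the tail notation up to conjugation by `mapComp`. In a composite of
such images the inner constraints cancel, which is how whole pastings are transported. -/
theorem map₂_t12 {f : X ⟶ Y} {g : Y ⟶ Z} {h : X ⟶ Z} (η : h ⟶ f ≫ g) (z : Z ⟶ V) :
    F.map₂ (t12 η z) = (F.mapComp h z).hom ≫ t12 (pf12 F η) (F.map z) ≫
      F.map f ◁ (F.mapComp g z).inv ≫ (F.mapComp f (g ≫ z)).inv := by
  simp [t12, pf12]

theorem map₂_t21 {f : X ⟶ Y} {g : Y ⟶ Z} {h : X ⟶ Z} (η : f ≫ g ⟶ h) (z : Z ⟶ V) :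
    F.map₂ (t21 η z) = (F.mapComp f (g ≫ z)).hom ≫ F.map f ◁ (F.mapComp g z).hom ≫
      t21 (pf21 F η) (F.map z) ≫ (F.mapComp h z).inv := by
  rw [F.mapComp_assoc_right_hom_assoc]
  simp [t21, pf21, hom_inv_whiskerRight_assoc]

theorem map₂_t22 {f : X ⟶ Y} {g : Y ⟶ Z} {h : X ⟶ W} {k : W ⟶ Z} (η : f ≫ g ⟶ h ≫ k)
    (z : Z ⟶ V) :
    F.map₂ (t22 η z) = (F.mapComp f (g ≫ z)).hom ≫ F.map f ◁ (F.mapComp g z).hom ≫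
      t22 (pf22 F η) (F.map z) ≫
      F.map h ◁ (F.mapComp k z).inv ≫ (F.mapComp h (k ≫ z)).inv := by
  rw [F.mapComp_assoc_right_hom_assoc]
  simp [t22, pf22, hom_inv_whiskerRight_assoc]

theorem map₂_eq_pf21 {f : X ⟶ Y} {g : Y ⟶ Z} {h : X ⟶ Z} (η : f ≫ g ⟶ h) :
    F.map₂ η = (F.mapComp f g).hom ≫ pf21 F η := by simp [pf21]

theorem map₂_eq_pf12 {f : X ⟶ Y} {g : Y ⟶ Z} {h : X ⟶ Z} (η : h ⟶ f ≫ g) :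
    F.map₂ η = pf12 F η ≫ (F.mapComp f g).inv := by simp [pf12]

theorem map₂_eq_pf22 {f : X ⟶ Y} {g : Y ⟶ Z} {h : X ⟶ W} {k : W ⟶ Z} (η : f ≫ g ⟶ h ≫ k) :
    F.map₂ η = (F.mapComp f g).hom ≫ pf22 F η ≫ (F.mapComp h k).inv := by simp [pf22]

theorem map₂_eq_pf32 {f : X ⟶ Y} {g : Y ⟶ Y'} {h : Y' ⟶ Z} {k : X ⟶ W} {l : W ⟶ Z}
    (η : f ≫ g ≫ h ⟶ k ≫ l) :
    F.map₂ η = (F.mapComp f (g ≫ h)).hom ≫ F.map f ◁ (F.mapComp g h).hom ≫ pf32 F η ≫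
      (F.mapComp k l).inv := by simp [pf32]

section Patterns

variable {X₀ X₁ X₂ X₃ X₄ X₅ X₆ X₇ : B}

/-- The shape of a unit condition, stated in an arbitrary bicategory so that it can be transported
along tensoring with an object on either side. Here and in the next three lemmas, `h1` is the image
equation without tail, and whiskering it with `z` gives the result. -/
theorem pf_rightUnital {i : X₀ ⟶ X₁} {a : X₁ ⟶ X₂} {s : X₂ ⟶ X₃} {t : X₃ ⟶ X₄}
    {a' : X₀ ⟶ X₅} {i' : X₅ ⟶ X₂} {r' : X₅ ⟶ X₃} {r : X₀ ⟶ X₃}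
    {t₁ : X₁ ⟶ X₆} {v : X₆ ⟶ X₄} {t₂ : X₀ ⟶ X₇} {i₂ : X₇ ⟶ X₆} {r₂ : X₇ ⟶ X₄}
    {n : i ≫ a ⟶ a' ≫ i'} {s₀ : i' ≫ s ⟶ r'} {ρ : a' ≫ r' ⟶ r} {α : a ≫ s ≫ t ⟶ t₁ ≫ v}
    {c : i ≫ t₁ ⟶ t₂ ≫ i₂} {v₀ : i₂ ≫ v ⟶ r₂} {m : t₂ ≫ r₂ ⟶ r ≫ t}
    (h : t22 n (s ≫ t) ≫ a' ◁ t21 s₀ t ≫ t21 ρ t = i ◁ α ≫ t22 c v ≫ t₂ ◁ v₀ ≫ m)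
    {E : C} (z : F.obj X₄ ⟶ E) :
    t22 (pf22 F n) (F.map s ≫ F.map t ≫ z) ≫ F.map a' ◁ t21 (pf21 F s₀) (F.map t ≫ z) ≫
        t21 (pf21 F ρ) (F.map t ≫ z) =
      F.map i ◁ t32 (pf32 F α) z ≫ t22 (pf22 F c) (F.map v ≫ z) ≫
        F.map t₂ ◁ t21 (pf21 F v₀) z ≫ t22 (pf22 F m) z := by
  have h1 : t22 (pf22 F n) (F.map s ≫ F.map t) ≫ F.map a' ◁ t21 (pf21 F s₀) (F.map t) ≫
        t21 (pf21 F ρ) (F.map t) =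
      F.map i ◁ pf32 F α ≫ t22 (pf22 F c) (F.map v) ≫
        F.map t₂ ◁ pf21 F v₀ ≫ pf22 F m := by
    calc
      _ = F.map i ◁ F.map a ◁ (F.mapComp s t).inv ≫ F.map i ◁ (F.mapComp a (s ≫ t)).inv ≫
          (F.mapComp i (a ≫ s ≫ t)).inv ≫ F.map₂ (t22 n (s ≫ t) ≫ a' ◁ t21 s₀ t ≫ t21 ρ t) ≫
          (F.mapComp r t).hom := by
        simp only [PrelaxFunctor.map₂_comp, map₂_t22, map₂_t21, Pseudofunctor.map₂_whisker_left,
          whiskerLeft_comp, Category.assoc, Iso.inv_hom_id_assoc, whiskerLeft_inv_hom_assoc,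
          Iso.inv_hom_id, Category.comp_id]
        -- Sliding the `mapComp` constraint past the cell brings it next to its inverse.
        rw [← reassoc_of% @t22_exchange]
        simp
      _ = _ := by
        rw [h]
        simp only [PrelaxFunctor.map₂_comp, map₂_t22, Pseudofunctor.map₂_whisker_left,
          map₂_eq_pf32 F α, map₂_eq_pf21 F v₀, map₂_eq_pf22 F m,
          whiskerLeft_comp, Category.assoc, Iso.inv_hom_id_assoc, whiskerLeft_inv_hom_assoc,
          Iso.inv_hom_id, Category.comp_id]
        simp
  calc
    _ = 𝟙 _ ⊗≫ (t22 (pf22 F n) (F.map s ≫ F.map t) ≫ F.map a' ◁ t21 (pf21 F s₀) (F.map t) ≫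
        t21 (pf21 F ρ) (F.map t)) ▷ z ⊗≫ 𝟙 _ := by
      simp only [t22, t21]
      bicategory
    _ = _ := by
      rw [h1]
      simp only [t22, t21, t32]
      bicategory

theorem pf_middleUnit {q : X₀ ⟶ X₁} {t : X₁ ⟶ X₂} {a : X₀ ⟶ X₃} {l : X₃ ⟶ X₁} {i₁ : X₃ ⟶ X₄}
    {s : X₄ ⟶ X₁} {i₂ : X₀ ⟶ X₅} {a₂ : X₅ ⟶ X₄} {t₁ : X₅ ⟶ X₁} {v : X₁ ⟶ X₂}
    {m : q ⟶ a ≫ l} {Λ : l ⟶ i₁ ≫ s} {n : a ≫ i₁ ⟶ i₂ ≫ a₂} {α : a₂ ≫ s ≫ t ⟶ t₁ ≫ v}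
    {ρ : i₂ ≫ t₁ ⟶ q} {κ : t ⟶ v}
    (h : q ◁ κ = t12 m t ≫ a ◁ t12 Λ t ≫ t22 n (s ≫ t) ≫ i₂ ◁ α ≫ t21 ρ v)
    {E : C} (z : F.obj X₂ ⟶ E) :
    F.map q ◁ F.map₂ κ ▷ z = t12 (pf12 F m) (F.map t ≫ z) ≫
      F.map a ◁ t12 (pf12 F Λ) (F.map t ≫ z) ≫ t22 (pf22 F n) (F.map s ≫ F.map t ≫ z) ≫
      F.map i₂ ◁ t32 (pf32 F α) z ≫ t21 (pf21 F ρ) (F.map v ≫ z) := by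
  have h1 : F.map q ◁ F.map₂ κ = t12 (pf12 F m) (F.map t) ≫
      F.map a ◁ t12 (pf12 F Λ) (F.map t) ≫ t22 (pf22 F n) (F.map s ≫ F.map t) ≫
      F.map i₂ ◁ pf32 F α ≫ t21 (pf21 F ρ) (F.map v) := by
    calc
      _ = (F.mapComp q t).inv ≫ F.map₂ (q ◁ κ) ≫ (F.mapComp q v).hom := by simp
      _ = _ := by
        rw [h]
        simp only [PrelaxFunctor.map₂_comp, map₂_t12, map₂_t22, map₂_t21,
          Pseudofunctor.map₂_whisker_left, map₂_eq_pf32 F α,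
          whiskerLeft_comp, Category.assoc, Iso.inv_hom_id_assoc, whiskerLeft_inv_hom_assoc,
          Iso.inv_hom_id, Category.comp_id]
        rw [← reassoc_of% @t22_exchange]
        simp
  calc
    _ = 𝟙 _ ⊗≫ (F.map q ◁ F.map₂ κ) ▷ z ⊗≫ 𝟙 _ := by bicategory
    _ = _ := by
      rw [h1]
      simp only [t12, t22, t21, t32]
      bicategory

theorem pf_leftUnital {a : X₀ ⟶ X₁} {s₁ : X₁ ⟶ X₂} {l : X₂ ⟶ X₃} {l' : X₁ ⟶ X₄} {s : X₄ ⟶ X₃}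
    {l'' : X₀ ⟶ X₄} {j : X₀ ⟶ X₅} {t₁ : X₅ ⟶ X₄} {i : X₂ ⟶ X₆} {t : X₆ ⟶ X₃} {j' : X₁ ⟶ X₇}
    {s₂ : X₇ ⟶ X₆} {a' : X₅ ⟶ X₇} {n : s₁ ≫ l ⟶ l' ≫ s} {m : a ≫ l' ⟶ l''} {Λ : l'' ⟶ j ≫ t₁}
    {Λ' : l ⟶ i ≫ t} {c : s₁ ≫ i ⟶ j' ≫ s₂} {n₁ : a ≫ j' ⟶ j ≫ a'} {α : a' ≫ s₂ ≫ t ⟶ t₁ ≫ s}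
    (h : a ◁ n ≫ t21 m s ≫ t12 Λ s =
      a ◁ s₁ ◁ Λ' ≫ a ◁ t22 c t ≫ t22 n₁ (s₂ ≫ t) ≫ j ◁ α)
    {E : C} (z : F.obj X₃ ⟶ E) :
    F.map a ◁ t22 (pf22 F n) z ≫ t21 (pf21 F m) (F.map s ≫ z) ≫ t12 (pf12 F Λ) (F.map s ≫ z) =
      F.map a ◁ F.map s₁ ◁ t12 (pf12 F Λ') z ≫ F.map a ◁ t22 (pf22 F c) (F.map t ≫ z) ≫
        t22 (pf22 F n₁) (F.map s₂ ≫ F.map t ≫ z) ≫ F.map j ◁ t32 (pf32 F α) z := by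
  have h1 : F.map a ◁ pf22 F n ≫ t21 (pf21 F m) (F.map s) ≫ t12 (pf12 F Λ) (F.map s) =
      F.map a ◁ F.map s₁ ◁ pf12 F Λ' ≫ F.map a ◁ t22 (pf22 F c) (F.map t) ≫
        t22 (pf22 F n₁) (F.map s₂ ≫ F.map t) ≫ F.map j ◁ pf32 F α := by
    calc
      _ = F.map a ◁ (F.mapComp s₁ l).inv ≫ (F.mapComp a (s₁ ≫ l)).inv ≫
          F.map₂ (a ◁ n ≫ t21 m s ≫ t12 Λ s) ≫
          (F.mapComp j (t₁ ≫ s)).hom ≫ F.map j ◁ (F.mapComp t₁ s).hom := by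
        simp only [PrelaxFunctor.map₂_comp, map₂_t12, map₂_t21,
          Pseudofunctor.map₂_whisker_left, map₂_eq_pf22 F n,
          whiskerLeft_comp, Category.assoc, Iso.inv_hom_id_assoc, whiskerLeft_inv_hom_assoc]
        simp
      _ = _ := by
        rw [h]
        simp only [PrelaxFunctor.map₂_comp, map₂_t22,
          Pseudofunctor.map₂_whisker_left, map₂_eq_pf32 F α, map₂_eq_pf12 F Λ',
          whiskerLeft_comp, Category.assoc, Iso.inv_hom_id_assoc, whiskerLeft_inv_hom_assoc]
        rw [← reassoc_of% @t22_exchange]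
        simp
  calc
    _ = 𝟙 _ ⊗≫ (F.map a ◁ pf22 F n ≫ t21 (pf21 F m) (F.map s) ≫
        t12 (pf12 F Λ) (F.map s)) ▷ z ⊗≫ 𝟙 _ := by
      simp only [t12, t22, t21]
      bicategory
    _ = _ := by
      rw [h1]
      simp only [t12, t22, t32]
      bicategory

theorem pf_unitUnit {i₁ : X₀ ⟶ X₁} {l : X₁ ⟶ X₂} {j : X₁ ⟶ X₃} {s : X₃ ⟶ X₂} {j' : X₀ ⟶ X₄}
    {i' : X₄ ⟶ X₃} {r : X₄ ⟶ X₂} {l' r' : X₀ ⟶ X₅} {i : X₅ ⟶ X₂}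
    {Λ : l ⟶ j ≫ s} {c : i₁ ≫ j ⟶ j' ≫ i'} {s₀ : i' ≫ s ⟶ r} {n : i₁ ≫ l ⟶ l' ≫ i}
    {θ : l' ⟶ r'} {m : r' ≫ i ⟶ j' ≫ r}
    (h : i₁ ◁ Λ ≫ t22 c s ≫ j' ◁ s₀ = n ≫ θ ▷ i ≫ m)
    {E : C} (z : F.obj X₂ ⟶ E) :
    F.map i₁ ◁ t12 (pf12 F Λ) z ≫ t22 (pf22 F c) (F.map s ≫ z) ≫ F.map j' ◁ t21 (pf21 F s₀) z =
      t22 (pf22 F n) z ≫ F.map₂ θ ▷ (F.map i ≫ z) ≫ t22 (pf22 F m) z := by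
  have h1 : F.map i₁ ◁ pf12 F Λ ≫ t22 (pf22 F c) (F.map s) ≫ F.map j' ◁ pf21 F s₀ =
      pf22 F n ≫ F.map₂ θ ▷ F.map i ≫ pf22 F m := by
    calc
      _ = (F.mapComp i₁ l).inv ≫ F.map₂ (i₁ ◁ Λ ≫ t22 c s ≫ j' ◁ s₀) ≫ (F.mapComp j' r).hom := by
        simp only [PrelaxFunctor.map₂_comp, map₂_t22,
          Pseudofunctor.map₂_whisker_left, map₂_eq_pf12 F Λ, map₂_eq_pf21 F s₀,
          whiskerLeft_comp, Category.assoc, Iso.inv_hom_id_assoc, whiskerLeft_inv_hom_assoc,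
          Iso.inv_hom_id, Category.comp_id]
      _ = _ := by
        rw [h]
        simp [pf22]
  calc
    _ = 𝟙 _ ⊗≫ (F.map i₁ ◁ pf12 F Λ ≫ t22 (pf22 F c) (F.map s) ≫
        F.map j' ◁ pf21 F s₀) ▷ z ⊗≫ 𝟙 _ := by
      simp only [t12, t22, t21]
      bicategory
    _ = _ := by
      rw [h1]
      simp only [t22]
      bicategory

end Patterns

end Image

end MonBicat

/-! ### The tensor product of 2-cells and the pseudofunctors `U ⊠ -` and `- ⊠ U` -/

namespace MonBicat

section Tensor

variable {B : Type u} [Bicategory.{w, v} B] [TensorStruct B]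

theorem tensorHom₂_comp {X X' Y Y' : B} {f f' f'' : X ⟶ X'} {g g' g'' : Y ⟶ Y'} (η : f ⟶ f')
    (η' : f' ⟶ f'') (θ : g ⟶ g') (θ' : g' ⟶ g'') :
    (η ≫ η') ⊠₂ (θ ≫ θ') = η ⊠₂ θ ≫ η' ⊠₂ θ' :=
  (TensorStruct.tensor (B := B)).map₂_comp (a := (X, Y)) (b := (X', Y')) (f := Prod.mkHom f g)
    (g := Prod.mkHom f' g') (h := Prod.mkHom f'' g'') (Prod.mkHom η θ) (Prod.mkHom η' θ')

theorem tensorHom₂_id {X X' Y Y' : B} (f : X ⟶ X') (g : Y ⟶ Y') :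
    𝟙 f ⊠₂ 𝟙 g = 𝟙 (f ⊠₁ g) :=
  (TensorStruct.tensor (B := B)).map₂_id (a := (X, Y)) (b := (X', Y')) (Prod.mkHom f g)

theorem whiskerLeft_tensorHom₂ {X X' X'' Y Y' Y'' : B} (f : X ⟶ X') {f' f'' : X' ⟶ X''}
    (g : Y ⟶ Y') {g' g'' : Y' ⟶ Y''} (η : f' ⟶ f'') (θ : g' ⟶ g'') :
    (f ◁ η) ⊠₂ (g ◁ θ) = (tensorComp f f' g g').hom ≫ (f ⊠₁ g) ◁ (η ⊠₂ θ) ≫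
      (tensorComp f f'' g g'').inv :=
  (TensorStruct.tensor (B := B)).map₂_whisker_left (a := (X, Y)) (b := (X', Y')) (c := (X'', Y''))
    (Prod.mkHom f g) (g := Prod.mkHom f' g') (h := Prod.mkHom f'' g'') (Prod.mkHom η θ)

theorem tensorHom₂_whiskerRight {X X' X'' Y Y' Y'' : B} {f f' : X ⟶ X'} {g g' : Y ⟶ Y'}
    (η : f ⟶ f') (θ : g ⟶ g') (h : X' ⟶ X'') (k : Y' ⟶ Y'') :
    (η ▷ h) ⊠₂ (θ ▷ k) = (tensorComp f h g k).hom ≫ (η ⊠₂ θ) ▷ (h ⊠₁ k) ≫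
      (tensorComp f' h g' k).inv :=
  (TensorStruct.tensor (B := B)).map₂_whisker_right (a := (X, Y)) (b := (X', Y')) (c := (X'', Y''))
    (f := Prod.mkHom f g) (g := Prod.mkHom f' g') (Prod.mkHom η θ) (Prod.mkHom h k)

theorem leftUnitor_tensorHom₂ {X X' Y Y' : B} (f : X ⟶ X') (g : Y ⟶ Y') :
    (λ_ f).hom ⊠₂ (λ_ g).hom = (tensorComp (𝟙 X) f (𝟙 Y) g).hom ≫
      (tensorId X Y).hom ▷ (f ⊠₁ g) ≫ (λ_ _).hom :=
  (TensorStruct.tensor (B := B)).map₂_left_unitor (a := (X, Y)) (b := (X', Y')) (Prod.mkHom f g)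

theorem rightUnitor_tensorHom₂ {X X' Y Y' : B} (f : X ⟶ X') (g : Y ⟶ Y') :
    (ρ_ f).hom ⊠₂ (ρ_ g).hom = (tensorComp f (𝟙 X') g (𝟙 Y')).hom ≫
      (f ⊠₁ g) ◁ (tensorId X' Y').hom ≫ (ρ_ _).hom :=
  (TensorStruct.tensor (B := B)).map₂_right_unitor (a := (X, Y)) (b := (X', Y')) (Prod.mkHom f g)

/-- Together with the next three lemmas this allows `leftTensor` and `rightTensor` to have `compL`,
`compR` and `tensorId` as constraints by definition, so that images of cells unfold to the
expressions occurring in the axioms. -/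
theorem tensorOnLeft_mapComp (U : B) {X Y Z : B} (f : X ⟶ Y) (g : Y ⟶ Z) :
    (tensorOnLeft (TensorStruct.tensor (B := B)) U).mapComp f g = compL U f g := by
  ext
  change (TensorStruct.tensor (B := B)).map₂ _ ≫ _ = ((λ_ (𝟙 U)).inv ⊠₂ 𝟙 (f ≫ g)) ≫ _
  -- The two sides split `𝟙 U` by different unitors, which agree on an identity.
  rw [unitors_inv_equal]
  rfl

theorem tensorOnRight_mapComp (U : B) {X Y Z : B} (f : X ⟶ Y) (g : Y ⟶ Z) :
    (tensorOnRight (TensorStruct.tensor (B := B)) U).mapComp f g = compR f g U := by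
  ext
  rfl

theorem tensorOnLeft_mapId (U : B) (X : B) :
    (tensorOnLeft (TensorStruct.tensor (B := B)) U).mapId X = tensorId U X := by
  ext
  change (TensorStruct.tensor (B := B)).map₂ (𝟙 _) ≫ _ = _
  rw [PrelaxFunctor.map₂_id]
  exact Category.id_comp _

theorem tensorOnRight_mapId (U : B) (X : B) :
    (tensorOnRight (TensorStruct.tensor (B := B)) U).mapId X = tensorId X U := by
  ext
  change (TensorStruct.tensor (B := B)).map₂ (𝟙 _) ≫ _ = _
  rw [PrelaxFunctor.map₂_id]
  exact Category.id_comp _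

/-- The pseudofunctor `X ↦ U ⊠ X`. -/
abbrev leftTensor (U : B) : B ⥤ᵖ B where
  obj X := U ⊠ X
  map f := 𝟙 U ⊠₁ f
  map₂ η := 𝟙 (𝟙 U) ⊠₂ η
  map₂_id f := (tensorOnLeft TensorStruct.tensor U).map₂_id f
  map₂_comp η θ := (tensorOnLeft TensorStruct.tensor U).map₂_comp η θ
  mapId X := tensorId U X
  mapComp f g := compL U f g
  map₂_whisker_left f g h η := by
    have := (tensorOnLeft TensorStruct.tensor U).map₂_whisker_left f η
    simp only [tensorOnLeft_mapComp] at this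
    exact this
  map₂_whisker_right η h := by
    have := (tensorOnLeft TensorStruct.tensor U).map₂_whisker_right η h
    simp only [tensorOnLeft_mapComp] at this
    exact this
  map₂_associator f g h := by
    have := (tensorOnLeft TensorStruct.tensor U).map₂_associator f g h
    simp only [tensorOnLeft_mapComp] at this
    exact this
  map₂_left_unitor f := by
    have := (tensorOnLeft TensorStruct.tensor U).map₂_left_unitor f
    simp only [tensorOnLeft_mapComp, tensorOnLeft_mapId] at this
    exact this
  map₂_right_unitor f := by
    have := (tensorOnLeft TensorStruct.tensor U).map₂_right_unitor f
    simp only [tensorOnLeft_mapComp, tensorOnLeft_mapId] at this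
    exact this

/-- The pseudofunctor `X ↦ X ⊠ U`. -/
abbrev rightTensor (U : B) : B ⥤ᵖ B where
  obj X := X ⊠ U
  map f := f ⊠₁ 𝟙 U
  map₂ η := η ⊠₂ 𝟙 (𝟙 U)
  map₂_id f := (tensorOnRight TensorStruct.tensor U).map₂_id f
  map₂_comp η θ := (tensorOnRight TensorStruct.tensor U).map₂_comp η θ
  mapId X := tensorId X U
  mapComp f g := compR f g U
  map₂_whisker_left f g h η := by
    have := (tensorOnRight TensorStruct.tensor U).map₂_whisker_left f η
    simp only [tensorOnRight_mapComp] at this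
    exact this
  map₂_whisker_right η h := by
    have := (tensorOnRight TensorStruct.tensor U).map₂_whisker_right η h
    simp only [tensorOnRight_mapComp] at this
    exact this
  map₂_associator f g h := by
    have := (tensorOnRight TensorStruct.tensor U).map₂_associator f g h
    simp only [tensorOnRight_mapComp] at this
    exact this
  map₂_left_unitor f := by
    have := (tensorOnRight TensorStruct.tensor U).map₂_left_unitor f
    simp only [tensorOnRight_mapComp, tensorOnRight_mapId] at this
    exact this
  map₂_right_unitor f := by
    have := (tensorOnRight TensorStruct.tensor U).map₂_right_unitor f
    simp only [tensorOnRight_mapComp, tensorOnRight_mapId] at this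
    exact this

end Tensor
end MonBicat

/-! ### Pseudonaturality with respect to cells between composites -/

namespace MonBicat

section Flip

variable {B : Type u} [Bicategory.{w, v} B] {X Y Z X' Y' Z' V W : B}
  {f : X ⟶ Y} {g : Y ⟶ Z} {h : X ⟶ Z} {f' : X' ⟶ Y'} {g' : Y' ⟶ Z'} {h' : X' ⟶ Z'}
  {m : X ⟶ X'} {n : Y ⟶ Y'} {p : Z ⟶ Z'}
  {Nf : f ≫ n ≅ m ≫ f'} {Ng : g ≫ p ≅ n ≫ g'} {Nh : h ≫ p ≅ m ≫ h'}

theorem nat21_whiskerRight {φ : f ≫ g ⟶ h} {φ' : f' ≫ g' ⟶ h'}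
    (H : t21 φ p ≫ Nh.hom = f ◁ Ng.hom ≫ t22 Nf.hom g' ≫ m ◁ φ') (z : Z' ⟶ V) :
    t21 φ (p ≫ z) ≫ t22 Nh.hom z =
      f ◁ t22 Ng.hom z ≫ t22 Nf.hom (g' ≫ z) ≫ m ◁ t21 φ' z := by
  calc
    _ = 𝟙 _ ⊗≫ (t21 φ p ≫ Nh.hom) ▷ z ⊗≫ 𝟙 _ := by
      simp only [t21, t22]
      bicategory
    _ = _ := by
      rw [H]
      simp only [t21, t22]
      bicategory

/-- Pasting the inverse squares onto both ends turns compatibility with `Nf`, `Ng`, `Nh` into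
compatibility with their inverses. The inverse squares are the ones that occur in the tetrahedron
condition. -/
theorem nat21_inv {φ : f ≫ g ⟶ h} {φ' : f' ≫ g' ⟶ h'}
    (H : t21 φ p ≫ Nh.hom = f ◁ Ng.hom ≫ t22 Nf.hom g' ≫ m ◁ φ') (z : Z' ⟶ V) :
    m ◁ t21 φ' z ≫ t22 Nh.inv z =
      t22 Nf.inv (g' ≫ z) ≫ f ◁ t22 Ng.inv z ≫ t21 φ (p ≫ z) := by
  have H' := nat21_whiskerRight H z
  have h₁ := congrArg (f ◁ ·) (t22_inv_hom Ng z)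
  simp only [whiskerLeft_comp, whiskerLeft_id] at h₁
  calc
    _ = t22 Nf.inv (g' ≫ z) ≫ f ◁ t22 Ng.inv z ≫
        (f ◁ t22 Ng.hom z ≫ t22 Nf.hom (g' ≫ z) ≫ m ◁ t21 φ' z) ≫ t22 Nh.inv z := by
      simp only [Category.assoc]
      rw [reassoc_of% h₁, reassoc_of% t22_inv_hom Nf (g' ≫ z)]
    _ = _ := by
      rw [← H', Category.assoc, t22_hom_inv, Category.comp_id]

theorem nat12_whiskerRight {φ : h ⟶ f ≫ g} {φ' : h' ⟶ f' ≫ g'}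
    (H : Nh.hom ≫ m ◁ φ' = t12 φ p ≫ f ◁ Ng.hom ≫ t22 Nf.hom g') (z : Z' ⟶ V) :
    t22 Nh.hom z ≫ m ◁ t12 φ' z =
      t12 φ (p ≫ z) ≫ f ◁ t22 Ng.hom z ≫ t22 Nf.hom (g' ≫ z) := by
  calc
    _ = 𝟙 _ ⊗≫ (Nh.hom ≫ m ◁ φ') ▷ z ⊗≫ 𝟙 _ := by
      simp only [t12, t22]
      bicategory
    _ = _ := by
      rw [H]
      simp only [t12, t22]
      bicategory

theorem nat22_whiskerRight {k : X ⟶ W} {l : W ⟶ Z} {W' : B} {k' : X' ⟶ W'} {l' : W' ⟶ Z'}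
    {q : W ⟶ W'} {Nk : k ≫ q ≅ m ≫ k'} {Nl : l ≫ p ≅ q ≫ l'}
    {φ : f ≫ g ⟶ k ≫ l} {φ' : f' ≫ g' ⟶ k' ≫ l'}
    (H : t22 φ p ≫ k ◁ Nl.hom ≫ t22 Nk.hom l' = f ◁ Ng.hom ≫ t22 Nf.hom g' ≫ m ◁ φ')
    (z : Z' ⟶ V) :
    t22 φ (p ≫ z) ≫ k ◁ t22 Nl.hom z ≫ t22 Nk.hom (l' ≫ z) =
      f ◁ t22 Ng.hom z ≫ t22 Nf.hom (g' ≫ z) ≫ m ◁ t22 φ' z := by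
  calc
    _ = 𝟙 _ ⊗≫ (t22 φ p ≫ k ◁ Nl.hom ≫ t22 Nk.hom l') ▷ z ⊗≫ 𝟙 _ := by
      simp only [t22]
      bicategory
    _ = _ := by
      rw [H]
      simp only [t22]
      bicategory

theorem nat02_whiskerRight {g : Y ⟶ X} {g' : Y' ⟶ X'} {Ng : g ≫ m ≅ n ≫ g'}
    {φ : 𝟙 X ⟶ f ≫ g} {φ' : 𝟙 X' ⟶ f' ≫ g'}
    (H : t02 φ m ≫ f ◁ Ng.hom ≫ t22 Nf.hom g' = (ρ_ m).inv ≫ m ◁ φ') (z : X' ⟶ V) :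
    t02 φ (m ≫ z) ≫ f ◁ t22 Ng.hom z ≫ t22 Nf.hom (g' ≫ z) = m ◁ t02 φ' z := by
  calc
    _ = 𝟙 _ ⊗≫ (t02 φ m ≫ f ◁ Ng.hom ≫ t22 Nf.hom g') ▷ z ⊗≫ 𝟙 _ := by
      simp only [t02, t22]
      bicategory
    _ = _ := by
      rw [H]
      simp only [t02]
      bicategory

theorem nat02_inv {g : Y ⟶ X} {g' : Y' ⟶ X'} {Ng : g ≫ m ≅ n ≫ g'}
    {φ : 𝟙 X ⟶ f ≫ g} {φ' : 𝟙 X' ⟶ f' ≫ g'}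
    (H : t02 φ m ≫ f ◁ Ng.hom ≫ t22 Nf.hom g' = (ρ_ m).inv ≫ m ◁ φ') (z : X' ⟶ V) :
    m ◁ t02 φ' z ≫ t22 Nf.inv (g' ≫ z) ≫ f ◁ t22 Ng.inv z = t02 φ (m ≫ z) := by
  have h₁ := congrArg (f ◁ ·) (t22_hom_inv Ng z)
  simp only [whiskerLeft_comp, whiskerLeft_id] at h₁
  rw [← nat02_whiskerRight H z]
  simp only [Category.assoc]
  rw [reassoc_of% t22_hom_inv Nf (g' ≫ z), h₁, Category.comp_id]

end Flip

section StrongTrans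

variable {B C : Type u} [Bicategory.{w, v} B] [Bicategory.{w, v} C] {F G : B ⥤ᵖ C} (n : F ⟶ G)
  {X Y Z W : B}

/-- Naturality of `n` in the 2-cell `φ`, with the component of `n` at `f ≫ g` split into those at
`f` and `g`. -/
theorem strongTrans_nat21 {f : X ⟶ Y} {g : Y ⟶ Z} {h : X ⟶ Z} (φ : f ≫ g ⟶ h) :
    t21 (pf21 F φ) (n.app Z) ≫ (n.naturality h).hom =
      F.map f ◁ (n.naturality g).hom ≫ t22 (n.naturality f).hom (G.map g) ≫
        n.app X ◁ pf21 G φ := by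
  have h₁ := n.naturality_naturality φ
  have h₂ : (n.naturality (f ≫ g)).hom = ((F.mapComp f g).hom ▷ n.app Z ≫ (α_ _ _ _).hom ≫
      F.map f ◁ (n.naturality g).hom ≫ t22 (n.naturality f).hom (G.map g)) ≫
      n.app X ◁ (G.mapComp f g).inv := by
    rw [t22, ← n.naturality_comp f g, Category.assoc, ← whiskerLeft_comp, Iso.hom_inv_id, whiskerLeft_id, Category.comp_id]
  simp only [t21, pf21, comp_whiskerRight, Category.assoc, whiskerLeft_comp]
  rw [h₁, h₂]
  simp [inv_hom_whiskerRight_assoc]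

theorem strongTrans_nat12 {f : X ⟶ Y} {g : Y ⟶ Z} {h : X ⟶ Z} (φ : h ⟶ f ≫ g) :
    (n.naturality h).hom ≫ n.app X ◁ pf12 G φ =
      t12 (pf12 F φ) (n.app Z) ≫ F.map f ◁ (n.naturality g).hom ≫
        t22 (n.naturality f).hom (G.map g) := by
  have h₁ := n.naturality_naturality φ
  have h₂ := n.naturality_comp f g
  simp only [t12, t22, pf12, comp_whiskerRight, Category.assoc, whiskerLeft_comp,
    ← reassoc_of% h₁, h₂]

theorem strongTrans_nat02 {f : X ⟶ Y} {g : Y ⟶ X} (φ : 𝟙 X ⟶ f ≫ g) :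
    t02 (pf02 F φ) (n.app X) ≫ F.map f ◁ (n.naturality g).hom ≫
        t22 (n.naturality f).hom (G.map g) = (ρ_ (n.app X)).inv ≫ n.app X ◁ pf02 G φ := by
  have h₁ := strongTrans_nat12 n φ
  have h₂ := n.naturality_id X
  have h₃ : t02 (pf02 F φ) (n.app X) =
      (λ_ (n.app X)).inv ≫ (F.mapId X).inv ▷ n.app X ≫ t12 (pf12 F φ) (n.app X) := by
    simp [t02, pf02, t12, pf12]
  have h₄ : pf02 G φ = (G.mapId X).inv ≫ pf12 G φ := rfl
  rw [h₃]
  simp only [Category.assoc]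
  have h₅ : (n.naturality (𝟙 X)).hom = ((F.mapId X).hom ▷ n.app X ≫ (λ_ (n.app X)).hom ≫
      (ρ_ (n.app X)).inv) ≫ n.app X ◁ (G.mapId X).inv := by
    rw [← h₂, Category.assoc, ← whiskerLeft_comp, Iso.hom_inv_id, whiskerLeft_id, Category.comp_id]
  rw [← h₁, h₅, h₄]
  simp [inv_hom_whiskerRight_assoc]

end StrongTrans

end MonBicat

/-! ### Tensor products of cells between composites, and naturality of the associator in all
variables -/

namespace MonBicat

section TensorCells

variable {B : Type u} [Bicategory.{w, v} B] [TensorStruct B] {X Y Y' Z W : B}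
  {X₁ Y₁ Z₁ W₁ : B}

/-- The tensor product of `φ : 𝟙 ⟶ f ≫ g` and `ψ : 𝟙 ⟶ f₁ ≫ g₁`. -/
def T02 {f : X ⟶ Y} {g : Y ⟶ X} {f₁ : X₁ ⟶ Y₁} {g₁ : Y₁ ⟶ X₁} (φ : 𝟙 X ⟶ f ≫ g)
    (ψ : 𝟙 X₁ ⟶ f₁ ≫ g₁) : 𝟙 (X ⊠ X₁) ⟶ f ⊠₁ f₁ ≫ g ⊠₁ g₁ :=
  (tensorId X X₁).inv ≫ φ ⊠₂ ψ ≫ (tensorComp f g f₁ g₁).hom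

/-- The tensor product of `φ : h ⟶ f ≫ g` and `ψ : h₁ ⟶ f₁ ≫ g₁`. -/
def T12 {f : X ⟶ Y} {g : Y ⟶ Z} {h : X ⟶ Z} {f₁ : X₁ ⟶ Y₁} {g₁ : Y₁ ⟶ Z₁} {h₁ : X₁ ⟶ Z₁}
    (φ : h ⟶ f ≫ g) (ψ : h₁ ⟶ f₁ ≫ g₁) : h ⊠₁ h₁ ⟶ f ⊠₁ f₁ ≫ g ⊠₁ g₁ :=
  φ ⊠₂ ψ ≫ (tensorComp f g f₁ g₁).hom

/-- The tensor product of `φ : f ≫ g ⟶ h` and `ψ : f₁ ≫ g₁ ⟶ h₁`. -/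
def T21 {f : X ⟶ Y} {g : Y ⟶ Z} {h : X ⟶ Z} {f₁ : X₁ ⟶ Y₁} {g₁ : Y₁ ⟶ Z₁} {h₁ : X₁ ⟶ Z₁}
    (φ : f ≫ g ⟶ h) (ψ : f₁ ≫ g₁ ⟶ h₁) : f ⊠₁ f₁ ≫ g ⊠₁ g₁ ⟶ h ⊠₁ h₁ :=
  (tensorComp f g f₁ g₁).inv ≫ φ ⊠₂ ψ

/-- The tensor product of `φ : f ≫ g ⟶ h ≫ k` and `ψ : f₁ ≫ g₁ ⟶ h₁ ≫ k₁`. -/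
def T22 {f : X ⟶ Y} {g : Y ⟶ Z} {h : X ⟶ W} {k : W ⟶ Z} {f₁ : X₁ ⟶ Y₁} {g₁ : Y₁ ⟶ Z₁}
    {h₁ : X₁ ⟶ W₁} {k₁ : W₁ ⟶ Z₁} (φ : f ≫ g ⟶ h ≫ k) (ψ : f₁ ≫ g₁ ⟶ h₁ ≫ k₁) :
    f ⊠₁ f₁ ≫ g ⊠₁ g₁ ⟶ h ⊠₁ h₁ ≫ k ⊠₁ k₁ :=
  (tensorComp f g f₁ g₁).inv ≫ φ ⊠₂ ψ ≫ (tensorComp h k h₁ k₁).hom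

/-- Tensoring with an object is tensoring with a unitor of its identity arrow. One-variable
statements thereby become instances of the symmetric ones for `T02`, `T12`, `T21`, `T22`. -/
theorem pf21_rightTensor (U : B) {f : X ⟶ Y} {g : Y ⟶ Z} {h : X ⟶ Z} (φ : f ≫ g ⟶ h) :
    pf21 (rightTensor U) φ = T21 φ (λ_ (𝟙 U)).hom := by
  change ((tensorComp f g (𝟙 U) (𝟙 U)).inv ≫ 𝟙 _ ⊠₂ (λ_ (𝟙 U)).hom) ≫ φ ⊠₂ 𝟙 (𝟙 U) = _
  rw [Category.assoc, ← tensorHom₂_comp, Category.id_comp, Category.comp_id]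
  rfl

theorem pf12_rightTensor (U : B) {f : X ⟶ Y} {g : Y ⟶ Z} {h : X ⟶ Z} (φ : h ⟶ f ≫ g) :
    pf12 (rightTensor U) φ = T12 φ (λ_ (𝟙 U)).inv := by
  change φ ⊠₂ 𝟙 (𝟙 U) ≫ 𝟙 _ ⊠₂ (λ_ (𝟙 U)).inv ≫ (tensorComp f g (𝟙 U) (𝟙 U)).hom = _
  rw [← Category.assoc, ← tensorHom₂_comp, Category.id_comp, Category.comp_id]
  rfl

theorem pf02_rightTensor (U : B) {f : X ⟶ Y} {g : Y ⟶ X} (φ : 𝟙 X ⟶ f ≫ g) :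
    pf02 (rightTensor U) φ = T02 φ (λ_ (𝟙 U)).inv := by
  change (tensorId X U).inv ≫ pf12 (rightTensor U) φ = _
  rw [pf12_rightTensor]
  rfl

theorem pf22_rightTensor (U : B) {f : X ⟶ Y} {g : Y ⟶ Z} {h : X ⟶ W} {k : W ⟶ Z}
    (φ : f ≫ g ⟶ h ≫ k) : pf22 (rightTensor U) φ = T22 φ (𝟙 (𝟙 U ≫ 𝟙 U)) := by
  change ((tensorComp f g (𝟙 U) (𝟙 U)).inv ≫ 𝟙 _ ⊠₂ (λ_ (𝟙 U)).hom) ≫ φ ⊠₂ 𝟙 (𝟙 U) ≫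
    𝟙 _ ⊠₂ (λ_ (𝟙 U)).inv ≫ (tensorComp h k (𝟙 U) (𝟙 U)).hom = _
  rw [← Category.assoc (φ ⊠₂ 𝟙 (𝟙 U)), ← tensorHom₂_comp, Category.assoc, ← Category.assoc (_ ⊠₂ _),
    ← tensorHom₂_comp, Category.comp_id, Category.id_comp, Category.id_comp, Iso.hom_inv_id]
  rfl

theorem pf21_leftTensor (U : B) {f : X ⟶ Y} {g : Y ⟶ Z} {h : X ⟶ Z} (φ : f ≫ g ⟶ h) :
    pf21 (leftTensor U) φ = T21 (λ_ (𝟙 U)).hom φ := by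
  change ((tensorComp (𝟙 U) (𝟙 U) f g).inv ≫ (λ_ (𝟙 U)).hom ⊠₂ 𝟙 _) ≫ 𝟙 (𝟙 U) ⊠₂ φ = _
  rw [Category.assoc, ← tensorHom₂_comp, Category.id_comp, Category.comp_id]
  rfl

theorem pf12_leftTensor (U : B) {f : X ⟶ Y} {g : Y ⟶ Z} {h : X ⟶ Z} (φ : h ⟶ f ≫ g) :
    pf12 (leftTensor U) φ = T12 (λ_ (𝟙 U)).inv φ := by
  change 𝟙 (𝟙 U) ⊠₂ φ ≫ (λ_ (𝟙 U)).inv ⊠₂ 𝟙 _ ≫ (tensorComp (𝟙 U) (𝟙 U) f g).hom = _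
  rw [← Category.assoc, ← tensorHom₂_comp, Category.id_comp, Category.comp_id]
  rfl

theorem pf22_leftTensor (U : B) {f : X ⟶ Y} {g : Y ⟶ Z} {h : X ⟶ W} {k : W ⟶ Z}
    (φ : f ≫ g ⟶ h ≫ k) : pf22 (leftTensor U) φ = T22 (𝟙 (𝟙 U ≫ 𝟙 U)) φ := by
  change ((tensorComp (𝟙 U) (𝟙 U) f g).inv ≫ (λ_ (𝟙 U)).hom ⊠₂ 𝟙 _) ≫ 𝟙 (𝟙 U) ⊠₂ φ ≫
    (λ_ (𝟙 U)).inv ⊠₂ 𝟙 _ ≫ (tensorComp (𝟙 U) (𝟙 U) h k).hom = _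
  rw [← Category.assoc (𝟙 (𝟙 U) ⊠₂ φ), ← tensorHom₂_comp, Category.assoc, ← Category.assoc (_ ⊠₂ _),
    ← tensorHom₂_comp, Category.comp_id, Category.id_comp, Category.id_comp, Iso.hom_inv_id]
  rfl

/-! ### Naturality of the tensor product of cells -/

theorem tensorComp_inv_whiskerRight {f f' : X ⟶ Y} {f₁ f₁' : X₁ ⟶ Y₁} (η : f ⟶ f') (θ : f₁ ⟶ f₁')
    (g : Y ⟶ Z) (g₁ : Y₁ ⟶ Z₁) :
    (tensorComp f g f₁ g₁).inv ≫ (η ▷ g) ⊠₂ (θ ▷ g₁) =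
      (η ⊠₂ θ) ▷ (g ⊠₁ g₁) ≫ (tensorComp f' g f₁' g₁).inv := by
  rw [tensorHom₂_whiskerRight, Iso.inv_hom_id_assoc]

theorem tensorComp_inv_whiskerLeft (f : X ⟶ Y) (f₁ : X₁ ⟶ Y₁) {g g' : Y ⟶ Z} {g₁ g₁' : Y₁ ⟶ Z₁}
    (η : g ⟶ g') (θ : g₁ ⟶ g₁') :
    (tensorComp f g f₁ g₁).inv ≫ (f ◁ η) ⊠₂ (f₁ ◁ θ) =
      (f ⊠₁ f₁) ◁ (η ⊠₂ θ) ≫ (tensorComp f g' f₁ g₁').inv := by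
  rw [whiskerLeft_tensorHom₂, Iso.inv_hom_id_assoc]

theorem tensorComp_hom_whiskerRight {f f' : X ⟶ Y} {f₁ f₁' : X₁ ⟶ Y₁} (η : f ⟶ f') (θ : f₁ ⟶ f₁')
    (g : Y ⟶ Z) (g₁ : Y₁ ⟶ Z₁) :
    (η ▷ g) ⊠₂ (θ ▷ g₁) ≫ (tensorComp f' g f₁' g₁).hom =
      (tensorComp f g f₁ g₁).hom ≫ (η ⊠₂ θ) ▷ (g ⊠₁ g₁) := by
  rw [tensorHom₂_whiskerRight, Category.assoc, Category.assoc, Iso.inv_hom_id, Category.comp_id]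

theorem tensorComp_hom_whiskerLeft (f : X ⟶ Y) (f₁ : X₁ ⟶ Y₁) {g g' : Y ⟶ Z} {g₁ g₁' : Y₁ ⟶ Z₁}
    (η : g ⟶ g') (θ : g₁ ⟶ g₁') :
    (f ◁ η) ⊠₂ (f₁ ◁ θ) ≫ (tensorComp f g' f₁ g₁').hom =
      (tensorComp f g f₁ g₁).hom ≫ (f ⊠₁ f₁) ◁ (η ⊠₂ θ) := by
  rw [whiskerLeft_tensorHom₂, Category.assoc, Category.assoc, Iso.inv_hom_id, Category.comp_id]

theorem T21_leftUnitor (f : X ⟶ Y) (f₁ : X₁ ⟶ Y₁) :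
    T21 (λ_ f).hom (λ_ f₁).hom = (tensorId X X₁).hom ▷ (f ⊠₁ f₁) ≫ (λ_ _).hom := by
  rw [T21, leftUnitor_tensorHom₂, Iso.inv_hom_id_assoc]

theorem T21_rightUnitor (f : X ⟶ Y) (f₁ : X₁ ⟶ Y₁) :
    T21 (ρ_ f).hom (ρ_ f₁).hom = (f ⊠₁ f₁) ◁ (tensorId Y Y₁).hom ≫ (ρ_ _).hom := by
  rw [T21, rightUnitor_tensorHom₂, Iso.inv_hom_id_assoc]

theorem tensorHom₂_hom_inv {f f' : X ⟶ Y} {f₁ f₁' : X₁ ⟶ Y₁} (e : f ≅ f') (e₁ : f₁ ≅ f₁') :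
    e.hom ⊠₂ e₁.hom ≫ e.inv ⊠₂ e₁.inv = 𝟙 _ := by
  rw [← tensorHom₂_comp, Iso.hom_inv_id, Iso.hom_inv_id, tensorHom₂_id]

theorem T21_T12_hom_inv {f : X ⟶ Y} {g : Y ⟶ Z} {h : X ⟶ Z} {f₁ : X₁ ⟶ Y₁} {g₁ : Y₁ ⟶ Z₁}
    {h₁ : X₁ ⟶ Z₁} (e : f ≫ g ≅ h) (e₁ : f₁ ≫ g₁ ≅ h₁) :
    T21 e.hom e₁.hom ≫ T12 e.inv e₁.inv = 𝟙 _ := by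
  rw [T21, T12, Category.assoc, reassoc_of% tensorHom₂_hom_inv e e₁, Iso.inv_hom_id]

theorem T12_leftUnitor (f : X ⟶ Y) (f₁ : X₁ ⟶ Y₁) :
    T12 (λ_ f).inv (λ_ f₁).inv = (λ_ _).inv ≫ (tensorId X X₁).inv ▷ (f ⊠₁ f₁) := by
  have h := T21_T12_hom_inv (λ_ f) (λ_ f₁)
  rw [T21_leftUnitor, Category.assoc] at h
  rw [← cancel_epi (λ_ (f ⊠₁ f₁)).hom, ← cancel_epi ((tensorId X X₁).hom ▷ (f ⊠₁ f₁)), h,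
    Iso.hom_inv_id_assoc, hom_inv_whiskerRight]

theorem T12_rightUnitor (f : X ⟶ Y) (f₁ : X₁ ⟶ Y₁) :
    T12 (ρ_ f).inv (ρ_ f₁).inv = (ρ_ _).inv ≫ (f ⊠₁ f₁) ◁ (tensorId Y Y₁).inv := by
  have h := T21_T12_hom_inv (ρ_ f) (ρ_ f₁)
  rw [T21_rightUnitor, Category.assoc] at h
  rw [← cancel_epi (ρ_ (f ⊠₁ f₁)).hom, ← cancel_epi ((f ⊠₁ f₁) ◁ (tensorId Y Y₁).hom), h,
    Iso.hom_inv_id_assoc, whiskerLeft_hom_inv]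

/-- An identity square is a right unitor followed by an inverse left unitor, and the tensor product
preserves both up to `tensorId`. -/
theorem T22_idSq (f : X ⟶ Y) (f₁ : X₁ ⟶ Y₁) :
    T22 (idSq f).hom (idSq f₁).hom =
      (f ⊠₁ f₁) ◁ (tensorId Y Y₁).hom ≫ (idSq (f ⊠₁ f₁)).hom ≫
        (tensorId X X₁).inv ▷ (f ⊠₁ f₁) := by
  have h : T22 (idSq f).hom (idSq f₁).hom =
      T21 (ρ_ f).hom (ρ_ f₁).hom ≫ T12 (λ_ f).inv (λ_ f₁).inv := by
    simp only [T22, T21, T12, idSq, Iso.trans_hom, Iso.symm_hom, tensorHom₂_comp, Category.assoc]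
  rw [h, T21_rightUnitor, T12_leftUnitor]
  simp [idSq]

theorem T22_idSq_inv (f : X ⟶ Y) (f₁ : X₁ ⟶ Y₁) :
    T22 (idSq f).inv (idSq f₁).inv =
      (tensorId X X₁).hom ▷ (f ⊠₁ f₁) ≫ (idSq (f ⊠₁ f₁)).inv ≫
        (f ⊠₁ f₁) ◁ (tensorId Y Y₁).inv := by
  have h : T22 (idSq f).inv (idSq f₁).inv =
      T21 (λ_ f).hom (λ_ f₁).hom ≫ T12 (ρ_ f).inv (ρ_ f₁).inv := by
    simp only [T22, T21, T12, idSq, Iso.trans_inv, Iso.symm_inv, tensorHom₂_comp, Category.assoc]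
  rw [h, T21_leftUnitor, T12_rightUnitor]
  simp [idSq]

/-- Interchange is the tensor product of two identity squares taken in opposite directions. Its
naturality can therefore be checked in each factor separately, where it is coherence of unitors. -/
theorem interchange_hom {X X' Y Y' : B} (f : X ⟶ X') (g : Y ⟶ Y') :
    (interchange f g).hom = T22 (idSq f).hom (idSq g).inv := rfl

theorem interchange_inv {X X' Y Y' : B} (f : X ⟶ X') (g : Y ⟶ Y') :
    (interchange f g).inv = T22 (idSq f).inv (idSq g).hom := by
  change ((tensorComp _ _ _ _).inv ≫ _ ⊠₂ _) ≫ _ = _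
  rw [Category.assoc]
  rfl

theorem tensorSq_hom {X X' Y Y' Z Z' W W' : B} {f : X ⟶ X'} {b : X' ⟶ Y'} {p : X ⟶ Y} {f' : Y ⟶ Y'}
    {g : Z ⟶ Z'} {d : Z' ⟶ W'} {q : Z ⟶ W} {g' : W ⟶ W'}
    (σ : f ≫ b ≅ p ≫ f') (τ : g ≫ d ≅ q ≫ g') : (tensorSq σ τ).hom = T22 σ.hom τ.hom := rfl

end TensorCells

section Associator

variable {B : Type u} [Bicategory.{w, v} B] [TensorStruct B] {X Y Z W X₁ Y₁ Z₁ W₁ X₂ Y₂ Z₂ W₂ : B}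

/-- `strongTrans_nat21` for the associativity transformation; `e₁` and `e₂` identify the two
bracketings of the tensored cells with the images under `tripleLeft` and `tripleRight`. -/
theorem aNat_nat21 {f : X ⟶ Y} {g : Y ⟶ Z} {h : X ⟶ Z} {f₁ : X₁ ⟶ Y₁} {g₁ : Y₁ ⟶ Z₁}
    {h₁ : X₁ ⟶ Z₁} {f₂ : X₂ ⟶ Y₂} {g₂ : Y₂ ⟶ Z₂} {h₂ : X₂ ⟶ Z₂} (φ : f ≫ g ⟶ h)
    (φ₁ : f₁ ≫ g₁ ⟶ h₁) (φ₂ : f₂ ≫ g₂ ⟶ h₂) :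
    t21 (T21 (T21 φ φ₁) φ₂) (a Z Z₁ Z₂) ≫ (aNat h h₁ h₂).hom =
      ((f ⊠₁ f₁) ⊠₁ f₂) ◁ (aNat g g₁ g₂).hom ≫ t22 (aNat f f₁ f₂).hom (g ⊠₁ (g₁ ⊠₁ g₂)) ≫
        a X X₁ X₂ ◁ T21 φ (T21 φ₁ φ₂) := by
  have H := strongTrans_nat21 (TensorStruct.assoc (B := B)).hom
    (X := ((X, X₁), X₂)) (Y := ((Y, Y₁), Y₂)) (Z := ((Z, Z₁), Z₂))
    (f := Prod.mkHom (Prod.mkHom f f₁) f₂) (g := Prod.mkHom (Prod.mkHom g g₁) g₂)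
    (h := Prod.mkHom (Prod.mkHom h h₁) h₂) (Prod.mkHom (Prod.mkHom φ φ₁) φ₂)
  have e₁ : T21 (T21 φ φ₁) φ₂ = pf21 (tripleLeft (TensorStruct.tensor (B := B)))
      (X := ((X, X₁), X₂)) (Y := ((Y, Y₁), Y₂)) (Z := ((Z, Z₁), Z₂))
      (f := Prod.mkHom (Prod.mkHom f f₁) f₂) (g := Prod.mkHom (Prod.mkHom g g₁) g₂)
      (h := Prod.mkHom (Prod.mkHom h h₁) h₂) (Prod.mkHom (Prod.mkHom φ φ₁) φ₂) := by
    change _ = ((tensorComp (f ⊠₁ f₁) (g ⊠₁ g₁) f₂ g₂).inv ≫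
      (tensorComp f g f₁ g₁).inv ⊠₂ 𝟙 (f₂ ≫ g₂)) ≫ (φ ⊠₂ φ₁) ⊠₂ φ₂
    rw [Category.assoc, ← tensorHom₂_comp, Category.id_comp]
    rfl
  have e₂ : T21 φ (T21 φ₁ φ₂) = pf21 (tripleRight (TensorStruct.tensor (B := B)))
      (X := ((X, X₁), X₂)) (Y := ((Y, Y₁), Y₂)) (Z := ((Z, Z₁), Z₂))
      (f := Prod.mkHom (Prod.mkHom f f₁) f₂) (g := Prod.mkHom (Prod.mkHom g g₁) g₂)
      (h := Prod.mkHom (Prod.mkHom h h₁) h₂) (Prod.mkHom (Prod.mkHom φ φ₁) φ₂) := by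
    change _ = (((tensorComp f g (f₁ ⊠₁ f₂) (g₁ ⊠₁ g₂)).inv ≫
      𝟙 (f ≫ g) ⊠₂ (tensorComp f₁ g₁ f₂ g₂).inv) ≫ 𝟙 (f ≫ g) ⊠₂ (𝟙 (f₁ ≫ g₁) ⊠₂ 𝟙 (f₂ ≫ g₂))) ≫
      φ ⊠₂ (φ₁ ⊠₂ φ₂)
    simp only [Category.assoc]
    rw [← tensorHom₂_comp, ← tensorHom₂_comp, ← tensorHom₂_comp, Category.id_comp, Category.id_comp,
      Category.id_comp, Category.id_comp]
    rfl
  rw [e₁, e₂]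
  exact H

theorem aNat_nat12 {f : X ⟶ Y} {g : Y ⟶ Z} {h : X ⟶ Z} {f₁ : X₁ ⟶ Y₁} {g₁ : Y₁ ⟶ Z₁}
    {h₁ : X₁ ⟶ Z₁} {f₂ : X₂ ⟶ Y₂} {g₂ : Y₂ ⟶ Z₂} {h₂ : X₂ ⟶ Z₂} (φ : h ⟶ f ≫ g)
    (φ₁ : h₁ ⟶ f₁ ≫ g₁) (φ₂ : h₂ ⟶ f₂ ≫ g₂) :
    (aNat h h₁ h₂).hom ≫ a X X₁ X₂ ◁ T12 φ (T12 φ₁ φ₂) =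
      t12 (T12 (T12 φ φ₁) φ₂) (a Z Z₁ Z₂) ≫
      ((f ⊠₁ f₁) ⊠₁ f₂) ◁ (aNat g g₁ g₂).hom ≫ t22 (aNat f f₁ f₂).hom (g ⊠₁ (g₁ ⊠₁ g₂)) := by
  have H := strongTrans_nat12 (TensorStruct.assoc (B := B)).hom
    (X := ((X, X₁), X₂)) (Y := ((Y, Y₁), Y₂)) (Z := ((Z, Z₁), Z₂))
    (f := Prod.mkHom (Prod.mkHom f f₁) f₂) (g := Prod.mkHom (Prod.mkHom g g₁) g₂)
    (h := Prod.mkHom (Prod.mkHom h h₁) h₂) (Prod.mkHom (Prod.mkHom φ φ₁) φ₂)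
  have e₁ : T12 (T12 φ φ₁) φ₂ = pf12 (tripleLeft (TensorStruct.tensor (B := B)))
      (X := ((X, X₁), X₂)) (Y := ((Y, Y₁), Y₂)) (Z := ((Z, Z₁), Z₂))
      (f := Prod.mkHom (Prod.mkHom f f₁) f₂) (g := Prod.mkHom (Prod.mkHom g g₁) g₂)
      (h := Prod.mkHom (Prod.mkHom h h₁) h₂) (Prod.mkHom (Prod.mkHom φ φ₁) φ₂) := by
    change _ = (φ ⊠₂ φ₁) ⊠₂ φ₂ ≫ (tensorComp f g f₁ g₁).hom ⊠₂ 𝟙 (f₂ ≫ g₂) ≫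
      (tensorComp (f ⊠₁ f₁) (g ⊠₁ g₁) f₂ g₂).hom
    rw [← Category.assoc, ← tensorHom₂_comp, Category.comp_id]
    rfl
  have e₂ : T12 φ (T12 φ₁ φ₂) = pf12 (tripleRight (TensorStruct.tensor (B := B)))
      (X := ((X, X₁), X₂)) (Y := ((Y, Y₁), Y₂)) (Z := ((Z, Z₁), Z₂))
      (f := Prod.mkHom (Prod.mkHom f f₁) f₂) (g := Prod.mkHom (Prod.mkHom g g₁) g₂)
      (h := Prod.mkHom (Prod.mkHom h h₁) h₂) (Prod.mkHom (Prod.mkHom φ φ₁) φ₂) := by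
    change _ = φ ⊠₂ (φ₁ ⊠₂ φ₂) ≫ 𝟙 (f ≫ g) ⊠₂ (𝟙 (f₁ ≫ g₁) ⊠₂ 𝟙 (f₂ ≫ g₂)) ≫
      𝟙 (f ≫ g) ⊠₂ (tensorComp f₁ g₁ f₂ g₂).hom ≫ (tensorComp f g (f₁ ⊠₁ f₂) (g₁ ⊠₁ g₂)).hom
    rw [tensorHom₂_id, tensorHom₂_id, Category.id_comp, ← Category.assoc, ← tensorHom₂_comp,
      Category.comp_id]
    rfl
  rw [e₁, e₂]
  exact H

/-- A `T22` factors as a `T21` of identities followed by a `T12`, so the two preceding lemmas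
compose. -/
theorem aNat_nat22 {f : X ⟶ Y} {g : Y ⟶ Z} {h : X ⟶ W} {k : W ⟶ Z} {f₁ : X₁ ⟶ Y₁} {g₁ : Y₁ ⟶ Z₁}
    {h₁ : X₁ ⟶ W₁} {k₁ : W₁ ⟶ Z₁} {f₂ : X₂ ⟶ Y₂} {g₂ : Y₂ ⟶ Z₂} {h₂ : X₂ ⟶ W₂} {k₂ : W₂ ⟶ Z₂}
    (φ : f ≫ g ⟶ h ≫ k) (φ₁ : f₁ ≫ g₁ ⟶ h₁ ≫ k₁) (φ₂ : f₂ ≫ g₂ ⟶ h₂ ≫ k₂) :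
    t22 (T22 (T22 φ φ₁) φ₂) (a Z Z₁ Z₂) ≫ ((h ⊠₁ h₁) ⊠₁ h₂) ◁ (aNat k k₁ k₂).hom ≫
        t22 (aNat h h₁ h₂).hom (k ⊠₁ (k₁ ⊠₁ k₂)) =
      ((f ⊠₁ f₁) ⊠₁ f₂) ◁ (aNat g g₁ g₂).hom ≫ t22 (aNat f f₁ f₂).hom (g ⊠₁ (g₁ ⊠₁ g₂)) ≫
        a X X₁ X₂ ◁ T22 φ (T22 φ₁ φ₂) := by
  have h₁ := aNat_nat12 φ φ₁ φ₂
  have h₂ := aNat_nat21 (𝟙 (f ≫ g)) (𝟙 (f₁ ≫ g₁)) (𝟙 (f₂ ≫ g₂))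
  have e {X Y Z W X₁ Y₁ Z₁ W₁ : B} {f : X ⟶ Y} {g : Y ⟶ Z} {h : X ⟶ W} {k : W ⟶ Z} {f₁ : X₁ ⟶ Y₁}
      {g₁ : Y₁ ⟶ Z₁} {h₁ : X₁ ⟶ W₁} {k₁ : W₁ ⟶ Z₁} (φ : f ≫ g ⟶ h ≫ k)
      (φ₁ : f₁ ≫ g₁ ⟶ h₁ ≫ k₁) : T22 φ φ₁ = T21 (𝟙 _) (𝟙 _) ≫ T12 φ φ₁ := by
    rw [T22, T21, T12, tensorHom₂_id, Category.comp_id]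
  have e' {X Y Z W X₁ Y₁ Z₁ W₁ : B} {f : X ⟶ Y} {g : Y ⟶ Z} {h : X ⟶ W} {k : W ⟶ Z} {p : X ⟶ Z}
      {f₁ : X₁ ⟶ Y₁} {g₁ : Y₁ ⟶ Z₁} {h₁ : X₁ ⟶ W₁} {k₁ : W₁ ⟶ Z₁} {p₁ : X₁ ⟶ Z₁}
      (φ : f ≫ g ⟶ p) (ψ : p ⟶ h ≫ k) (φ₁ : f₁ ≫ g₁ ⟶ p₁) (ψ₁ : p₁ ⟶ h₁ ≫ k₁) :
      T22 (φ ≫ ψ) (φ₁ ≫ ψ₁) = T21 φ φ₁ ≫ T12 ψ ψ₁ := by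
    rw [T22, T21, T12, tensorHom₂_comp, Category.assoc, Category.assoc]
  have e₁ : T22 (T22 φ φ₁) φ₂ = T21 (T21 (𝟙 _) (𝟙 _)) (𝟙 _) ≫ T12 (T12 φ φ₁) φ₂ := by
    rw [← e', ← e, Category.id_comp]
  have e₂ : T22 φ (T22 φ₁ φ₂) = T21 (𝟙 _) (T21 (𝟙 _) (𝟙 _)) ≫ T12 φ (T12 φ₁ φ₂) := by
    rw [← e', ← e, Category.id_comp]
  rw [e₁, ← t21_t12, Category.assoc, ← h₁, reassoc_of% h₂, e₂, whiskerLeft_comp]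

end Associator

end MonBicat

/-! ### Naturality of the associator in one variable at a time -/

namespace MonBicat

section Associator

variable {B : Type u} [Bicategory.{w, v} B] [TensorStruct B] {X Y Z W X₁ Y₁ Z₁ W₁ X₂ Y₂ Z₂ W₂ : B}

theorem aNat_nat02 {f : X ⟶ Y} {g : Y ⟶ X} {f₁ : X₁ ⟶ Y₁} {g₁ : Y₁ ⟶ X₁}
    {f₂ : X₂ ⟶ Y₂} {g₂ : Y₂ ⟶ X₂} (φ : 𝟙 X ⟶ f ≫ g)
    (φ₁ : 𝟙 X₁ ⟶ f₁ ≫ g₁) (φ₂ : 𝟙 X₂ ⟶ f₂ ≫ g₂) :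
    t02 (T02 (T02 φ φ₁) φ₂) (a X X₁ X₂) ≫
      ((f ⊠₁ f₁) ⊠₁ f₂) ◁ (aNat g g₁ g₂).hom ≫ t22 (aNat f f₁ f₂).hom (g ⊠₁ (g₁ ⊠₁ g₂)) =
      (ρ_ _).inv ≫ a X X₁ X₂ ◁ T02 φ (T02 φ₁ φ₂) := by
  have H := strongTrans_nat02 (TensorStruct.assoc (B := B)).hom
    (X := ((X, X₁), X₂)) (Y := ((Y, Y₁), Y₂))
    (f := Prod.mkHom (Prod.mkHom f f₁) f₂) (g := Prod.mkHom (Prod.mkHom g g₁) g₂)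
    (Prod.mkHom (Prod.mkHom φ φ₁) φ₂)
  have e₁ : T02 (T02 φ φ₁) φ₂ = pf02 (tripleLeft (TensorStruct.tensor (B := B)))
      (X := ((X, X₁), X₂)) (Y := ((Y, Y₁), Y₂))
      (f := Prod.mkHom (Prod.mkHom f f₁) f₂) (g := Prod.mkHom (Prod.mkHom g g₁) g₂)
      (Prod.mkHom (Prod.mkHom φ φ₁) φ₂) := by
    change _ = ((tensorId (X ⊠ X₁) X₂).inv ≫ (tensorId X X₁).inv ⊠₂ 𝟙 (𝟙 X₂)) ≫ (φ ⊠₂ φ₁) ⊠₂ φ₂ ≫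
      (tensorComp f g f₁ g₁).hom ⊠₂ 𝟙 (f₂ ≫ g₂) ≫ (tensorComp (f ⊠₁ f₁) (g ⊠₁ g₁) f₂ g₂).hom
    rw [← Category.assoc ((φ ⊠₂ φ₁) ⊠₂ φ₂), ← tensorHom₂_comp, Category.comp_id, Category.assoc,
      ← Category.assoc (_ ⊠₂ _), ← tensorHom₂_comp, Category.id_comp]
    rfl
  have e₂ : T02 φ (T02 φ₁ φ₂) = pf02 (tripleRight (TensorStruct.tensor (B := B)))
      (X := ((X, X₁), X₂)) (Y := ((Y, Y₁), Y₂))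
      (f := Prod.mkHom (Prod.mkHom f f₁) f₂) (g := Prod.mkHom (Prod.mkHom g g₁) g₂)
      (Prod.mkHom (Prod.mkHom φ φ₁) φ₂) := by
    change _ = (((tensorId X (X₁ ⊠ X₂)).inv ≫ 𝟙 (𝟙 X) ⊠₂ (tensorId X₁ X₂).inv) ≫
      𝟙 (𝟙 X) ⊠₂ (𝟙 (𝟙 X₁) ⊠₂ 𝟙 (𝟙 X₂))) ≫ φ ⊠₂ (φ₁ ⊠₂ φ₂) ≫
      𝟙 (f ≫ g) ⊠₂ (𝟙 (f₁ ≫ g₁) ⊠₂ 𝟙 (f₂ ≫ g₂)) ≫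
      𝟙 (f ≫ g) ⊠₂ (tensorComp f₁ g₁ f₂ g₂).hom ≫ (tensorComp f g (f₁ ⊠₁ f₂) (g₁ ⊠₁ g₂)).hom
    rw [tensorHom₂_id, tensorHom₂_id, tensorHom₂_id, tensorHom₂_id, Category.id_comp,
      Category.comp_id, ← Category.assoc (φ ⊠₂ (φ₁ ⊠₂ φ₂)), ← tensorHom₂_comp, Category.comp_id,
      Category.assoc, ← Category.assoc (_ ⊠₂ _), ← tensorHom₂_comp, Category.id_comp]
    rfl
  rw [e₁, e₂]
  exact H

theorem T21_whiskerRight {f : X ⟶ Y} {g : Y ⟶ Z} {h : X ⟶ Z} {f₁ f₁' : X₁ ⟶ Y₁} {g₁ : Y₁ ⟶ Z₁}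
    {h₁ : X₁ ⟶ Z₁} (φ : f ≫ g ⟶ h) (θ : f₁' ⟶ f₁) (φ₁ : f₁ ≫ g₁ ⟶ h₁) :
    T21 φ (θ ▷ g₁ ≫ φ₁) = (𝟙 f ⊠₂ θ) ▷ (g ⊠₁ g₁) ≫ T21 φ φ₁ := by
  have h := tensorComp_inv_whiskerRight (𝟙 f) θ g g₁
  rw [T21, T21, ← Category.assoc, ← h, Category.assoc, ← tensorHom₂_comp, id_whiskerRight,
    Category.id_comp]

theorem T21_whiskerLeft {f : X ⟶ Y} {g : Y ⟶ Z} {h : X ⟶ Z} {f₁ : X₁ ⟶ Y₁} {g₁ g₁' : Y₁ ⟶ Z₁}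
    {h₁ : X₁ ⟶ Z₁} (φ : f ≫ g ⟶ h) (θ : g₁' ⟶ g₁) (φ₁ : f₁ ≫ g₁ ⟶ h₁) :
    T21 φ (f₁ ◁ θ ≫ φ₁) = (f ⊠₁ f₁) ◁ (𝟙 g ⊠₂ θ) ≫ T21 φ φ₁ := by
  have h := tensorComp_inv_whiskerLeft f f₁ (𝟙 g) θ
  rw [T21, T21, ← Category.assoc, ← h, Category.assoc, ← tensorHom₂_comp, whiskerLeft_id,
    Category.id_comp]

theorem T21_comp {f : X ⟶ Y} {g : Y ⟶ Z} {h : X ⟶ Z} {f₁ : X₁ ⟶ Y₁} {g₁ : Y₁ ⟶ Z₁}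
    {h₁ h₁' : X₁ ⟶ Z₁} (φ : f ≫ g ⟶ h) (φ₁ : f₁ ≫ g₁ ⟶ h₁) (θ : h₁ ⟶ h₁') :
    T21 φ (φ₁ ≫ θ) = T21 φ φ₁ ≫ 𝟙 h ⊠₂ θ := by
  rw [T21, T21, Category.assoc, ← tensorHom₂_comp, Category.comp_id]

theorem T12_whiskerRight {f : X ⟶ Y} {g : Y ⟶ Z} {h : X ⟶ Z} {f₁ f₁' : X₁ ⟶ Y₁} {g₁ : Y₁ ⟶ Z₁}
    {h₁ : X₁ ⟶ Z₁} (φ : h ⟶ f ≫ g) (θ : f₁ ⟶ f₁') (φ₁ : h₁ ⟶ f₁ ≫ g₁) :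
    T12 φ (φ₁ ≫ θ ▷ g₁) = T12 φ φ₁ ≫ (𝟙 f ⊠₂ θ) ▷ (g ⊠₁ g₁) := by
  have h := tensorComp_hom_whiskerRight (𝟙 f) θ g g₁
  rw [T12, T12, Category.assoc, ← h, ← Category.assoc, ← tensorHom₂_comp, id_whiskerRight,
    Category.comp_id]

theorem T12_whiskerLeft {f : X ⟶ Y} {g : Y ⟶ Z} {h : X ⟶ Z} {f₁ : X₁ ⟶ Y₁} {g₁ g₁' : Y₁ ⟶ Z₁}
    {h₁ : X₁ ⟶ Z₁} (φ : h ⟶ f ≫ g) (θ : g₁ ⟶ g₁') (φ₁ : h₁ ⟶ f₁ ≫ g₁) :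
    T12 φ (φ₁ ≫ f₁ ◁ θ) = T12 φ φ₁ ≫ (f ⊠₁ f₁) ◁ (𝟙 g ⊠₂ θ) := by
  have h := tensorComp_hom_whiskerLeft f f₁ (𝟙 g) θ
  rw [T12, T12, Category.assoc, ← h, ← Category.assoc, ← tensorHom₂_comp, whiskerLeft_id,
    Category.comp_id]

/-- `aNat₁` also contains the isomorphism `𝟙 U ⊠₁ 𝟙 V ≅ 𝟙 (U ⊠ V)`. The equation `e₁` collects the
copies of it at `f` and `g` into the one at `h`; the rest is `aNat_nat21`. -/
theorem aNat₁_nat21 {f : X ⟶ Y} {g : Y ⟶ Z} {h : X ⟶ Z} (φ : f ≫ g ⟶ h) (U V : B) :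
    t21 (pf21 (rightTensor V) (pf21 (rightTensor U) φ)) (a Z U V) ≫ (aNat₁ h U V).hom =
      ((f ⊠₁ 𝟙 U) ⊠₁ 𝟙 V) ◁ (aNat₁ g U V).hom ≫ t22 (aNat₁ f U V).hom (g ⊠₁ 𝟙 (U ⊠ V)) ≫
        a X U V ◁ pf21 (rightTensor (U ⊠ V)) φ := by
  have H := aNat_nat21 φ (λ_ (𝟙 U)).hom (λ_ (𝟙 V)).hom
  have e {X Y : B} {f : X ⟶ Y} : (aNat₁ f U V).hom =
      (aNat f (𝟙 U) (𝟙 V)).hom ≫ a X U V ◁ (𝟙 f ⊠₂ (tensorId U V).hom) := rfl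
  have e₁ : T21 φ (T21 (λ_ (𝟙 U)).hom (λ_ (𝟙 V)).hom) ≫ 𝟙 h ⊠₂ (tensorId U V).hom =
      (f ⊠₁ (𝟙 U ⊠₁ 𝟙 V)) ◁ (𝟙 g ⊠₂ (tensorId U V).hom) ≫
      (𝟙 f ⊠₂ (tensorId U V).hom) ▷ (g ⊠₁ 𝟙 (U ⊠ V)) ≫ T21 φ (λ_ (𝟙 (U ⊠ V))).hom := by
    rw [← T21_whiskerRight, ← T21_whiskerLeft, ← T21_comp, T21_leftUnitor]
    congr 1
    rw [whisker_exchange_assoc]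
    simp
  rw [pf21_rightTensor, pf21_rightTensor, pf21_rightTensor, e, reassoc_of% H, ← whiskerLeft_comp,
    e₁, e, e]
  simp only [whiskerLeft_comp, Category.assoc]
  rw [reassoc_of% t22_exchange (𝟙 g ⊠₂ (tensorId U V).hom) (aNat f (𝟙 U) (𝟙 V)).hom]
  simp [t22]

theorem aNat₁_nat02 {f : X ⟶ Y} {g : Y ⟶ X} (φ : 𝟙 X ⟶ f ≫ g) (U V : B) :
    t02 (pf02 (rightTensor V) (pf02 (rightTensor U) φ)) (a X U V) ≫
      ((f ⊠₁ 𝟙 U) ⊠₁ 𝟙 V) ◁ (aNat₁ g U V).hom ≫ t22 (aNat₁ f U V).hom (g ⊠₁ 𝟙 (U ⊠ V)) =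
      (ρ_ _).inv ≫ a X U V ◁ pf02 (rightTensor (U ⊠ V)) φ := by
  have H := aNat_nat02 φ (λ_ (𝟙 U)).inv (λ_ (𝟙 V)).inv
  have e {X Y : B} {f : X ⟶ Y} : (aNat₁ f U V).hom =
      (aNat f (𝟙 U) (𝟙 V)).hom ≫ a X U V ◁ (𝟙 f ⊠₂ (tensorId U V).hom) := rfl
  have e₁ : T02 φ (T02 (λ_ (𝟙 U)).inv (λ_ (𝟙 V)).inv) ≫
      (f ⊠₁ (𝟙 U ⊠₁ 𝟙 V)) ◁ (𝟙 g ⊠₂ (tensorId U V).hom) ≫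
      (𝟙 f ⊠₂ (tensorId U V).hom) ▷ (g ⊠₁ 𝟙 (U ⊠ V)) = T02 φ (λ_ (𝟙 (U ⊠ V))).inv := by
    have h₁ : T02 (λ_ (𝟙 U)).inv (λ_ (𝟙 V)).inv =
        (tensorId U V).inv ≫ T12 (λ_ (𝟙 U)).inv (λ_ (𝟙 V)).inv := rfl
    have h₂ {f₁ : U ⊠ V ⟶ U ⊠ V} {g₁ : U ⊠ V ⟶ U ⊠ V} (ψ : 𝟙 (U ⊠ V) ⟶ f₁ ≫ g₁) :
      T02 φ ψ = (tensorId X (U ⊠ V)).inv ≫ T12 φ ψ := rfl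
    rw [h₂, h₂, Category.assoc, ← Category.assoc (T12 _ _), ← T12_whiskerLeft, ← T12_whiskerRight,
      h₁, T12_leftUnitor]
    congr 2
    simp only [Category.assoc, ← whisker_exchange]
    simp
  rw [pf02_rightTensor, pf02_rightTensor, pf02_rightTensor, e, e, ← e₁]
  simp only [whiskerLeft_comp, ← reassoc_of% H]
  have h₁ : t22 ((aNat f (𝟙 U) (𝟙 V)).hom ≫ a X U V ◁ (𝟙 f ⊠₂ (tensorId U V).hom))
      (g ⊠₁ 𝟙 (U ⊠ V)) = t22 (aNat f (𝟙 U) (𝟙 V)).hom (g ⊠₁ 𝟙 (U ⊠ V)) ≫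
      a X U V ◁ (𝟙 f ⊠₂ (tensorId U V).hom) ▷ (g ⊠₁ 𝟙 (U ⊠ V)) := by
    simp [t22]
  rw [h₁]
  simp only [Category.assoc]
  rw [← reassoc_of% t22_exchange (𝟙 g ⊠₂ (tensorId U V).hom) (aNat f (𝟙 U) (𝟙 V)).hom]

theorem aNat₂_nat21 (U : B) {f : X ⟶ Y} {g : Y ⟶ Z} {h : X ⟶ Z} (φ : f ≫ g ⟶ h) (V : B) :
    t21 (pf21 (rightTensor V) (pf21 (leftTensor U) φ)) (a U Z V) ≫ (aNat₂ U h V).hom =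
      ((𝟙 U ⊠₁ f) ⊠₁ 𝟙 V) ◁ (aNat₂ U g V).hom ≫
        t22 (aNat₂ U f V).hom (𝟙 U ⊠₁ (g ⊠₁ 𝟙 V)) ≫
        a U X V ◁ pf21 (leftTensor U) (pf21 (rightTensor V) φ) := by
  rw [pf21_rightTensor, pf21_leftTensor, pf21_leftTensor, pf21_rightTensor]
  exact aNat_nat21 (λ_ (𝟙 U)).hom φ (λ_ (𝟙 V)).hom

theorem aNat₂_nat12 (U : B) {f : X ⟶ Y} {g : Y ⟶ Z} {h : X ⟶ Z} (φ : h ⟶ f ≫ g) (V : B) :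
    (aNat₂ U h V).hom ≫ a U X V ◁ pf12 (leftTensor U) (pf12 (rightTensor V) φ) =
      t12 (pf12 (rightTensor V) (pf12 (leftTensor U) φ)) (a U Z V) ≫
        ((𝟙 U ⊠₁ f) ⊠₁ 𝟙 V) ◁ (aNat₂ U g V).hom ≫
        t22 (aNat₂ U f V).hom (𝟙 U ⊠₁ (g ⊠₁ 𝟙 V)) := by
  rw [pf12_rightTensor, pf12_leftTensor, pf12_leftTensor, pf12_rightTensor]
  exact aNat_nat12 (λ_ (𝟙 U)).inv φ (λ_ (𝟙 V)).inv

theorem aNat₃_nat12 (U V : B) {f : X ⟶ Y} {g : Y ⟶ Z} {h : X ⟶ Z} (φ : h ⟶ f ≫ g) :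
    (aNat₃ U V h).hom ≫ a U V X ◁ pf12 (leftTensor U) (pf12 (leftTensor V) φ) =
      t12 (pf12 (leftTensor (U ⊠ V)) φ) (a U V Z) ≫
        (𝟙 (U ⊠ V) ⊠₁ f) ◁ (aNat₃ U V g).hom ≫
        t22 (aNat₃ U V f).hom (𝟙 U ⊠₁ (𝟙 V ⊠₁ g)) := by
  have H := aNat_nat12 (λ_ (𝟙 U)).inv (λ_ (𝟙 V)).inv φ
  have e {X Y : B} {f : X ⟶ Y} : (aNat₃ U V f).hom =
      ((tensorId U V).inv ⊠₂ 𝟙 f) ▷ a U V Y ≫ (aNat (𝟙 U) (𝟙 V) f).hom := rfl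
  have e₁ : (tensorId U V).inv ⊠₂ 𝟙 h ≫ T12 (T12 (λ_ (𝟙 U)).inv (λ_ (𝟙 V)).inv) φ =
      T12 (λ_ (𝟙 (U ⊠ V))).inv φ ≫ ((tensorId U V).inv ⊠₂ 𝟙 f) ▷ (𝟙 (U ⊠ V) ⊠₁ g) ≫
        ((𝟙 U ⊠₁ 𝟙 V) ⊠₁ f) ◁ ((tensorId U V).inv ⊠₂ 𝟙 g) := by
    have h₁ := tensorComp_hom_whiskerRight (tensorId U V).inv (𝟙 f) (𝟙 (U ⊠ V)) g
    have h₂ := tensorComp_hom_whiskerLeft (𝟙 U ⊠₁ 𝟙 V) f (tensorId U V).inv (𝟙 g)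
    have h₃ : (tensorId U V).inv ⊠₂ 𝟙 h ≫
        ((λ_ (𝟙 U ⊠₁ 𝟙 V)).inv ≫ (tensorId U V).inv ▷ (𝟙 U ⊠₁ 𝟙 V)) ⊠₂ φ =
        (λ_ (𝟙 (U ⊠ V))).inv ⊠₂ φ ≫ ((tensorId U V).inv ▷ 𝟙 (U ⊠ V)) ⊠₂ (𝟙 f ▷ g) ≫
        ((𝟙 U ⊠₁ 𝟙 V) ◁ (tensorId U V).inv) ⊠₂ (f ◁ 𝟙 g) := by
      simp only [← tensorHom₂_comp]
      congr 1
      · simp only [← whisker_exchange]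
        simp
      · simp
    rw [T12_leftUnitor, T12, T12, Category.assoc, ← reassoc_of% h₁, ← h₂, reassoc_of% h₃]
  rw [pf12_leftTensor, pf12_leftTensor, pf12_leftTensor, e, Category.assoc, H]
  have h₁ := congrArg (t12 · (a U V Z)) e₁
  have h₂ : t12 ((tensorId U V).inv ⊠₂ 𝟙 h ≫ T12 (T12 (λ_ (𝟙 U)).inv (λ_ (𝟙 V)).inv) φ)
      (a U V Z) = ((tensorId U V).inv ⊠₂ 𝟙 h) ▷ a U V Z ≫
        t12 (T12 (T12 (λ_ (𝟙 U)).inv (λ_ (𝟙 V)).inv) φ) (a U V Z) := by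
    simp [t12]
  rw [h₂] at h₁
  rw [reassoc_of% h₁]
  calc
    _ = t12 (T12 (λ_ (𝟙 (U ⊠ V))).inv φ) (a U V Z) ⊗≫
        (((tensorId U V).inv ⊠₂ 𝟙 f) ▷ (𝟙 (U ⊠ V) ⊠₁ g ≫ a U V Z) ≫
          ((𝟙 U ⊠₁ 𝟙 V) ⊠₁ f) ◁ (aNat₃ U V g).hom) ⊗≫
        (aNat (𝟙 U) (𝟙 V) f).hom ▷ (𝟙 U ⊠₁ (𝟙 V ⊠₁ g)) ⊗≫ 𝟙 _ := by
      rw [e]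
      simp only [t12, t22]
      bicategory
    _ = _ := by
      rw [← whisker_exchange, e (f := f)]
      simp only [t12, t22]
      bicategory

end Associator

end MonBicat

/-! ### Naturality of interchange and of the right unit equivalence -/

namespace MonBicat

section Image

variable {B C : Type u} [Bicategory.{w, v} B] [Bicategory.{w, v} C] (F : B ⥤ᵖ C)
  {X Y Z X' Y' Z' : B} {f : X ⟶ Y} {g : Y ⟶ Z} {h : X ⟶ Z} {f' : X' ⟶ Y'} {g' : Y' ⟶ Z'}
  {h' : X' ⟶ Z'} {m : X ⟶ X'} {n : Y ⟶ Y'} {p : Z ⟶ Z'}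
  {Nf : f ≫ n ⟶ m ≫ f'} {Ng : g ≫ p ⟶ n ≫ g'} {Nh : h ≫ p ⟶ m ≫ h'}

theorem pf_nat12 {φ : h ⟶ f ≫ g} {φ' : h' ⟶ f' ≫ g'}
    (H : Nh ≫ m ◁ φ' = t12 φ p ≫ f ◁ Ng ≫ t22 Nf g') :
    pf22 F Nh ≫ F.map m ◁ pf12 F φ' =
      t12 (pf12 F φ) (F.map p) ≫ F.map f ◁ pf22 F Ng ≫ t22 (pf22 F Nf) (F.map g') := by
  calc
    _ = (F.mapComp h p).inv ≫ F.map₂ (Nh ≫ m ◁ φ') ≫ (F.mapComp m (f' ≫ g')).hom ≫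
        F.map m ◁ (F.mapComp f' g').hom := by
      simp [pf22, pf12]
    _ = _ := by
      rw [H]
      simp only [PrelaxFunctor.map₂_comp, map₂_t12, map₂_t22, Pseudofunctor.map₂_whisker_left,
        map₂_eq_pf22 F Ng, whiskerLeft_comp, Category.assoc, Iso.inv_hom_id_assoc,
        whiskerLeft_inv_hom_assoc, Category.comp_id, whiskerLeft_inv_hom]

theorem pf_nat21 {φ : f ≫ g ⟶ h} {φ' : f' ≫ g' ⟶ h'}
    (H : t21 φ p ≫ Nh = f ◁ Ng ≫ t22 Nf g' ≫ m ◁ φ') :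
    t21 (pf21 F φ) (F.map p) ≫ pf22 F Nh =
      F.map f ◁ pf22 F Ng ≫ t22 (pf22 F Nf) (F.map g') ≫ F.map m ◁ pf21 F φ' := by
  calc
    _ = F.map f ◁ (F.mapComp g p).inv ≫ (F.mapComp f (g ≫ p)).inv ≫ F.map₂ (t21 φ p ≫ Nh) ≫
        (F.mapComp m h').hom := by
      simp only [PrelaxFunctor.map₂_comp, map₂_t21, map₂_eq_pf22 F Nh, Category.assoc,
        Iso.inv_hom_id_assoc, whiskerLeft_inv_hom_assoc, Iso.inv_hom_id, Category.comp_id]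
    _ = _ := by
      rw [H]
      simp only [PrelaxFunctor.map₂_comp, map₂_t22, Pseudofunctor.map₂_whisker_left,
        map₂_eq_pf22 F Ng, map₂_eq_pf21 F φ', whiskerLeft_comp, Category.assoc,
        Iso.inv_hom_id_assoc, whiskerLeft_inv_hom_assoc, Iso.inv_hom_id, Category.comp_id]

theorem pf_nat02 {g : Y ⟶ X} {g' : Y' ⟶ X'} {Ng : g ≫ m ⟶ n ≫ g'} {φ : 𝟙 X ⟶ f ≫ g}
    {φ' : 𝟙 X' ⟶ f' ≫ g'} (H : t02 φ m ≫ f ◁ Ng ≫ t22 Nf g' = (ρ_ m).inv ≫ m ◁ φ') :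
    t02 (pf02 F φ) (F.map m) ≫ F.map f ◁ pf22 F Ng ≫ t22 (pf22 F Nf) (F.map g') =
      (ρ_ (F.map m)).inv ≫ F.map m ◁ pf02 F φ' := by
  have h₀ : F.map₂ (λ_ m).inv ≫ (F.mapComp (𝟙 X) m).hom =
      (λ_ (F.map m)).inv ≫ (F.mapId X).inv ▷ F.map m := by
    rw [F.mapComp_id_left_hom, ← PrelaxFunctor.map₂_comp_assoc]
    simp
  have h₁ : F.map₂ (t02 φ m) = t02 (pf02 F φ) (F.map m) ≫ F.map f ◁ (F.mapComp g m).inv ≫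
      (F.mapComp f (g ≫ m)).inv := by
    simp [t02, pf02, reassoc_of% h₀]
  have h₂ : F.map₂ (ρ_ m).inv ≫ (F.mapComp m (𝟙 X')).hom =
      (ρ_ (F.map m)).inv ≫ F.map m ◁ (F.mapId X').inv := by
    rw [F.mapComp_id_right_hom, ← PrelaxFunctor.map₂_comp_assoc]
    simp
  calc
    _ = F.map₂ (t02 φ m ≫ f ◁ Ng ≫ t22 Nf g') ≫ (F.mapComp m (f' ≫ g')).hom ≫
        F.map m ◁ (F.mapComp f' g').hom := by
      simp only [PrelaxFunctor.map₂_comp, h₁, map₂_t22, Pseudofunctor.map₂_whisker_left,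
        map₂_eq_pf22 F Ng, whiskerLeft_comp, Category.assoc, Iso.inv_hom_id_assoc,
        whiskerLeft_inv_hom_assoc, Category.comp_id, whiskerLeft_inv_hom]
    _ = _ := by
      rw [H]
      simp [pf02, reassoc_of% h₂]

end Image

section Interchange

variable {B : Type u} [Bicategory.{w, v} B] [TensorStruct B] {X Y Z X' : B}


/-- The image under the tensor pseudofunctor of a pair of equations, `h₁` in the first factor and
`h₂` in the second, each a matter of unitors. The next two lemmas follow the same scheme. -/
theorem interchange_symm_nat12 {U U' : B} (p : U ⟶ U') {f : X ⟶ Y} {g : Y ⟶ Z} {h : X ⟶ Z}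
    (φ : h ⟶ f ≫ g) :
    (interchange p h).inv ≫ (p ⊠₁ 𝟙 X) ◁ pf12 (leftTensor U') φ =
      t12 (pf12 (leftTensor U) φ) (p ⊠₁ 𝟙 Z) ≫ (𝟙 U ⊠₁ f) ◁ (interchange p g).inv ≫
        t22 (interchange p f).inv (𝟙 U' ⊠₁ g) := by
  rw [pf12_leftTensor, pf12_leftTensor, interchange_inv, interchange_inv, interchange_inv]
  have h₁ : (idSq p).inv ≫ p ◁ (λ_ (𝟙 U')).inv =
      t12 (λ_ (𝟙 U)).inv p ≫ 𝟙 U ◁ (idSq p).inv ≫ t22 (idSq p).inv (𝟙 U') := by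
    simp only [idSq, Iso.trans_inv, Iso.symm_inv, t12, t22]
    bicategory
  have h₂ : (idSq h).hom ≫ 𝟙 X ◁ φ = t12 φ (𝟙 Z) ≫ f ◁ (idSq g).hom ≫ t22 (idSq f).hom g := by
    simp only [idSq, Iso.trans_hom, Iso.symm_hom, t12, t22]
    bicategory
  exact pf_nat12 (TensorStruct.tensor (B := B)) (X := (U, X)) (Y := (U, Y)) (Z := (U, Z))
    (X' := (U', X)) (Y' := (U', Y)) (Z' := (U', Z))
    (m := Prod.mkHom p (𝟙 X)) (n := Prod.mkHom p (𝟙 Y)) (p := Prod.mkHom p (𝟙 Z))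
    (f := Prod.mkHom (𝟙 U) f) (g := Prod.mkHom (𝟙 U) g) (h := Prod.mkHom (𝟙 U) h)
    (f' := Prod.mkHom (𝟙 U') f) (g' := Prod.mkHom (𝟙 U') g) (h' := Prod.mkHom (𝟙 U') h)
    (Nf := Prod.mkHom (idSq p).inv (idSq f).hom) (Ng := Prod.mkHom (idSq p).inv (idSq g).hom)
    (Nh := Prod.mkHom (idSq p).inv (idSq h).hom)
    (φ := Prod.mkHom (λ_ (𝟙 U)).inv φ) (φ' := Prod.mkHom (λ_ (𝟙 U')).inv φ) (Prod.ext h₁ h₂)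

theorem interchange_nat21 {f : X ⟶ Y} {g : Y ⟶ Z} {h : X ⟶ Z} (φ : f ≫ g ⟶ h) {U U' : B}
    (s : U ⟶ U') :
    t21 (pf21 (rightTensor U) φ) (𝟙 Z ⊠₁ s) ≫ (interchange h s).hom =
      (f ⊠₁ 𝟙 U) ◁ (interchange g s).hom ≫ t22 (interchange f s).hom (g ⊠₁ 𝟙 U') ≫
        (𝟙 X ⊠₁ s) ◁ pf21 (rightTensor U') φ := by
  rw [pf21_rightTensor, pf21_rightTensor, interchange_hom, interchange_hom, interchange_hom]
  have h₁ : t21 φ (𝟙 Z) ≫ (idSq h).hom =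
      f ◁ (idSq g).hom ≫ t22 (idSq f).hom g ≫ 𝟙 X ◁ φ := by
    simp only [idSq, Iso.trans_hom, Iso.symm_hom, t21, t22]
    bicategory
  have h₂ : t21 (λ_ (𝟙 U)).hom s ≫ (idSq s).inv =
      𝟙 U ◁ (idSq s).inv ≫ t22 (idSq s).inv (𝟙 U') ≫ s ◁ (λ_ (𝟙 U')).hom := by
    simp only [idSq, Iso.trans_inv, Iso.symm_inv, t21, t22]
    bicategory
  exact pf_nat21 (TensorStruct.tensor (B := B)) (X := (X, U)) (Y := (Y, U)) (Z := (Z, U))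
    (X' := (X, U')) (Y' := (Y, U')) (Z' := (Z, U'))
    (m := Prod.mkHom (𝟙 X) s) (n := Prod.mkHom (𝟙 Y) s) (p := Prod.mkHom (𝟙 Z) s)
    (f := Prod.mkHom f (𝟙 U)) (g := Prod.mkHom g (𝟙 U)) (h := Prod.mkHom h (𝟙 U))
    (f' := Prod.mkHom f (𝟙 U')) (g' := Prod.mkHom g (𝟙 U')) (h' := Prod.mkHom h (𝟙 U'))
    (Nf := Prod.mkHom (idSq f).hom (idSq s).inv) (Ng := Prod.mkHom (idSq g).hom (idSq s).inv)
    (Nh := Prod.mkHom (idSq h).hom (idSq s).inv)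
    (φ := Prod.mkHom φ (λ_ (𝟙 U)).hom) (φ' := Prod.mkHom φ (λ_ (𝟙 U')).hom) (Prod.ext h₁ h₂)

theorem interchange_nat02 {f : X ⟶ Y} {g : Y ⟶ X} (φ : 𝟙 X ⟶ f ≫ g) {U U' : B} (s : U ⟶ U') :
    t02 (pf02 (rightTensor U) φ) (𝟙 X ⊠₁ s) ≫ (f ⊠₁ 𝟙 U) ◁ (interchange g s).hom ≫
        t22 (interchange f s).hom (g ⊠₁ 𝟙 U') =
      (ρ_ (𝟙 X ⊠₁ s)).inv ≫ (𝟙 X ⊠₁ s) ◁ pf02 (rightTensor U') φ := by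
  rw [pf02_rightTensor, pf02_rightTensor, interchange_hom, interchange_hom]
  have h₁ : t02 φ (𝟙 X) ≫ f ◁ (idSq g).hom ≫ t22 (idSq f).hom g =
      (ρ_ (𝟙 X)).inv ≫ 𝟙 X ◁ φ := by
    simp only [idSq, Iso.trans_hom, Iso.symm_hom, t02, t22]
    bicategory
  have h₂ : t02 (λ_ (𝟙 U)).inv s ≫ 𝟙 U ◁ (idSq s).inv ≫ t22 (idSq s).inv (𝟙 U') =
      (ρ_ s).inv ≫ s ◁ (λ_ (𝟙 U')).inv := by
    simp only [idSq, Iso.trans_inv, Iso.symm_inv, t02, t22]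
    bicategory
  exact pf_nat02 (TensorStruct.tensor (B := B)) (X := (X, U)) (Y := (Y, U))
    (X' := (X, U')) (Y' := (Y, U')) (m := Prod.mkHom (𝟙 X) s) (n := Prod.mkHom (𝟙 Y) s)
    (f := Prod.mkHom f (𝟙 U)) (g := Prod.mkHom g (𝟙 U))
    (f' := Prod.mkHom f (𝟙 U')) (g' := Prod.mkHom g (𝟙 U'))
    (Nf := Prod.mkHom (idSq f).hom (idSq s).inv) (Ng := Prod.mkHom (idSq g).hom (idSq s).inv)
    (φ := Prod.mkHom φ (λ_ (𝟙 U)).inv) (φ' := Prod.mkHom φ (λ_ (𝟙 U')).inv) (Prod.ext h₁ h₂)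

end Interchange

section RightUnit

variable {B : Type u} [Bicategory.{w, v} B] [TensorStruct B] {X Y Z : B}

theorem rNat_nat21 {f : X ⟶ Y} {g : Y ⟶ Z} {h : X ⟶ Z} (φ : f ≫ g ⟶ h) :
    t21 (pf21 (rightTensor (I B)) φ) (r Z) ≫ (rNat h).hom =
      (f ⊠₁ 𝟙 (I B)) ◁ (rNat g).hom ≫ t22 (rNat f).hom g ≫ r X ◁ φ := by
  have H := strongTrans_nat21 (TensorStruct.rightUnitor (B := B)).hom φ
  have e₁ : pf21 (tensorOnRight (TensorStruct.tensor (B := B)) TensorStruct.unit) φ =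
      pf21 (rightTensor (I B)) φ := by
    rw [pf21, tensorOnRight_mapComp]
    rfl
  have e₂ : pf21 (Pseudofunctor.id B) φ = φ := Category.id_comp _
  rw [e₁, e₂] at H
  exact H

theorem rNat_nat02 {f : X ⟶ Y} {g : Y ⟶ X} (φ : 𝟙 X ⟶ f ≫ g) :
    t02 (pf02 (rightTensor (I B)) φ) (r X) ≫ (f ⊠₁ 𝟙 (I B)) ◁ (rNat g).hom ≫
      t22 (rNat f).hom g = (ρ_ (r X)).inv ≫ r X ◁ φ := by
  have H := strongTrans_nat02 (TensorStruct.rightUnitor (B := B)).hom φ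
  have e₁ : pf02 (tensorOnRight (TensorStruct.tensor (B := B)) TensorStruct.unit) φ =
      pf02 (rightTensor (I B)) φ := by
    rw [pf02, tensorOnRight_mapComp, tensorOnRight_mapId]
    rfl
  have e₂ : pf02 (Pseudofunctor.id B) φ = φ :=
    (Category.id_comp _).trans (Category.comp_id _)
  rw [e₁, e₂] at H
  exact H

end RightUnit

end MonBicat

/-! ### Compatibility of interchange with the associator -/

namespace MonBicat

section Flip

variable {B : Type u} [Bicategory.{w, v} B] {X Y Z X' Y' Z' V W W' : B}
  {f : X ⟶ Y} {g : Y ⟶ Z} {f' : X' ⟶ Y'} {g' : Y' ⟶ Z'}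
  {m : X ⟶ X'} {n : Y ⟶ Y'} {p : Z ⟶ Z'} {k : X ⟶ W} {l : W ⟶ Z} {k' : X' ⟶ W'} {l' : W' ⟶ Z'}
  {q : W ⟶ W'} {Nf : f ≫ n ≅ m ≫ f'} {Ng : g ≫ p ≅ n ≫ g'} {Nk : k ≫ q ≅ m ≫ k'}
  {Nl : l ≫ p ≅ q ≫ l'}

theorem nat22_inv {φ : f ≫ g ⟶ k ≫ l} {φ' : f' ≫ g' ⟶ k' ≫ l'}
    (H : t22 φ p ≫ k ◁ Nl.hom ≫ t22 Nk.hom l' = f ◁ Ng.hom ≫ t22 Nf.hom g' ≫ m ◁ φ')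
    (z : Z' ⟶ V) :
    m ◁ t22 φ' z ≫ t22 Nk.inv (l' ≫ z) ≫ k ◁ t22 Nl.inv z =
      t22 Nf.inv (g' ≫ z) ≫ f ◁ t22 Ng.inv z ≫ t22 φ (p ≫ z) := by
  have H' := nat22_whiskerRight H z
  have h₁ := congrArg (f ◁ ·) (t22_inv_hom Ng z)
  have h₂ := congrArg (k ◁ ·) (t22_hom_inv Nl z)
  simp only [whiskerLeft_comp, whiskerLeft_id] at h₁ h₂
  calc
    _ = t22 Nf.inv (g' ≫ z) ≫ f ◁ t22 Ng.inv z ≫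
        (f ◁ t22 Ng.hom z ≫ t22 Nf.hom (g' ≫ z) ≫ m ◁ t22 φ' z) ≫ t22 Nk.inv (l' ≫ z) ≫
        k ◁ t22 Nl.inv z := by
      simp only [Category.assoc]
      rw [reassoc_of% h₁, reassoc_of% t22_inv_hom Nf (g' ≫ z)]
    _ = _ := by
      rw [← H']
      simp only [Category.assoc]
      rw [reassoc_of% t22_hom_inv Nk (l' ≫ z), h₂, Category.comp_id]

theorem nat22_inv_hom {φ : f ≫ g ⟶ k ≫ l} {φ' : f' ≫ g' ⟶ k' ≫ l'}
    (H : t22 φ p ≫ k ◁ Nl.hom ≫ t22 Nk.hom l' = f ◁ Ng.hom ≫ t22 Nf.hom g' ≫ m ◁ φ')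
    (z : Z' ⟶ V) :
    f ◁ t22 Ng.inv z ≫ t22 φ (p ≫ z) ≫ k ◁ t22 Nl.hom z =
      t22 Nf.hom (g' ≫ z) ≫ m ◁ t22 φ' z ≫ t22 Nk.inv (l' ≫ z) := by
  have h₁ := congrArg (k ◁ ·) (t22_inv_hom Nl z)
  simp only [whiskerLeft_comp, whiskerLeft_id] at h₁
  have h₂ := nat22_inv H z
  calc
    _ = t22 Nf.hom (g' ≫ z) ≫ (t22 Nf.inv (g' ≫ z) ≫ f ◁ t22 Ng.inv z ≫ t22 φ (p ≫ z)) ≫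
        k ◁ t22 Nl.hom z := by
      simp only [Category.assoc]
      rw [reassoc_of% t22_hom_inv Nf (g' ≫ z)]
    _ = _ := by
      rw [← h₂]
      simp only [Category.assoc]
      rw [h₁, Category.comp_id]

end Flip

section TensorCells

variable {B : Type u} [Bicategory.{w, v} B] [TensorStruct B] {X Y Z W X₁ Y₁ Z₁ W₁ X₂ Y₂ : B}

section
variable {f : X ⟶ Y} {g : Y ⟶ Z} {h : X ⟶ W} {k : W ⟶ Z} {f₁ : X₁ ⟶ Y₁}
  {g₁ : Y₁ ⟶ Z₁} {h₁ : X₁ ⟶ W₁} {k₁ : W₁ ⟶ Z₁}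

theorem T22_whiskerRight_comp {f' : X ⟶ Y} {f₁' : X₁ ⟶ Y₁} (θ : f' ⟶ f) (θ₁ : f₁' ⟶ f₁)
    (φ : f ≫ g ⟶ h ≫ k) (φ₁ : f₁ ≫ g₁ ⟶ h₁ ≫ k₁) :
    T22 (θ ▷ g ≫ φ) (θ₁ ▷ g₁ ≫ φ₁) = (θ ⊠₂ θ₁) ▷ (g ⊠₁ g₁) ≫ T22 φ φ₁ := by
  rw [T22, T22, tensorHom₂_comp, Category.assoc,
    reassoc_of% tensorComp_inv_whiskerRight θ θ₁ g g₁]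

theorem T22_whiskerLeft_comp {g' : Y ⟶ Z} {g₁' : Y₁ ⟶ Z₁} (θ : g' ⟶ g) (θ₁ : g₁' ⟶ g₁)
    (φ : f ≫ g ⟶ h ≫ k) (φ₁ : f₁ ≫ g₁ ⟶ h₁ ≫ k₁) :
    T22 (f ◁ θ ≫ φ) (f₁ ◁ θ₁ ≫ φ₁) = (f ⊠₁ f₁) ◁ (θ ⊠₂ θ₁) ≫ T22 φ φ₁ := by
  rw [T22, T22, tensorHom₂_comp, Category.assoc,
    reassoc_of% tensorComp_inv_whiskerLeft f f₁ θ θ₁]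

theorem T22_comp_whiskerRight {h' : X ⟶ W} {h₁' : X₁ ⟶ W₁} (φ : f ≫ g ⟶ h ≫ k)
    (φ₁ : f₁ ≫ g₁ ⟶ h₁ ≫ k₁) (θ : h ⟶ h') (θ₁ : h₁ ⟶ h₁') :
    T22 (φ ≫ θ ▷ k) (φ₁ ≫ θ₁ ▷ k₁) = T22 φ φ₁ ≫ (θ ⊠₂ θ₁) ▷ (k ⊠₁ k₁) := by
  rw [T22, T22, tensorHom₂_comp, Category.assoc, Category.assoc, Category.assoc,
    tensorComp_hom_whiskerRight θ θ₁ k k₁]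

theorem T22_comp_whiskerLeft {k' : W ⟶ Z} {k₁' : W₁ ⟶ Z₁} (φ : f ≫ g ⟶ h ≫ k)
    (φ₁ : f₁ ≫ g₁ ⟶ h₁ ≫ k₁) (θ : k ⟶ k') (θ₁ : k₁ ⟶ k₁') :
    T22 (φ ≫ h ◁ θ) (φ₁ ≫ h₁ ◁ θ₁) = T22 φ φ₁ ≫ (h ⊠₁ h₁) ◁ (θ ⊠₂ θ₁) := by
  rw [T22, T22, tensorHom₂_comp, Category.assoc, Category.assoc, Category.assoc,
    tensorComp_hom_whiskerLeft h h₁ θ θ₁]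

end

/-- Needed to specialise the modification axioms: an argument set to an identity contributes the
square `idSq (𝟙 X)`, which is trivial. -/
theorem idSq_id {B : Type u} [Bicategory.{w, v} B] (X : B) : idSq (𝟙 X) = Iso.refl _ := by
  ext
  simp [idSq]

theorem aNat_naturality {f f' : X ⟶ Y} {f₁ f₁' : X₁ ⟶ Y₁} {f₂ f₂' : X₂ ⟶ Y₂} (η : f ⟶ f')
    (η₁ : f₁ ⟶ f₁') (η₂ : f₂ ⟶ f₂') :
    ((η ⊠₂ η₁) ⊠₂ η₂) ▷ a Y Y₁ Y₂ ≫ (aNat f' f₁' f₂').hom =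
      (aNat f f₁ f₂).hom ≫ a X X₁ X₂ ◁ (η ⊠₂ (η₁ ⊠₂ η₂)) :=
  (TensorStruct.assoc (B := B)).hom.naturality_naturality
    (a := ((X, X₁), X₂)) (b := ((Y, Y₁), Y₂))
    (f := Prod.mkHom (Prod.mkHom f f₁) f₂) (g := Prod.mkHom (Prod.mkHom f' f₁') f₂')
    (Prod.mkHom (Prod.mkHom η η₁) η₂)

theorem rNat_id (X : B) : (rNat (𝟙 X)).hom = (tensorId X (I B)).hom ▷ r X ≫ (idSq (r X)).inv := by
  have H := (TensorStruct.rightUnitor (B := B)).hom.naturality_id X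
  rw [tensorOnRight_mapId] at H
  have H' : (rNat (𝟙 X)).hom ≫ r X ◁ 𝟙 (𝟙 X) =
    (tensorId X (I B)).hom ▷ r X ≫ (λ_ (r X)).hom ≫ (ρ_ (r X)).inv := H
  rw [whiskerLeft_id, Category.comp_id] at H'
  rw [H']
  rfl

theorem lNat_id (X : B) : (lNat (𝟙 X)).hom = (tensorId (I B) X).hom ▷ l X ≫ (idSq (l X)).inv := by
  have H := (TensorStruct.leftUnitor (B := B)).hom.naturality_id X
  rw [tensorOnLeft_mapId] at H
  have H' : (lNat (𝟙 X)).hom ≫ l X ◁ 𝟙 (𝟙 X) =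
    (tensorId (I B) X).hom ▷ l X ≫ (λ_ (l X)).hom ≫ (ρ_ (l X)).inv := H
  rw [whiskerLeft_id, Category.comp_id] at H'
  rw [H']
  rfl

/-- `aNat_nat22` for the identity squares of `p`, `i` and the object `Z`. The second and third of
these tensor to the identity square of `i ⊠₁ 𝟙 Z` up to `tensorId`, which is what `aNat₁` carries.
-/
theorem aNat₁_nat22 (p : X ⟶ Y) (i : X₁ ⟶ Y₁) (Z : B) :
    t22 (pf22 (rightTensor Z) (interchange p i).inv) (a Y Y₁ Z) ≫
        ((p ⊠₁ 𝟙 X₁) ⊠₁ 𝟙 Z) ◁ (aNat₂ Y i Z).hom ≫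
        t22 (aNat₁ p X₁ Z).hom (𝟙 Y ⊠₁ (i ⊠₁ 𝟙 Z)) =
      ((𝟙 X ⊠₁ i) ⊠₁ 𝟙 Z) ◁ (aNat₁ p Y₁ Z).hom ≫ t22 (aNat₂ X i Z).hom (p ⊠₁ 𝟙 (Y₁ ⊠ Z)) ≫
        a X X₁ Z ◁ (interchange p (i ⊠₁ 𝟙 Z)).inv := by
  have H : t22 (T22 (T22 (idSq p).inv (idSq i).hom) (𝟙 (𝟙 Z ≫ 𝟙 Z))) (a Y Y₁ Z) ≫
        ((p ⊠₁ 𝟙 X₁) ⊠₁ 𝟙 Z) ◁ (aNat₂ Y i Z).hom ≫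
        t22 (aNat p (𝟙 X₁) (𝟙 Z)).hom (𝟙 Y ⊠₁ (i ⊠₁ 𝟙 Z)) =
      ((𝟙 X ⊠₁ i) ⊠₁ 𝟙 Z) ◁ (aNat p (𝟙 Y₁) (𝟙 Z)).hom ≫
        t22 (aNat₂ X i Z).hom (p ⊠₁ (𝟙 Y₁ ⊠₁ 𝟙 Z)) ≫
        a X X₁ Z ◁ T22 (idSq p).inv (T22 (idSq i).hom (𝟙 (𝟙 Z ≫ 𝟙 Z))) :=
    aNat_nat22 (idSq p).inv (idSq i).hom (𝟙 (𝟙 Z ≫ 𝟙 Z))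
  have e {U : B} : (aNat₁ p U Z).hom =
      (aNat p (𝟙 U) (𝟙 Z)).hom ≫ a X U Z ◁ (𝟙 p ⊠₂ (tensorId U Z).hom) := rfl
  have e₁ : T22 (idSq i).hom (𝟙 (𝟙 Z ≫ 𝟙 Z)) ≫ (tensorId X₁ Z).hom ▷ (i ⊠₁ 𝟙 Z) =
      (i ⊠₁ 𝟙 Z) ◁ (tensorId Y₁ Z).hom ≫ (idSq (i ⊠₁ 𝟙 Z)).hom := by
    have := T22_idSq i (𝟙 Z)
    rw [idSq_id] at this
    rw [Iso.refl_hom] at this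
    rw [this]
    simp [inv_hom_whiskerRight]
  have e₂ : T22 (idSq p).inv (T22 (idSq i).hom (𝟙 (𝟙 Z ≫ 𝟙 Z))) ≫
      (𝟙 p ⊠₂ (tensorId X₁ Z).hom) ▷ (𝟙 Y ⊠₁ (i ⊠₁ 𝟙 Z)) =
      (𝟙 X ⊠₁ (i ⊠₁ 𝟙 Z)) ◁ (𝟙 p ⊠₂ (tensorId Y₁ Z).hom) ≫ (interchange p (i ⊠₁ 𝟙 Z)).inv := by
    rw [interchange_inv, ← T22_comp_whiskerRight, ← T22_whiskerLeft_comp, e₁]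
    simp
  rw [pf22_rightTensor, interchange_inv, e, e]
  have h₁ : t22 ((aNat p (𝟙 X₁) (𝟙 Z)).hom ≫ a X X₁ Z ◁ (𝟙 p ⊠₂ (tensorId X₁ Z).hom))
      (𝟙 Y ⊠₁ (i ⊠₁ 𝟙 Z)) = t22 (aNat p (𝟙 X₁) (𝟙 Z)).hom (𝟙 Y ⊠₁ (i ⊠₁ 𝟙 Z)) ≫
        a X X₁ Z ◁ (𝟙 p ⊠₂ (tensorId X₁ Z).hom) ▷ (𝟙 Y ⊠₁ (i ⊠₁ 𝟙 Z)) := by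
    simp [t22]
  rw [h₁, reassoc_of% H, ← whiskerLeft_comp, e₂]
  simp only [whiskerLeft_comp, Category.assoc]
  rw [reassoc_of% t22_exchange (𝟙 p ⊠₂ (tensorId Y₁ Z).hom) (aNat₂ X i Z).hom]

theorem aNat₃_nat22 (X : B) (i : X₁ ⟶ Y₁) (s : X₂ ⟶ Y₂) :
    t22 (interchange (𝟙 X ⊠₁ i) s).inv (a X Y₁ Y₂) ≫
        ((𝟙 X ⊠₁ i) ⊠₁ 𝟙 X₂) ◁ (aNat₃ X Y₁ s).hom ≫
        t22 (aNat₂ X i X₂).hom (𝟙 X ⊠₁ (𝟙 Y₁ ⊠₁ s)) =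
      (𝟙 (X ⊠ X₁) ⊠₁ s) ◁ (aNat₂ X i Y₂).hom ≫
        t22 (aNat₃ X X₁ s).hom (𝟙 X ⊠₁ (i ⊠₁ 𝟙 Y₂)) ≫
        a X X₁ X₂ ◁ pf22 (leftTensor X) (interchange i s).inv := by
  have H := aNat_nat22 (𝟙 (𝟙 X ≫ 𝟙 X)) (idSq i).inv (idSq s).hom
  have e {U : B} : (aNat₃ X U s).hom =
      ((tensorId X U).inv ⊠₂ 𝟙 s) ▷ a X U Y₂ ≫ (aNat (𝟙 X) (𝟙 U) s).hom := rfl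
  have e₁ : (tensorId X X₁).inv ▷ (𝟙 X ⊠₁ i) ≫ T22 (𝟙 (𝟙 X ≫ 𝟙 X)) (idSq i).inv =
      (idSq (𝟙 X ⊠₁ i)).inv ≫ (𝟙 X ⊠₁ i) ◁ (tensorId X Y₁).inv := by
    have := T22_idSq_inv (𝟙 X) i
    rw [idSq_id] at this
    rw [Iso.refl_inv] at this
    rw [this]
    simp [inv_hom_whiskerRight_assoc]
  have e₂ : ((tensorId X X₁).inv ⊠₂ 𝟙 s) ▷ ((𝟙 X ⊠₁ i) ⊠₁ 𝟙 Y₂) ≫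
      T22 (T22 (𝟙 (𝟙 X ≫ 𝟙 X)) (idSq i).inv) (idSq s).hom =
      (interchange (𝟙 X ⊠₁ i) s).inv ≫ ((𝟙 X ⊠₁ i) ⊠₁ 𝟙 X₂) ◁ ((tensorId X Y₁).inv ⊠₂ 𝟙 s) := by
    rw [interchange_inv, ← T22_comp_whiskerLeft, ← T22_whiskerRight_comp, e₁]
    simp
  rw [pf22_leftTensor, interchange_inv i s]
  have h₁ : t22 (aNat₃ X X₁ s).hom (𝟙 X ⊠₁ (i ⊠₁ 𝟙 Y₂)) =
      ((tensorId X X₁).inv ⊠₂ 𝟙 s) ▷ (a X X₁ Y₂ ≫ 𝟙 X ⊠₁ (i ⊠₁ 𝟙 Y₂)) ≫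
      t22 (aNat (𝟙 X) (𝟙 X₁) s).hom (𝟙 X ⊠₁ (i ⊠₁ 𝟙 Y₂)) := by
    simp [t22, e]
  have h₂ : (𝟙 (X ⊠ X₁) ⊠₁ s) ◁ (aNat₂ X i Y₂).hom ≫
      ((tensorId X X₁).inv ⊠₂ 𝟙 s) ▷ (a X X₁ Y₂ ≫ 𝟙 X ⊠₁ (i ⊠₁ 𝟙 Y₂)) =
      ((tensorId X X₁).inv ⊠₂ 𝟙 s) ▷ ((𝟙 X ⊠₁ i) ⊠₁ 𝟙 Y₂ ≫ a X Y₁ Y₂) ≫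
      ((𝟙 X ⊠₁ 𝟙 X₁) ⊠₁ s) ◁ (aNat (𝟙 X) i (𝟙 Y₂)).hom := whisker_exchange _ _
  rw [h₁, Category.assoc, reassoc_of% h₂, ← H]
  have h₃ := congrArg (t22 · (a X Y₁ Y₂)) e₂
  have h₄ : t22 (((tensorId X X₁).inv ⊠₂ 𝟙 s) ▷ ((𝟙 X ⊠₁ i) ⊠₁ 𝟙 Y₂) ≫
      T22 (T22 (𝟙 (𝟙 X ≫ 𝟙 X)) (idSq i).inv) (idSq s).hom) (a X Y₁ Y₂) =
      ((tensorId X X₁).inv ⊠₂ 𝟙 s) ▷ ((𝟙 X ⊠₁ i) ⊠₁ 𝟙 Y₂ ≫ a X Y₁ Y₂) ≫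
      t22 (T22 (T22 (𝟙 (𝟙 X ≫ 𝟙 X)) (idSq i).inv) (idSq s).hom) (a X Y₁ Y₂) := by
    simp [t22]
  rw [h₄] at h₃
  rw [reassoc_of% h₃, e]
  simp [t22]
  rfl

end TensorCells

end MonBicat

/-! ### The modifications `π`, `μ` and `rho` as natural in a single variable -/

namespace MonBicat

open MonoidalBicategory

variable {B : Type u} [Bicategory.{w, v} B] [MonoidalBicategory B]

theorem pasteSq_hom {B : Type u} [Bicategory.{w, v} B] {X X' Y Y' Z Z' : B} {f : X ⟶ X'}
    {b : X' ⟶ Y'} {p : X ⟶ Y} {f' : Y ⟶ Y'} {d : Y' ⟶ Z'} {q : Y ⟶ Z} {f'' : Z ⟶ Z'}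
    (σ : f ≫ b ≅ p ≫ f') (τ : f' ≫ d ≅ q ≫ f'') :
    (pasteSq σ τ).hom = t22 σ.hom d ≫ p ◁ τ.hom ≫ (α_ p q f'').inv := by
  simp [pasteSq, t22]

theorem rho_nat_second (X : B) {Y Y' V : B} (i : Y ⟶ Y') (z : X ⊠ Y' ⟶ V) :
    ((𝟙 X ⊠₁ i) ⊠₁ 𝟙 (I B)) ◁ t21 (rho X Y').hom z ≫ t22 (rNat (𝟙 X ⊠₁ i)).hom z =
      t22 (aNat₂ X i (I B)).hom (𝟙 X ⊠₁ r Y' ≫ z) ≫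
        a X Y (I B) ◁ t22 (pf22 (leftTensor X) (rNat i).hom) z ≫
        t21 (rho X Y).hom (𝟙 X ⊠₁ i ≫ z) := by
  have H : ((𝟙 X ⊠₁ i) ⊠₁ 𝟙 (I B)) ◁ (rho X Y').hom ≫ (rNat (𝟙 X ⊠₁ i)).hom =
      t22 (aNat₂ X i (I B)).hom (𝟙 X ⊠₁ r Y') ≫
        a X Y (I B) ◁ pf22 (leftTensor X) (rNat i).hom ≫ t21 (rho X Y).hom (𝟙 X ⊠₁ i) := by
    have h := rho_naturality (𝟙 X) i
    have e := tensorSq_hom (idSq (𝟙 X)) (rNat i)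
    rw [idSq_id, Iso.refl_hom, ← pf22_leftTensor] at e
    rw [idSq_id, pasteSq_hom, e, Category.assoc, Category.assoc] at h
    exact h
  calc
    _ = 𝟙 _ ⊗≫ (((𝟙 X ⊠₁ i) ⊠₁ 𝟙 (I B)) ◁ (rho X Y').hom ≫ (rNat (𝟙 X ⊠₁ i)).hom) ▷ z ⊗≫ 𝟙 _ := by
      simp only [t21, t22]
      bicategory
    _ = _ := by
      rw [H]
      simp only [t21, t22]
      bicategory

/-- `μ_naturality` with an identity as second arrow. The square `lNat (𝟙 Y)` is an inverse identity
square of `l Y` up to `tensorId`, so tensoring it with `idSq p` produces the interchange of `p` and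
`l Y`. -/
theorem μ_nat_first {X X' V : B} (p : X ⟶ X') (Y : B) (z : X' ⊠ Y ⟶ V) :
    ((p ⊠₁ 𝟙 (I B)) ⊠₁ 𝟙 Y) ◁ t21 (μ X' Y).hom z ≫ t22 (pf22 (rightTensor Y) (rNat p).hom) z =
      t22 (aNat₁ p (I B) Y).hom (𝟙 X' ⊠₁ l Y ≫ z) ≫
        a X (I B) Y ◁ t22 (interchange p (l Y)).hom z ≫ t21 (μ X Y).hom (p ⊠₁ 𝟙 Y ≫ z) := by
  have H : ((p ⊠₁ 𝟙 (I B)) ⊠₁ 𝟙 Y) ◁ (μ X' Y).hom ≫ pf22 (rightTensor Y) (rNat p).hom =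
      t22 (aNat₁ p (I B) Y).hom (𝟙 X' ⊠₁ l Y) ≫
        a X (I B) Y ◁ (interchange p (l Y)).hom ≫ t21 (μ X Y).hom (p ⊠₁ 𝟙 Y) := by
    have h := μ_naturality p (𝟙 Y)
    have e := tensorSq_hom (rNat p) (idSq (𝟙 Y))
    rw [idSq_id, Iso.refl_hom, ← pf22_rightTensor] at e
    rw [idSq_id, pasteSq_hom, e, Category.assoc, Category.assoc] at h
    have e₁ : (tensorSq (idSq p) (lNat (𝟙 Y))).hom =
        (𝟙 p ⊠₂ (tensorId (I B) Y).hom) ▷ (𝟙 X' ⊠₁ l Y) ≫ (interchange p (l Y)).hom := by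
      rw [tensorSq_hom, lNat_id, interchange_hom, ← T22_whiskerRight_comp]
      simp
    have e₂ : (aNat₁ p (I B) Y).hom = (aNat p (𝟙 (I B)) (𝟙 Y)).hom ≫
      a X (I B) Y ◁ (𝟙 p ⊠₂ (tensorId (I B) Y).hom) := rfl
    rw [h, e₁, e₂]
    simp [t22, t21]
  calc
    _ = 𝟙 _ ⊗≫ (((p ⊠₁ 𝟙 (I B)) ⊠₁ 𝟙 Y) ◁ (μ X' Y).hom ≫
        pf22 (rightTensor Y) (rNat p).hom) ▷ z ⊗≫ 𝟙 _ := by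
      simp only [t21, t22]
      bicategory
    _ = _ := by
      rw [H]
      simp only [t21, t22]
      bicategory

theorem μ_nat_second (X : B) {Y Y' V : B} (s : Y ⟶ Y') (z : X ⊠ Y' ⟶ V) :
    (𝟙 (X ⊠ I B) ⊠₁ s) ◁ t21 (μ X Y').hom z ≫ t22 (interchange (r X) s).inv z =
      t22 (aNat₃ X (I B) s).hom (𝟙 X ⊠₁ l Y' ≫ z) ≫
        a X (I B) Y ◁ t22 (pf22 (leftTensor X) (lNat s).hom) z ≫
        t21 (μ X Y).hom (𝟙 X ⊠₁ s ≫ z) := by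
  have H : (𝟙 (X ⊠ I B) ⊠₁ s) ◁ (μ X Y').hom ≫ (interchange (r X) s).inv =
      t22 (aNat₃ X (I B) s).hom (𝟙 X ⊠₁ l Y') ≫
        a X (I B) Y ◁ pf22 (leftTensor X) (lNat s).hom ≫ t21 (μ X Y).hom (𝟙 X ⊠₁ s) := by
    have h := μ_naturality (𝟙 X) s
    have e := tensorSq_hom (idSq (𝟙 X)) (lNat s)
    rw [idSq_id, Iso.refl_hom, ← pf22_leftTensor] at e
    rw [idSq_id, pasteSq_hom, e, Category.assoc, Category.assoc] at h
    have e₁ : (interchange (r X) s).inv =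
        ((tensorId X (I B)).inv ⊠₂ 𝟙 s) ▷ (r X ⊠₁ 𝟙 Y') ≫ (tensorSq (rNat (𝟙 X)) (idSq s)).hom := by
      rw [tensorSq_hom, rNat_id, interchange_inv, ← T22_whiskerRight_comp]
      simp [inv_hom_whiskerRight_assoc]
    have e₂ : (aNat₃ X (I B) s).hom = ((tensorId X (I B)).inv ⊠₂ 𝟙 s) ▷ a X (I B) Y' ≫
      (aNat (𝟙 X) (𝟙 (I B)) s).hom := rfl
    rw [e₁, whisker_exchange_assoc, h, e₂]
    simp [t22, t21]
  calc
    _ = 𝟙 _ ⊗≫ ((𝟙 (X ⊠ I B) ⊠₁ s) ◁ (μ X Y').hom ≫ (interchange (r X) s).inv) ▷ z ⊗≫ 𝟙 _ := by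
      simp only [t21, t22]
      bicategory
    _ = _ := by
      rw [H]
      simp only [t21, t22]
      bicategory

/-- `π_naturality` with three identity arguments. The difference between `𝟙 U ⊠₁ 𝟙 T` and `𝟙 (U ⊠
T)` is carried through the associator by `aNat_naturality` (step `e₆`). -/
theorem π_nat_third (U T : B) {Y Y' V : B} (i : Y ⟶ Y') (R : B) (y : U ⊠ (T ⊠ (Y' ⊠ R)) ⟶ V) :
    ((𝟙 (U ⊠ T) ⊠₁ i) ⊠₁ 𝟙 R) ◁ t32 (π U T Y' R).hom y ≫
      t22 (aNat₂ (U ⊠ T) i R).hom (a U T (Y' ⊠ R) ≫ y) ≫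
      a (U ⊠ T) Y R ◁ t22 (aNat₃ U T (i ⊠₁ 𝟙 R)).hom y =
    t22 (pf22 (rightTensor R) (aNat₃ U T i).hom) (a U (T ⊠ Y') R ≫ 𝟙 U ⊠₁ a T Y' R ≫ y) ≫
      (a U T Y ⊠₁ 𝟙 R) ◁ t22 (aNat₂ U (𝟙 T ⊠₁ i) R).hom (𝟙 U ⊠₁ a T Y' R ≫ y) ≫
      (a U T Y ⊠₁ 𝟙 R) ◁ a U (T ⊠ Y) R ◁ t22 (pf22 (leftTensor U) (aNat₂ T i R).hom) y ≫
      t32 (π U T Y R).hom (𝟙 U ⊠₁ (𝟙 T ⊠₁ (i ⊠₁ 𝟙 R)) ≫ y) := by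
  have H : ((𝟙 (U ⊠ T) ⊠₁ i) ⊠₁ 𝟙 R) ◁ (π U T Y' R).hom ≫
      t22 (aNat₂ (U ⊠ T) i R).hom (a U T (Y' ⊠ R)) ≫
      a (U ⊠ T) Y R ◁ (aNat₃ U T (i ⊠₁ 𝟙 R)).hom =
    t22 (pf22 (rightTensor R) (aNat₃ U T i).hom) (a U (T ⊠ Y') R ≫ 𝟙 U ⊠₁ a T Y' R) ≫
      (a U T Y ⊠₁ 𝟙 R) ◁ t22 (aNat₂ U (𝟙 T ⊠₁ i) R).hom (𝟙 U ⊠₁ a T Y' R) ≫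
      (a U T Y ⊠₁ 𝟙 R) ◁ a U (T ⊠ Y) R ◁ pf22 (leftTensor U) (aNat₂ T i R).hom ≫
      t32 (π U T Y R).hom (𝟙 U ⊠₁ (𝟙 T ⊠₁ (i ⊠₁ 𝟙 R))) := by
    have h := π_naturality (𝟙 U) (𝟙 T) i (𝟙 R)
    have e₁ := tensorSq_hom (idSq (𝟙 U)) (aNat (𝟙 T) i (𝟙 R))
    rw [idSq_id, Iso.refl_hom, ← pf22_leftTensor] at e₁
    have e₂ := tensorSq_hom (aNat (𝟙 U) (𝟙 T) i) (idSq (𝟙 R))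
    rw [idSq_id, Iso.refl_hom] at e₂
    rw [idSq_id, idSq_id, pasteSq_hom, pasteSq_hom, pasteSq_hom, e₁, e₂] at h
    have e₃ : pf22 (rightTensor R) (aNat₃ U T i).hom =
        (((tensorId U T).inv ⊠₂ 𝟙 i) ⊠₂ 𝟙 (𝟙 R)) ▷ (a U T Y' ⊠₁ 𝟙 R) ≫
          T22 (aNat (𝟙 U) (𝟙 T) i).hom (𝟙 (𝟙 R ≫ 𝟙 R)) := by
      rw [pf22_rightTensor, ← T22_whiskerRight_comp]
      congr 1
      simp
    have e₄ := aNat_naturality (tensorId U T).inv (𝟙 i) (𝟙 (𝟙 R))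
    rw [tensorHom₂_id i] at e₄
    have e₅ : (aNat₃ U T (i ⊠₁ 𝟙 R)).hom =
      ((tensorId U T).inv ⊠₂ 𝟙 (i ⊠₁ 𝟙 R)) ▷ a U T (Y' ⊠ R) ≫
        (aNat (𝟙 U) (𝟙 T) (i ⊠₁ 𝟙 R)).hom := rfl
    have e₆ : t22 (aNat₂ (U ⊠ T) i R).hom (a U T (Y' ⊠ R)) ≫
        a (U ⊠ T) Y R ◁ (aNat₃ U T (i ⊠₁ 𝟙 R)).hom =
        (((tensorId U T).inv ⊠₂ 𝟙 i) ⊠₂ 𝟙 (𝟙 R)) ▷ (a (U ⊠ T) Y' R ≫ a U T (Y' ⊠ R)) ≫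
        t22 (aNat (𝟙 U ⊠₁ 𝟙 T) i (𝟙 R)).hom (a U T (Y' ⊠ R)) ≫
        a (U ⊠ T) Y R ◁ (aNat (𝟙 U) (𝟙 T) (i ⊠₁ 𝟙 R)).hom := by
      calc
        _ = 𝟙 _ ⊗≫ ((aNat₂ (U ⊠ T) i R).hom ≫ a (U ⊠ T) Y R ◁
            ((tensorId U T).inv ⊠₂ 𝟙 (i ⊠₁ 𝟙 R))) ▷ a U T (Y' ⊠ R) ⊗≫
            a (U ⊠ T) Y R ◁ (aNat (𝟙 U) (𝟙 T) (i ⊠₁ 𝟙 R)).hom := by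
          rw [e₅]
          simp only [t22]
          bicategory
        _ = _ := by
          rw [aNat₂, ← e₄]
          simp only [t22]
          bicategory
    have h' := congrArg (· ≫ (α_ _ _ _).hom) h
    simp only [Category.assoc, Iso.inv_hom_id, Category.comp_id] at h'
    rw [e₆, whisker_exchange_assoc, h', e₃]
    simp only [t22, t32, aNat₂]
    bicategory
  calc
    _ = 𝟙 _ ⊗≫ (((𝟙 (U ⊠ T) ⊠₁ i) ⊠₁ 𝟙 R) ◁ (π U T Y' R).hom ≫
      t22 (aNat₂ (U ⊠ T) i R).hom (a U T (Y' ⊠ R)) ≫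
      a (U ⊠ T) Y R ◁ (aNat₃ U T (i ⊠₁ 𝟙 R)).hom) ▷ y ⊗≫ 𝟙 _ := by
      simp only [t22, t32]
      bicategory
    _ = _ := by
      rw [H]
      simp only [t22, t32]
      bicategory

theorem π_nat_second (U : B) {Y Y' V : B} (i : Y ⟶ Y') (S R : B)
    (z : U ⊠ (Y' ⊠ (S ⊠ R)) ⟶ V) :
    (((𝟙 U ⊠₁ i) ⊠₁ 𝟙 S) ⊠₁ 𝟙 R) ◁ t32 (π U Y' S R).hom z ≫
      t22 (aNat₁ (𝟙 U ⊠₁ i) S R).hom (a U Y' (S ⊠ R) ≫ z) ≫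
      a (U ⊠ Y) S R ◁ t22 (aNat₂ U i (S ⊠ R)).hom z =
    t22 (pf22 (rightTensor R) (aNat₂ U i S).hom) (a U (Y' ⊠ S) R ≫ 𝟙 U ⊠₁ a Y' S R ≫ z) ≫
      (a U Y S ⊠₁ 𝟙 R) ◁ t22 (aNat₂ U (i ⊠₁ 𝟙 S) R).hom (𝟙 U ⊠₁ a Y' S R ≫ z) ≫
      (a U Y S ⊠₁ 𝟙 R) ◁ a U (Y ⊠ S) R ◁ t22 (pf22 (leftTensor U) (aNat₁ i S R).hom) z ≫
      t32 (π U Y S R).hom (𝟙 U ⊠₁ (i ⊠₁ 𝟙 (S ⊠ R)) ≫ z) := by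
  have H : (((𝟙 U ⊠₁ i) ⊠₁ 𝟙 S) ⊠₁ 𝟙 R) ◁ (π U Y' S R).hom ≫
      t22 (aNat₁ (𝟙 U ⊠₁ i) S R).hom (a U Y' (S ⊠ R)) ≫
      a (U ⊠ Y) S R ◁ (aNat₂ U i (S ⊠ R)).hom =
    t22 (pf22 (rightTensor R) (aNat₂ U i S).hom) (a U (Y' ⊠ S) R ≫ 𝟙 U ⊠₁ a Y' S R) ≫
      (a U Y S ⊠₁ 𝟙 R) ◁ t22 (aNat₂ U (i ⊠₁ 𝟙 S) R).hom (𝟙 U ⊠₁ a Y' S R) ≫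
      (a U Y S ⊠₁ 𝟙 R) ◁ a U (Y ⊠ S) R ◁ pf22 (leftTensor U) (aNat₁ i S R).hom ≫
      t32 (π U Y S R).hom (𝟙 U ⊠₁ (i ⊠₁ 𝟙 (S ⊠ R))) := by
    have h := π_naturality (𝟙 U) i (𝟙 S) (𝟙 R)
    have e₁ := tensorSq_hom (idSq (𝟙 U)) (aNat i (𝟙 S) (𝟙 R))
    rw [idSq_id, Iso.refl_hom] at e₁
    have e₂ := tensorSq_hom (aNat (𝟙 U) i (𝟙 S)) (idSq (𝟙 R))
    rw [idSq_id, Iso.refl_hom, ← pf22_rightTensor] at e₂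
    rw [idSq_id, idSq_id, pasteSq_hom, pasteSq_hom, pasteSq_hom, e₁, e₂] at h
    have e₃ : pf22 (leftTensor U) (aNat₁ i S R).hom =
        T22 (𝟙 (𝟙 U ≫ 𝟙 U)) (aNat i (𝟙 S) (𝟙 R)).hom ≫
        (𝟙 U ⊠₁ a Y S R) ◁ (𝟙 (𝟙 U) ⊠₂ (𝟙 i ⊠₂ (tensorId S R).hom)) := by
      rw [pf22_leftTensor, ← T22_comp_whiskerLeft]
      congr 1
      simp
    have e₄ := aNat_naturality (𝟙 (𝟙 U)) (𝟙 i) (tensorId S R).hom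
    rw [tensorHom₂_id (𝟙 U)] at e₄
    have e₅ : (aNat₁ (𝟙 U ⊠₁ i) S R).hom = (aNat (𝟙 U ⊠₁ i) (𝟙 S) (𝟙 R)).hom ≫
        a (U ⊠ Y) S R ◁ (𝟙 (𝟙 U ⊠₁ i) ⊠₂ (tensorId S R).hom) := rfl
    have e₆ : t22 (aNat₁ (𝟙 U ⊠₁ i) S R).hom (a U Y' (S ⊠ R)) ≫
        a (U ⊠ Y) S R ◁ (aNat₂ U i (S ⊠ R)).hom =
        (t22 (aNat (𝟙 U ⊠₁ i) (𝟙 S) (𝟙 R)).hom (a U Y' (S ⊠ R)) ≫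
        a (U ⊠ Y) S R ◁ (aNat (𝟙 U) i (𝟙 S ⊠₁ 𝟙 R)).hom) ≫
        a (U ⊠ Y) S R ◁ a U Y (S ⊠ R) ◁ (𝟙 (𝟙 U) ⊠₂ (𝟙 i ⊠₂ (tensorId S R).hom)) := by
      rw [Category.assoc, ← whiskerLeft_comp (a (U ⊠ Y) S R), ← e₄, e₅]
      simp only [t22]
      bicategory
    have h' := congrArg (· ≫ (α_ _ _ _).hom) h
    simp only [Category.assoc, Iso.inv_hom_id, Category.comp_id] at h'
    rw [e₆, Category.assoc, reassoc_of% h', e₃]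
    have e₇ := t32_exchange (𝟙 (𝟙 U) ⊠₂ (𝟙 i ⊠₂ (tensorId S R).hom)) (π U Y S R).hom
    calc
      _ = t22 (pf22 (rightTensor R) (aNat₂ U i S).hom) (a U (Y' ⊠ S) R ≫ 𝟙 U ⊠₁ a Y' S R) ≫
      (a U Y S ⊠₁ 𝟙 R) ◁ t22 (aNat₂ U (i ⊠₁ 𝟙 S) R).hom (𝟙 U ⊠₁ a Y' S R) ≫
      (a U Y S ⊠₁ 𝟙 R) ◁ a U (Y ⊠ S) R ◁ T22 (𝟙 (𝟙 U ≫ 𝟙 U)) (aNat i (𝟙 S) (𝟙 R)).hom ≫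
        t32 (π U Y S R).hom _ ≫
        a (U ⊠ Y) S R ◁ a U Y (S ⊠ R) ◁ (𝟙 (𝟙 U) ⊠₂ (𝟙 i ⊠₂ (tensorId S R).hom)) := by
        simp only [t22, t32, aNat₂]
        bicategory
      _ = _ := by
        rw [e₇]
        -- The copy of `tensorId S R` after `π` has been moved in front of it, where it completes
        -- `aNat` to `aNat₁`.
        simp only [t22, t32]
        bicategory
  calc
    _ = 𝟙 _ ⊗≫ ((((𝟙 U ⊠₁ i) ⊠₁ 𝟙 S) ⊠₁ 𝟙 R) ◁ (π U Y' S R).hom ≫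
      t22 (aNat₁ (𝟙 U ⊠₁ i) S R).hom (a U Y' (S ⊠ R)) ≫
      a (U ⊠ Y) S R ◁ (aNat₂ U i (S ⊠ R)).hom) ▷ z ⊗≫ 𝟙 _ := by
      simp only [t22, t32]
      bicategory
    _ = _ := by
      rw [H]
      simp only [t22, t32]
      bicategory

end MonBicat

/-! ### Rewriting rules for the constraints, with invertible cells moved across the equations -/

namespace MonBicat

section TensorCells

variable {B : Type u} [Bicategory.{w, v} B] [TensorStruct B] {X Y Y' Z W : B}

/-- `1η` for `η : h ⟶ f ≫ g`. -/
def L12 (U : B) {f : X ⟶ Y} {g : Y ⟶ Z} {h : X ⟶ Z} (η : h ⟶ f ≫ g) :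
    𝟙 U ⊠₁ h ⟶ 𝟙 U ⊠₁ f ≫ 𝟙 U ⊠₁ g := pf12 (leftTensor U) η

/-- `1η` for `η : f ≫ g ⟶ h`. -/
def L21 (U : B) {f : X ⟶ Y} {g : Y ⟶ Z} {h : X ⟶ Z} (η : f ≫ g ⟶ h) :
    𝟙 U ⊠₁ f ≫ 𝟙 U ⊠₁ g ⟶ 𝟙 U ⊠₁ h := pf21 (leftTensor U) η

/-- `1η` for `η : f ≫ g ⟶ h ≫ k`. -/
def L22 (U : B) {f : X ⟶ Y} {g : Y ⟶ Z} {h : X ⟶ W} {k : W ⟶ Z} (η : f ≫ g ⟶ h ≫ k) :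
    𝟙 U ⊠₁ f ≫ 𝟙 U ⊠₁ g ⟶ 𝟙 U ⊠₁ h ≫ 𝟙 U ⊠₁ k := pf22 (leftTensor U) η

/-- `1η` for `η : f ≫ g ≫ h ⟶ k ≫ l`. -/
def L32 (U : B) {f : X ⟶ Y} {g : Y ⟶ Y'} {h : Y' ⟶ Z} {k : X ⟶ W} {l : W ⟶ Z}
    (η : f ≫ g ≫ h ⟶ k ≫ l) :
    𝟙 U ⊠₁ f ≫ 𝟙 U ⊠₁ g ≫ 𝟙 U ⊠₁ h ⟶ 𝟙 U ⊠₁ k ≫ 𝟙 U ⊠₁ l := pf32 (leftTensor U) η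

/-- `η1` for `η : 𝟙 ⟶ f ≫ g`. -/
def R02 (U : B) {f : X ⟶ Y} {g : Y ⟶ X} (η : 𝟙 X ⟶ f ≫ g) :
    𝟙 (X ⊠ U) ⟶ f ⊠₁ 𝟙 U ≫ g ⊠₁ 𝟙 U := pf02 (rightTensor U) η

/-- `η1` for `η : h ⟶ f ≫ g`. -/
def R12 (U : B) {f : X ⟶ Y} {g : Y ⟶ Z} {h : X ⟶ Z} (η : h ⟶ f ≫ g) :
    h ⊠₁ 𝟙 U ⟶ f ⊠₁ 𝟙 U ≫ g ⊠₁ 𝟙 U := pf12 (rightTensor U) η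

/-- `η1` for `η : f ≫ g ⟶ h`. -/
def R21 (U : B) {f : X ⟶ Y} {g : Y ⟶ Z} {h : X ⟶ Z} (η : f ≫ g ⟶ h) :
    f ⊠₁ 𝟙 U ≫ g ⊠₁ 𝟙 U ⟶ h ⊠₁ 𝟙 U := pf21 (rightTensor U) η

/-- `η1` for `η : f ≫ g ⟶ h ≫ k`. -/
def R22 (U : B) {f : X ⟶ Y} {g : Y ⟶ Z} {h : X ⟶ W} {k : W ⟶ Z} (η : f ≫ g ⟶ h ≫ k) :
    f ⊠₁ 𝟙 U ≫ g ⊠₁ 𝟙 U ⟶ h ⊠₁ 𝟙 U ≫ k ⊠₁ 𝟙 U := pf22 (rightTensor U) η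

/-- `η1` for `η : f ≫ g ≫ h ⟶ k ≫ l`. -/
def R32 (U : B) {f : X ⟶ Y} {g : Y ⟶ Y'} {h : Y' ⟶ Z} {k : X ⟶ W} {l : W ⟶ Z}
    (η : f ≫ g ≫ h ⟶ k ≫ l) :
    f ⊠₁ 𝟙 U ≫ g ⊠₁ 𝟙 U ≫ h ⊠₁ 𝟙 U ⟶ k ⊠₁ 𝟙 U ≫ l ⊠₁ 𝟙 U := pf32 (rightTensor U) η

end TensorCells

section Inverses

variable {B : Type u} [Bicategory.{w, v} B] [TensorStruct B] {X Y Y' Z W V : B}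

theorem t22_L22_hom_inv (U : B) {f : X ⟶ Y} {g : Y ⟶ Z} {h : X ⟶ W} {k : W ⟶ Z}
    (e : f ≫ g ≅ h ≫ k) (z : U ⊠ Z ⟶ V) :
    t22 (L22 U e.hom) z ≫ t22 (L22 U e.inv) z = 𝟙 _ := by
  rw [← t22_comp, L22, L22, pf22_hom_inv]
  exact t22_id _ _ _

theorem t22_L22_inv_hom (U : B) {f : X ⟶ Y} {g : Y ⟶ Z} {h : X ⟶ W} {k : W ⟶ Z}
    (e : f ≫ g ≅ h ≫ k) (z : U ⊠ Z ⟶ V) :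
    t22 (L22 U e.inv) z ≫ t22 (L22 U e.hom) z = 𝟙 _ :=
  t22_L22_hom_inv U e.symm z

theorem t22_R22_hom_inv (U : B) {f : X ⟶ Y} {g : Y ⟶ Z} {h : X ⟶ W} {k : W ⟶ Z}
    (e : f ≫ g ≅ h ≫ k) (z : Z ⊠ U ⟶ V) :
    t22 (R22 U e.hom) z ≫ t22 (R22 U e.inv) z = 𝟙 _ := by
  rw [← t22_comp, R22, R22, pf22_hom_inv]
  exact t22_id _ _ _

theorem t22_R22_inv_hom (U : B) {f : X ⟶ Y} {g : Y ⟶ Z} {h : X ⟶ W} {k : W ⟶ Z}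
    (e : f ≫ g ≅ h ≫ k) (z : Z ⊠ U ⟶ V) :
    t22 (R22 U e.inv) z ≫ t22 (R22 U e.hom) z = 𝟙 _ :=
  t22_R22_hom_inv U e.symm z

theorem t21_L21_hom_inv (U : B) {f : X ⟶ Y} {g : Y ⟶ Z} {h : X ⟶ Z}
    (e : f ≫ g ≅ h) (z : U ⊠ Z ⟶ V) :
    t21 (L21 U e.hom) z ≫ t12 (L12 U e.inv) z = 𝟙 _ := by
  rw [t21_t12, L12, L21, pf21_hom_inv]
  exact t22_id _ _ _

theorem t12_R12_inv_hom (U : B) {f : X ⟶ Y} {g : Y ⟶ Z} {h : X ⟶ Z}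
    (e : f ≫ g ≅ h) (z : Z ⊠ U ⟶ V) :
    t12 (R12 U e.inv) z ≫ t21 (R21 U e.hom) z = 𝟙 _ := by
  rw [t12_t21, R12, R21, pf12_inv_hom]
  exact id_whiskerRight _ _

theorem t21_R21_hom_inv (U : B) {f : X ⟶ Y} {g : Y ⟶ Z} {h : X ⟶ Z}
    (e : f ≫ g ≅ h) (z : Z ⊠ U ⟶ V) :
    t21 (R21 U e.hom) z ≫ t12 (R12 U e.inv) z = 𝟙 _ := by
  rw [t21_t12, R12, R21, pf21_hom_inv]
  exact t22_id _ _ _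

end Inverses

section Flip

variable {C : Type u} [Category.{v} C] {A₀ A₁ A₂ A₃ A₄ A₅ A₆ A₇ : C}

/-- These small lemmas move invertible factors to the other side. They ask only for the one-sided
inverse laws that are used, which spares packaging whiskered constraints as isomorphisms. -/
theorem comp_eq_of_eq_comp {f : A₀ ⟶ A₁} {f' : A₁ ⟶ A₀} {g : A₂ ⟶ A₁} {g' : A₁ ⟶ A₂}
    {x : A₀ ⟶ A₂} (h : f = x ≫ g) (hf : f' ≫ f = 𝟙 _) (hg : g ≫ g' = 𝟙 _) : f' ≫ x = g' := by
  rw [← Category.id_comp g', ← hf, h, Category.assoc, Category.assoc, hg, Category.comp_id]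

theorem flip_of_comp_eq_comp {f : A₀ ⟶ A₁} {f' : A₁ ⟶ A₀} {g : A₂ ⟶ A₃} {g' : A₃ ⟶ A₂}
    {x : A₀ ⟶ A₂} {y : A₁ ⟶ A₃} (h : f ≫ y = x ≫ g) (hf : f' ≫ f = 𝟙 _) (hg : g ≫ g' = 𝟙 _) :
    y ≫ g' = f' ≫ x := by
  have h' := congrArg (f' ≫ · ≫ g') h
  simp only [Category.assoc, hg, Category.comp_id, reassoc_of% hf] at h'
  exact h'

theorem eq_of_comp_eq_id {f g : A₀ ⟶ A₁} {f' g' : A₁ ⟶ A₀} (h : f = g) (hf : f' ≫ f = 𝟙 _)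
    (hg : g ≫ g' = 𝟙 _) : f' = g' := by
  rw [← Category.comp_id f', ← hg, ← h, reassoc_of% hf]

theorem comp_comp_eq_id {f : A₀ ⟶ A₁} {g : A₁ ⟶ A₂} {g' : A₂ ⟶ A₁} {f' : A₁ ⟶ A₀}
    (hg : g ≫ g' = 𝟙 _) (hf : f ≫ f' = 𝟙 _) : (f ≫ g) ≫ g' ≫ f' = 𝟙 _ := by
  rw [Category.assoc, reassoc_of% hg, hf]

end Flip

theorem whiskerLeft_comp_eq_id {B : Type u} [Bicategory.{w, v} B] {X Y Z : B} (f : X ⟶ Y)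
    {g h : Y ⟶ Z} {η : g ⟶ h} {θ : h ⟶ g} (e : η ≫ θ = 𝟙 _) : f ◁ η ≫ f ◁ θ = 𝟙 _ := by
  rw [← whiskerLeft_comp, e, whiskerLeft_id]

section Structural

open MonoidalBicategory

variable {B : Type u} [Bicategory.{w, v} B]

section
variable [TensorStruct B]

theorem interchange_inv_second (X : B) {X' Y Y' Y'' V : B} (p : X ⟶ X') {f : Y ⟶ Y'} {g : Y' ⟶ Y''}
    {h : Y ⟶ Y''} (φ : h ⟶ f ≫ g) (z : X' ⊠ Y'' ⟶ V) :
    t22 (interchange p h).inv z ≫ (p ⊠₁ 𝟙 Y) ◁ t12 (L12 X' φ) z =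
      t12 (L12 X φ) (p ⊠₁ 𝟙 Y'' ≫ z) ≫ (𝟙 X ⊠₁ f) ◁ t22 (interchange p g).inv z ≫
        t22 (interchange p f).inv (𝟙 X' ⊠₁ g ≫ z) :=
  nat12_whiskerRight (Nf := (interchange p f).symm) (Ng := (interchange p g).symm)
    (Nh := (interchange p h).symm) (interchange_symm_nat12 p φ) z

theorem interchange_inv_first {X X' X'' Y Y' V : B} {f : X ⟶ X'} {g : X' ⟶ X''}
    {h : X ⟶ X''} (φ : f ≫ g ⟶ h) (s : Y ⟶ Y') (z : X'' ⊠ Y' ⟶ V) :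
    (𝟙 X ⊠₁ s) ◁ t21 (R21 Y' φ) z ≫ t22 (interchange h s).inv z =
      t22 (interchange f s).inv (g ⊠₁ 𝟙 Y' ≫ z) ≫ (f ⊠₁ 𝟙 Y) ◁ t22 (interchange g s).inv z ≫
        t21 (R21 Y φ) (𝟙 X'' ⊠₁ s ≫ z) :=
  nat21_inv (interchange_nat21 φ s) z

theorem interchange_inv_unit {X X' Y Y' V : B} {f : X ⟶ X'} {g : X' ⟶ X}
    (φ : 𝟙 X ⟶ f ≫ g) (s : Y ⟶ Y') (z : X ⊠ Y' ⟶ V) :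
    (𝟙 X ⊠₁ s) ◁ t02 (R02 Y' φ) z ≫ t22 (interchange f s).inv (g ⊠₁ 𝟙 Y' ≫ z) ≫
        (f ⊠₁ 𝟙 Y) ◁ t22 (interchange g s).inv z =
      t02 (R02 Y φ) (𝟙 X ⊠₁ s ≫ z) :=
  nat02_inv (interchange_nat02 φ s) z

theorem aNat₁_inv_nat {X X' X'' V : B} {f : X ⟶ X'} {g : X' ⟶ X''}
    {h : X ⟶ X''} (φ : f ≫ g ⟶ h) (Y Z : B) (z : X'' ⊠ (Y ⊠ Z) ⟶ V) :
    a X Y Z ◁ t21 (R21 (Y ⊠ Z) φ) z ≫ t22 (aNat₁ h Y Z).inv z =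
      t22 (aNat₁ f Y Z).inv (g ⊠₁ 𝟙 (Y ⊠ Z) ≫ z) ≫
        ((f ⊠₁ 𝟙 Y) ⊠₁ 𝟙 Z) ◁ t22 (aNat₁ g Y Z).inv z ≫ t21 (R21 Z (R21 Y φ)) (a X'' Y Z ≫ z) :=
  nat21_inv (aNat₁_nat21 φ Y Z) z

theorem aNat₁_inv_unit {X X' V : B} {f : X ⟶ X'} {g : X' ⟶ X}
    (φ : 𝟙 X ⟶ f ≫ g) (Y Z : B) (z : X ⊠ (Y ⊠ Z) ⟶ V) :
    a X Y Z ◁ t02 (R02 (Y ⊠ Z) φ) z ≫ t22 (aNat₁ f Y Z).inv (g ⊠₁ 𝟙 (Y ⊠ Z) ≫ z) ≫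
        ((f ⊠₁ 𝟙 Y) ⊠₁ 𝟙 Z) ◁ t22 (aNat₁ g Y Z).inv z =
      t02 (R02 Z (R02 Y φ)) (a X Y Z ≫ z) :=
  nat02_inv (aNat₁_nat02 φ Y Z) z

/-- Tailored to moving a right unitor such as `ρt` from `U ⊠ (- ⊠ R)` to `(U ⊠ -) ⊠ R`: the
constraint at `f` cancels, and only the one at `g` survives. -/
theorem aNat₂_nat_merge (U : B) {Y Y' Y'' V : B} {f : Y ⟶ Y'} {g : Y' ⟶ Y''}
    {h : Y ⟶ Y''} (φ : f ≫ g ⟶ h) (R : B) (z : U ⊠ (Y'' ⊠ R) ⟶ V) :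
    t22 (aNat₂ U f R).hom (𝟙 U ⊠₁ (g ⊠₁ 𝟙 R) ≫ z) ≫ a U Y R ◁ t21 (L21 U (R21 R φ)) z ≫
        t22 (aNat₂ U h R).inv z =
      ((𝟙 U ⊠₁ f) ⊠₁ 𝟙 R) ◁ t22 (aNat₂ U g R).inv z ≫ t21 (R21 R (L21 U φ)) (a U Y'' R ≫ z) := by
  have H := nat21_inv (aNat₂_nat21 U φ R) z
  refine (congrArg (t22 (aNat₂ U f R).hom (𝟙 U ⊠₁ (g ⊠₁ 𝟙 R) ≫ z) ≫ ·) H).trans ?_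
  rw [reassoc_of% t22_hom_inv (aNat₂ U f R) (𝟙 U ⊠₁ (g ⊠₁ 𝟙 R) ≫ z)]
  rfl

theorem aNat₂_nat_split (U : B) {Y Y' Y'' V : B} {f : Y ⟶ Y'} {g : Y' ⟶ Y''}
    {h : Y ⟶ Y''} (φ : h ⟶ f ≫ g) (R : B) (z : U ⊠ (Y'' ⊠ R) ⟶ V) :
    t22 (aNat₂ U h R).hom z ≫ a U Y R ◁ t12 (L12 U (R12 R φ)) z ≫
        t22 (aNat₂ U f R).inv (𝟙 U ⊠₁ (g ⊠₁ 𝟙 R) ≫ z) ≫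
        ((𝟙 U ⊠₁ f) ⊠₁ 𝟙 R) ◁ t22 (aNat₂ U g R).inv z =
      t12 (R12 R (L12 U φ)) (a U Y'' R ≫ z) := by
  have H : t22 (aNat₂ U h R).hom z ≫ a U Y R ◁ t12 (L12 U (R12 R φ)) z =
      t12 (R12 R (L12 U φ)) (a U Y'' R ≫ z) ≫ ((𝟙 U ⊠₁ f) ⊠₁ 𝟙 R) ◁ t22 (aNat₂ U g R).hom z ≫
        t22 (aNat₂ U f R).hom (𝟙 U ⊠₁ (g ⊠₁ 𝟙 R) ≫ z) :=
    nat12_whiskerRight (aNat₂_nat12 U φ R) z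
  have h₁ := congrArg (((𝟙 U ⊠₁ f) ⊠₁ 𝟙 R) ◁ ·) (t22_hom_inv (aNat₂ U g R) z)
  simp only [whiskerLeft_comp, whiskerLeft_id] at h₁
  rw [reassoc_of% H, reassoc_of% t22_hom_inv (aNat₂ U f R) (𝟙 U ⊠₁ (g ⊠₁ 𝟙 R) ≫ z), h₁,
    Category.comp_id]

theorem aNat₃_nat (U T : B) {Y Y' Y'' V : B} {f : Y ⟶ Y'} {g : Y' ⟶ Y''}
    {h : Y ⟶ Y''} (φ : h ⟶ f ≫ g) (z : U ⊠ (T ⊠ Y'') ⟶ V) :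
    t22 (aNat₃ U T h).hom z ≫ a U T Y ◁ t12 (L12 U (L12 T φ)) z =
      t12 (L12 (U ⊠ T) φ) (a U T Y'' ≫ z) ≫ (𝟙 (U ⊠ T) ⊠₁ f) ◁ t22 (aNat₃ U T g).hom z ≫
        t22 (aNat₃ U T f).hom (𝟙 U ⊠₁ (𝟙 T ⊠₁ g) ≫ z) :=
  nat12_whiskerRight (aNat₃_nat12 U T φ) z

theorem rNat_inv_nat {X X' X'' : B} {f : X ⟶ X'} {g : X' ⟶ X''} {h : X ⟶ X''} (φ : f ≫ g ⟶ h) :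
    t22 (rNat f).inv g ≫ (f ⊠₁ 𝟙 (I B)) ◁ (rNat g).inv ≫ t21 (R21 (I B) φ) (r X'') =
      r X ◁ φ ≫ (rNat h).inv := by
  have H := rNat_nat21 φ
  have h₁ := congrArg ((f ⊠₁ 𝟙 (I B)) ◁ ·) (rNat g).inv_hom_id
  simp only [whiskerLeft_comp, whiskerLeft_id] at h₁
  rw [Iso.eq_comp_inv, Category.assoc, Category.assoc]
  refine (congrArg (fun x => t22 (rNat f).inv g ≫ (f ⊠₁ 𝟙 (I B)) ◁ (rNat g).inv ≫ x) H).trans ?_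
  rw [reassoc_of% h₁, reassoc_of% t22_inv_hom (rNat f) g]

theorem rNat_unit {X X' V : B} {f : X ⟶ X'} {g : X' ⟶ X} (φ : 𝟙 X ⟶ f ≫ g) (z : X ⟶ V) :
    t02 (R02 (I B) φ) (r X ≫ z) ≫ (f ⊠₁ 𝟙 (I B)) ◁ t22 (rNat g).hom z ≫
        t22 (rNat f).hom (g ≫ z) =
      r X ◁ t02 φ z :=
  nat02_whiskerRight (rNat_nat02 φ) z

theorem aNat₁_aNat₂ {X X' Y Y' V : B} (p : X ⟶ X') (i : Y ⟶ Y') (Z : B)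
    (z : X' ⊠ (Y' ⊠ Z) ⟶ V) :
    a X Y Z ◁ t22 (interchange p (i ⊠₁ 𝟙 Z)).inv z ≫
        t22 (aNat₁ p Y Z).inv (𝟙 X' ⊠₁ (i ⊠₁ 𝟙 Z) ≫ z) ≫
        ((p ⊠₁ 𝟙 Y) ⊠₁ 𝟙 Z) ◁ t22 (aNat₂ X' i Z).inv z =
      t22 (aNat₂ X i Z).inv (p ⊠₁ 𝟙 (Y' ⊠ Z) ≫ z) ≫
        ((𝟙 X ⊠₁ i) ⊠₁ 𝟙 Z) ◁ t22 (aNat₁ p Y' Z).inv z ≫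
        t22 (R22 Z (interchange p i).inv) (a X' Y' Z ≫ z) :=
  nat22_inv (aNat₁_nat22 p i Z) z

theorem aNat₂_aNat₃ (X : B) {Y Y' Z Z' V : B} (i : Y ⟶ Y') (s : Z ⟶ Z')
    (z : X ⊠ (Y' ⊠ Z') ⟶ V) :
    (𝟙 (X ⊠ Y) ⊠₁ s) ◁ t22 (aNat₂ X i Z').inv z ≫
        t22 (interchange (𝟙 X ⊠₁ i) s).inv (a X Y' Z' ≫ z) ≫
        ((𝟙 X ⊠₁ i) ⊠₁ 𝟙 Z) ◁ t22 (aNat₃ X Y' s).hom z =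
      t22 (aNat₃ X Y s).hom (𝟙 X ⊠₁ (i ⊠₁ 𝟙 Z') ≫ z) ≫
        a X Y Z ◁ t22 (L22 X (interchange i s).inv) z ≫
        t22 (aNat₂ X i Z).inv (𝟙 X ⊠₁ (𝟙 Y' ⊠₁ s) ≫ z) :=
  nat22_inv_hom (aNat₃_nat22 X i s) z

end

variable [MonoidalBicategory B]

/-- `π_nat_third` with its invertible pieces rearranged to the left-hand pattern met when a unit `i`
is inserted into a tetrahedron. The rules up to `rho_second` arise in the same way from their
counterparts. -/
theorem π_inv_third (U T : B) {Y Y' V : B} (i : Y ⟶ Y') (R : B) (y : U ⊠ (T ⊠ (Y' ⊠ R)) ⟶ V) :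
    a (U ⊠ T) Y R ◁ t22 (aNat₃ U T (i ⊠₁ 𝟙 R)).hom y ≫
        t23 (π U T Y R).inv (𝟙 U ⊠₁ (𝟙 T ⊠₁ (i ⊠₁ 𝟙 R)) ≫ y) ≫
        (a U T Y ⊠₁ 𝟙 R) ◁ a U (T ⊠ Y) R ◁ t22 (L22 U (aNat₂ T i R).inv) y =
      t22 (aNat₂ (U ⊠ T) i R).inv (a U T (Y' ⊠ R) ≫ y) ≫
        ((𝟙 (U ⊠ T) ⊠₁ i) ⊠₁ 𝟙 R) ◁ t23 (π U T Y' R).inv y ≫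
        t22 (R22 R (aNat₃ U T i).hom) (a U (T ⊠ Y') R ≫ 𝟙 U ⊠₁ a T Y' R ≫ y) ≫
        (a U T Y ⊠₁ 𝟙 R) ◁ t22 (aNat₂ U (𝟙 T ⊠₁ i) R).hom (𝟙 U ⊠₁ a T Y' R ≫ y) := by
  have H := flip_of_comp_eq_comp
    (f := ((𝟙 (U ⊠ T) ⊠₁ i) ⊠₁ 𝟙 R) ◁ t32 (π U T Y' R).hom y ≫
      t22 (aNat₂ (U ⊠ T) i R).hom (a U T (Y' ⊠ R) ≫ y))
    (x := t22 (R22 R (aNat₃ U T i).hom) (a U (T ⊠ Y') R ≫ 𝟙 U ⊠₁ a T Y' R ≫ y) ≫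
      (a U T Y ⊠₁ 𝟙 R) ◁ t22 (aNat₂ U (𝟙 T ⊠₁ i) R).hom (𝟙 U ⊠₁ a T Y' R ≫ y))
    (g := (a U T Y ⊠₁ 𝟙 R) ◁ a U (T ⊠ Y) R ◁ t22 (L22 U (aNat₂ T i R).hom) y ≫
      t32 (π U T Y R).hom (𝟙 U ⊠₁ (𝟙 T ⊠₁ (i ⊠₁ 𝟙 R)) ≫ y))
    (by simpa only [Category.assoc, L22, R22] using π_nat_third U T i R y)
    (comp_comp_eq_id (whiskerLeft_comp_eq_id _ (t32_inv_hom (π U T Y' R) y))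
      (t22_inv_hom (aNat₂ (U ⊠ T) i R) (a U T (Y' ⊠ R) ≫ y)))
    (comp_comp_eq_id (t32_hom_inv (π U T Y R) (𝟙 U ⊠₁ (𝟙 T ⊠₁ (i ⊠₁ 𝟙 R)) ≫ y))
      (whiskerLeft_comp_eq_id _ (whiskerLeft_comp_eq_id _
        (t22_L22_hom_inv U (aNat₂ T i R) y))))
  simpa only [Category.assoc] using H

theorem π_inv_second (U : B) {Y Y' V : B} (i : Y ⟶ Y') (S R : B)
    (z : U ⊠ (Y' ⊠ (S ⊠ R)) ⟶ V) :
    a (U ⊠ Y) S R ◁ t22 (aNat₂ U i (S ⊠ R)).inv z ≫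
        t22 (aNat₁ (𝟙 U ⊠₁ i) S R).inv (a U Y' (S ⊠ R) ≫ z) ≫
        (((𝟙 U ⊠₁ i) ⊠₁ 𝟙 S) ⊠₁ 𝟙 R) ◁ t23 (π U Y' S R).inv z =
      t23 (π U Y S R).inv (𝟙 U ⊠₁ (i ⊠₁ 𝟙 (S ⊠ R)) ≫ z) ≫
        (a U Y S ⊠₁ 𝟙 R) ◁ a U (Y ⊠ S) R ◁ t22 (L22 U (aNat₁ i S R).inv) z ≫
        (a U Y S ⊠₁ 𝟙 R) ◁ t22 (aNat₂ U (i ⊠₁ 𝟙 S) R).inv (𝟙 U ⊠₁ a Y' S R ≫ z) ≫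
        t22 (R22 R (aNat₂ U i S).inv) (a U (Y' ⊠ S) R ≫ 𝟙 U ⊠₁ a Y' S R ≫ z) := by
  have H := eq_of_comp_eq_id
    (f := (((𝟙 U ⊠₁ i) ⊠₁ 𝟙 S) ⊠₁ 𝟙 R) ◁ t32 (π U Y' S R).hom z ≫
      t22 (aNat₁ (𝟙 U ⊠₁ i) S R).hom (a U Y' (S ⊠ R) ≫ z) ≫
      a (U ⊠ Y) S R ◁ t22 (aNat₂ U i (S ⊠ R)).hom z)
    (g := ((t22 (R22 R (aNat₂ U i S).hom) (a U (Y' ⊠ S) R ≫ 𝟙 U ⊠₁ a Y' S R ≫ z) ≫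
      (a U Y S ⊠₁ 𝟙 R) ◁ t22 (aNat₂ U (i ⊠₁ 𝟙 S) R).hom (𝟙 U ⊠₁ a Y' S R ≫ z)) ≫
      (a U Y S ⊠₁ 𝟙 R) ◁ a U (Y ⊠ S) R ◁ t22 (L22 U (aNat₁ i S R).hom) z) ≫
      t32 (π U Y S R).hom (𝟙 U ⊠₁ (i ⊠₁ 𝟙 (S ⊠ R)) ≫ z))
    (by simpa only [Category.assoc, L22, R22] using π_nat_second U i S R z)
    (comp_comp_eq_id (whiskerLeft_comp_eq_id _ (t32_inv_hom (π U Y' S R) z))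
      (comp_comp_eq_id (t22_inv_hom (aNat₁ (𝟙 U ⊠₁ i) S R) (a U Y' (S ⊠ R) ≫ z))
        (whiskerLeft_comp_eq_id _ (t22_inv_hom (aNat₂ U i (S ⊠ R)) z))))
    (comp_comp_eq_id (t32_hom_inv (π U Y S R) (𝟙 U ⊠₁ (i ⊠₁ 𝟙 (S ⊠ R)) ≫ z))
      (comp_comp_eq_id (whiskerLeft_comp_eq_id _ (whiskerLeft_comp_eq_id _
          (t22_L22_hom_inv U (aNat₁ i S R) z)))
        (comp_comp_eq_id (whiskerLeft_comp_eq_id _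
            (t22_hom_inv (aNat₂ U (i ⊠₁ 𝟙 S) R) (𝟙 U ⊠₁ a Y' S R ≫ z)))
          (t22_R22_hom_inv R (aNat₂ U i S) (a U (Y' ⊠ S) R ≫ 𝟙 U ⊠₁ a Y' S R ≫ z)))))
  simpa only [Category.assoc] using H

theorem μ_inv_first {X X' V : B} (p : X ⟶ X') (Y : B) (z : X' ⊠ Y ⟶ V) :
    t22 (R22 Y (rNat p).inv) z ≫ ((p ⊠₁ 𝟙 (I B)) ⊠₁ 𝟙 Y) ◁ t12 (μ X' Y).inv z =
      t12 (μ X Y).inv (p ⊠₁ 𝟙 Y ≫ z) ≫ a X (I B) Y ◁ t22 (interchange p (l Y)).inv z ≫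
        t22 (aNat₁ p (I B) Y).inv (𝟙 X' ⊠₁ l Y ≫ z) := by
  have H := eq_of_comp_eq_id
    (f := ((p ⊠₁ 𝟙 (I B)) ⊠₁ 𝟙 Y) ◁ t21 (μ X' Y).hom z ≫ t22 (R22 Y (rNat p).hom) z)
    (g := (t22 (aNat₁ p (I B) Y).hom (𝟙 X' ⊠₁ l Y ≫ z) ≫
        a X (I B) Y ◁ t22 (interchange p (l Y)).hom z) ≫ t21 (μ X Y).hom (p ⊠₁ 𝟙 Y ≫ z))
    (by simpa only [Category.assoc, L22, R22] using μ_nat_first p Y z)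
    (comp_comp_eq_id (whiskerLeft_comp_eq_id _ (t21_inv_hom (μ X' Y) z))
      (t22_R22_inv_hom Y (rNat p) z))
    (comp_comp_eq_id (t21_hom_inv (μ X Y) (p ⊠₁ 𝟙 Y ≫ z))
      (comp_comp_eq_id (whiskerLeft_comp_eq_id _ (t22_hom_inv (interchange p (l Y)) z))
        (t22_hom_inv (aNat₁ p (I B) Y) (𝟙 X' ⊠₁ l Y ≫ z))))
  simpa only [Category.assoc] using H

theorem μ_inv_second (X : B) {Y Y' V : B} (s : Y ⟶ Y') (z : X ⊠ Y' ⟶ V) :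
    t22 (interchange (r X) s).hom z ≫ (𝟙 (X ⊠ I B) ⊠₁ s) ◁ t12 (μ X Y').inv z ≫
        t22 (aNat₃ X (I B) s).hom (𝟙 X ⊠₁ l Y' ≫ z) ≫
        a X (I B) Y ◁ t22 (L22 X (lNat s).hom) z =
      t12 (μ X Y).inv (𝟙 X ⊠₁ s ≫ z) := by
  have H := comp_eq_of_eq_comp
    (f := (𝟙 (X ⊠ I B) ⊠₁ s) ◁ t21 (μ X Y').hom z ≫ t22 (interchange (r X) s).inv z)
    (x := t22 (aNat₃ X (I B) s).hom (𝟙 X ⊠₁ l Y' ≫ z) ≫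
        a X (I B) Y ◁ t22 (L22 X (lNat s).hom) z)
    (by simpa only [Category.assoc, L22, R22] using μ_nat_second X s z)
    (comp_comp_eq_id (whiskerLeft_comp_eq_id _ (t21_inv_hom (μ X Y') z))
      (t22_hom_inv (interchange (r X) s) z))
    (t21_hom_inv (μ X Y) (𝟙 X ⊠₁ s ≫ z))
  simpa only [Category.assoc] using H

theorem rho_second (X : B) {Y Y' V : B} (i : Y ⟶ Y') (z : X ⊠ Y' ⟶ V) :
    a X Y (I B) ◁ t22 (L22 X (rNat i).inv) z ≫ t22 (aNat₂ X i (I B)).inv (𝟙 X ⊠₁ r Y' ≫ z) ≫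
        ((𝟙 X ⊠₁ i) ⊠₁ 𝟙 (I B)) ◁ t21 (rho X Y').hom z =
      t21 (rho X Y).hom (𝟙 X ⊠₁ i ≫ z) ≫ t22 (rNat (𝟙 X ⊠₁ i)).inv z := by
  have H := flip_of_comp_eq_comp
    (f := t22 (aNat₂ X i (I B)).hom (𝟙 X ⊠₁ r Y' ≫ z) ≫
        a X Y (I B) ◁ t22 (L22 X (rNat i).hom) z)
    (by simpa only [Category.assoc, L22, R22] using (rho_nat_second X i z).symm)
    (comp_comp_eq_id (t22_inv_hom (aNat₂ X i (I B)) (𝟙 X ⊠₁ r Y' ≫ z))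
      (whiskerLeft_comp_eq_id _ (t22_L22_inv_hom X (rNat i) z)))
    (t22_hom_inv (rNat (𝟙 X ⊠₁ i)) z)
  simpa only [Category.assoc] using H.symm

theorem right_normalisation_inv (X Y Z : B) {V : B} (z : X ⊠ (Y ⊠ Z) ⟶ V) :
    t12 (R12 Z (rho X Y).inv) (a X Y Z ≫ z) ≫
        (a X Y (I B) ⊠₁ 𝟙 Z) ◁ t22 (aNat₂ X (r Y) Z).hom z ≫
        (a X Y (I B) ⊠₁ 𝟙 Z) ◁ a X (Y ⊠ I B) Z ◁ t12 (L12 X (μ Y Z).inv) z =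
      t12 (μ (X ⊠ Y) Z).inv (a X Y Z ≫ z) ≫ a (X ⊠ Y) (I B) Z ◁ t22 (aNat₃ X Y (l Z)).hom z ≫
        t23 (π X Y (I B) Z).inv (𝟙 X ⊠₁ (𝟙 Y ⊠₁ l Z) ≫ z) := by
  have h : t32 (π X Y (I B) Z).hom (𝟙 X ⊠₁ (𝟙 Y ⊠₁ l Z) ≫ z) ≫
      a (X ⊠ Y) (I B) Z ◁ t22 (aNat₃ X Y (l Z)).inv z ≫ t21 (μ (X ⊠ Y) Z).hom (a X Y Z ≫ z) =
      (a X Y (I B) ⊠₁ 𝟙 Z) ◁ a X (Y ⊠ I B) Z ◁ t21 (L21 X (μ Y Z).hom) z ≫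
        (a X Y (I B) ⊠₁ 𝟙 Z) ◁ t22 (aNat₂ X (r Y) Z).inv z ≫
        t21 (R21 Z (rho X Y).hom) (a X Y Z ≫ z) := by
    -- The axiom has no tail; whiskering it with `z` supplies one.
    have e := congrArg (fun x => 𝟙 ((a X Y (I B) ⊠₁ 𝟙 Z) ≫ a X (Y ⊠ I B) Z ≫
      (𝟙 X ⊠₁ a Y (I B) Z) ≫ (𝟙 X ⊠₁ (𝟙 Y ⊠₁ l Z)) ≫ z) ⊗≫ x ▷ z ⊗≫
      𝟙 ((r (X ⊠ Y) ⊠₁ 𝟙 Z) ≫ a X Y Z ≫ z)) (right_normalisation X Y Z)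
    have h₁ : L21 X (μ Y Z).hom = (compL X _ _).inv ≫ (𝟙 (𝟙 X) ⊠₂ (μ Y Z).hom) := rfl
    have h₂ : R21 Z (rho X Y).hom = (compR _ _ Z).inv ≫ ((rho X Y).hom ⊠₂ 𝟙 (𝟙 Z)) := rfl
    simp only [← h₁, ← h₂] at e
    calc
      _ = _ := by
        simp only [t21, t22, t32]
        bicategory
      _ = _ := e
      _ = _ := by
        simp only [t21, t22]
        bicategory
  have H := eq_of_comp_eq_id h
    (comp_comp_eq_id (t32_inv_hom (π X Y (I B) Z) (𝟙 X ⊠₁ (𝟙 Y ⊠₁ l Z) ≫ z))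
      (comp_comp_eq_id (whiskerLeft_comp_eq_id _ (t22_hom_inv (aNat₃ X Y (l Z)) z))
        (t21_inv_hom (μ (X ⊠ Y) Z) (a X Y Z ≫ z))))
    (comp_comp_eq_id (comp_comp_eq_id (t21_R21_hom_inv Z (rho X Y) (a X Y Z ≫ z))
      (whiskerLeft_comp_eq_id _ (t22_inv_hom (aNat₂ X (r Y) Z) z)))
      (whiskerLeft_comp_eq_id _ (whiskerLeft_comp_eq_id _ (t21_L21_hom_inv X (μ Y Z) z))))
  simpa only [Category.assoc] using H.symm

theorem left_normalisation_inv (X Y Z : B) {V : B} (z : X ⊠ (Y ⊠ Z) ⟶ V) :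
    t22 (aNat₁ (r X) Y Z).hom z ≫ a (X ⊠ I B) Y Z ◁ t12 (μ X (Y ⊠ Z)).inv z ≫
        t23 (π X (I B) Y Z).inv (𝟙 X ⊠₁ l (Y ⊠ Z) ≫ z) ≫
        (a X (I B) Y ⊠₁ 𝟙 Z) ◁ a X (I B ⊠ Y) Z ◁ t21 (L21 X (lam Y Z).hom) z =
      t12 (R12 Z (μ X Y).inv) (a X Y Z ≫ z) ≫
        (a X (I B) Y ⊠₁ 𝟙 Z) ◁ t22 (aNat₂ X (l Y) Z).hom z := by
  have h : t32 (π X (I B) Y Z).hom (𝟙 X ⊠₁ l (Y ⊠ Z) ≫ z) ≫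
      a (X ⊠ I B) Y Z ◁ t21 (μ X (Y ⊠ Z)).hom z ≫ t22 (aNat₁ (r X) Y Z).inv z =
      (a X (I B) Y ⊠₁ 𝟙 Z) ◁ a X (I B ⊠ Y) Z ◁ t21 (L21 X (lam Y Z).hom) z ≫
        (a X (I B) Y ⊠₁ 𝟙 Z) ◁ t22 (aNat₂ X (l Y) Z).inv z ≫
        t21 (R21 Z (μ X Y).hom) (a X Y Z ≫ z) := by
    have e := congrArg (fun x => 𝟙 ((a X (I B) Y ⊠₁ 𝟙 Z) ≫ a X (I B ⊠ Y) Z ≫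
      (𝟙 X ⊠₁ a (I B) Y Z) ≫ (𝟙 X ⊠₁ l (Y ⊠ Z)) ≫ z) ⊗≫ x ▷ z ⊗≫
      𝟙 (((r X ⊠₁ 𝟙 Y) ⊠₁ 𝟙 Z) ≫ a X Y Z ≫ z)) (left_normalisation X Y Z)
    have h₁ : L21 X (lam Y Z).hom = (compL X _ _).inv ≫ (𝟙 (𝟙 X) ⊠₂ (lam Y Z).hom) := rfl
    have h₂ : R21 Z (μ X Y).hom = (compR _ _ Z).inv ≫ ((μ X Y).hom ⊠₂ 𝟙 (𝟙 Z)) := rfl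
    simp only [← h₁, ← h₂] at e
    calc
      _ = _ := by
        simp only [t21, t22, t32]
        bicategory
      _ = _ := e
      _ = _ := by
        simp only [t21, t22]
        bicategory
  have H := comp_eq_of_eq_comp h
    (comp_comp_eq_id (t32_inv_hom (π X (I B) Y Z) (𝟙 X ⊠₁ l (Y ⊠ Z) ≫ z))
      (comp_comp_eq_id (whiskerLeft_comp_eq_id _ (t21_inv_hom (μ X (Y ⊠ Z)) z))
        (t22_hom_inv (aNat₁ (r X) Y Z) z)))
    (comp_comp_eq_id (t21_R21_hom_inv Z (μ X Y) (a X Y Z ≫ z))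
      (whiskerLeft_comp_eq_id _ (t22_inv_hom (aNat₂ X (l Y) Z) z)))
  simpa only [Category.assoc] using H

end Structural

end MonBicat

/-! ### Cancelling unit equivalences, and right-bracketed forms of the pasting conditions -/

namespace MonBicat

section Equiv

variable {B : Type u} [Bicategory.{w, v} B]

/-- Whiskering `p ◁ χ` further with `q` and conjugating by `e` gives back `χ`; no triangle identity
is involved. -/
theorem whiskerLeft_injective_of_equiv {X Y Z : B} {p : X ⟶ Y} {q : Y ⟶ X} (e : q ≫ p ≅ 𝟙 Y)
    {f g : Y ⟶ Z} {φ ψ : f ⟶ g} (h : p ◁ φ = p ◁ ψ) : φ = ψ := by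
  have key : ∀ χ : f ⟶ g, χ = (λ_ f).inv ≫ e.inv ▷ f ≫ (α_ q p f).hom ≫ q ◁ p ◁ χ ≫
      (α_ q p g).inv ≫ e.hom ▷ g ≫ (λ_ g).hom := by
    intro χ
    rw [associator_inv_naturality_right_assoc, whisker_exchange_assoc]
    simp
  rw [key φ, h, ← key ψ]

end Equiv

section Forms

open MonoidalBicategory

variable {B : Type u} [Bicategory.{w, v} B] [MonoidalBicategory B]

/-- The condition in a form to which equational rewriting applies: every cell has an explicit tail,
and the associators hidden in `⊗≫` are gone. -/
theorem isTetrahedron_iff {R S T U : B} {s : S ⊠ R ⟶ S} {t : T ⊠ S ⟶ T} {u : U ⊠ T ⟶ U}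
    {v : T ⊠ R ⟶ T} {x : U ⊠ S ⟶ U} {w : U ⊠ R ⟶ U}
    (α : Square s t v) (β : Square s x w) (γ : Square v u w) (ζ : Square t u x) :
    IsTetrahedron α β γ ζ ↔
    a (U ⊠ T) S R ◁ t22 (aNat₃ U T s).hom (𝟙 U ⊠₁ t ≫ u) ≫
      t23 (π U T S R).inv (𝟙 U ⊠₁ (𝟙 T ⊠₁ s) ≫ 𝟙 U ⊠₁ t ≫ u) ≫
      (a U T S ⊠₁ 𝟙 R) ◁ a U (T ⊠ S) R ◁ t32 (L32 U α) u ≫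
      (a U T S ⊠₁ 𝟙 R) ◁ t22 (aNat₂ U t R).inv (𝟙 U ⊠₁ v ≫ u) ≫
      (a U T S ⊠₁ 𝟙 R) ◁ ((𝟙 U ⊠₁ t) ⊠₁ 𝟙 R) ◁ γ ≫
      t32 (R32 R ζ) w =
    a (U ⊠ T) S R ◁ (𝟙 (U ⊠ T) ⊠₁ s) ◁ ζ ≫
      a (U ⊠ T) S R ◁ t22 (interchange u s).inv x ≫
      t22 (aNat₁ u S R).inv (𝟙 U ⊠₁ s ≫ x) ≫
      ((u ⊠₁ 𝟙 S) ⊠₁ 𝟙 R) ◁ β := by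
  unfold IsTetrahedron
  apply iff_of_eq
  have h₁ : L32 U α = α.whiskerL U := rfl
  have h₂ : R32 R ζ = ζ.whiskerR R := rfl
  rw [h₁, h₂]
  congr 1
  · simp only [t22, t23, t32]
    bicategory
  · simp only [t22]
    bicategory

theorem isRightUnital_iff {R S T : B} (i : I B ⟶ R) {s : S ⊠ R ⟶ S} {t : T ⊠ S ⟶ T}
    {v : T ⊠ R ⟶ T} (s₀ : (𝟙 S ⊠₁ i) ≫ s ⟶ r S) (v₀ : (𝟙 T ⊠₁ i) ≫ v ⟶ r T) (α : Square s t v) :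
    IsRightUnital i s₀ v₀ α ↔
    t22 (aNat₃ T S i).hom (𝟙 T ⊠₁ s ≫ t) ≫ a T S (I B) ◁ t21 (L21 T s₀) t ≫
      t21 (rho T S).hom t =
    (𝟙 (T ⊠ S) ⊠₁ i) ◁ α ≫ t22 (interchange t i).inv v ≫ (t ⊠₁ 𝟙 (I B)) ◁ v₀ ≫
      (rNat t).hom := by
  unfold IsRightUnital
  apply iff_of_eq
  have h₁ : L21 T s₀ = (compL T _ _).inv ≫ (𝟙 (𝟙 T) ⊠₂ s₀) := rfl
  rw [h₁]
  congr 1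
  · simp only [t22, t21]
    bicategory
  · simp only [t22]
    bicategory

theorem middleUnit_eq {R T : B} {i : I B ⟶ R} {s : R ⊠ R ⟶ R} {t v : T ⊠ R ⟶ T}
    (lamb : l R ⟶ (i ⊠₁ 𝟙 R) ≫ s) (α : Square s t v) (rh : (𝟙 T ⊠₁ i) ≫ t ⟶ r T) :
    middleUnit lamb α rh =
      t12 (μ T R).inv t ≫ a T (I B) R ◁ t12 (L12 T lamb) t ≫
        t22 (aNat₂ T i R).inv (𝟙 T ⊠₁ s ≫ t) ≫ ((𝟙 T ⊠₁ i) ⊠₁ 𝟙 R) ◁ α ≫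
        t21 (R21 R rh) v := by
  have h₁ : L12 T lamb = (𝟙 (𝟙 T) ⊠₂ lamb) ≫ (compL T _ _).hom := rfl
  have h₂ : R21 R rh = (compR _ _ R).inv ≫ (rh ⊠₂ 𝟙 (𝟙 R)) := rfl
  rw [middleUnit, h₁, h₂]
  simp only [t12, t22, t21]
  bicategory

/-- `r⁻¹1 ≫ r1 ≅ 1` -/
def rCounitWhisker (T R : B) : (rInv T ⊠₁ 𝟙 R) ≫ (r T ⊠₁ 𝟙 R) ≅ 𝟙 (T ⊠ R) :=
  (compR (rInv T) (r T) R).symm ≪≫ tensorIso (rCounit T) (Iso.refl _) ≪≫ tensorId T R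

theorem r_whisker_injective {T R X : B} {f g : T ⊠ R ⟶ X} {φ ψ : f ⟶ g}
    (h : (r T ⊠₁ 𝟙 R) ◁ φ = (r T ⊠₁ 𝟙 R) ◁ ψ) : φ = ψ :=
  whiskerLeft_injective_of_equiv (rCounitWhisker T R) h

theorem r_whisker_whisker_injective {T S R X : B} {f g : (T ⊠ S) ⊠ R ⟶ X} {φ ψ : f ⟶ g}
    (h : ((r T ⊠₁ 𝟙 S) ⊠₁ 𝟙 R) ◁ φ = ((r T ⊠₁ 𝟙 S) ⊠₁ 𝟙 R) ◁ ψ) : φ = ψ :=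
  whiskerLeft_injective_of_equiv
    ((compR _ _ R).symm ≪≫ tensorIso (rCounitWhisker T S) (Iso.refl _) ≪≫ tensorId _ R) h

/-- `1 ≅ r ≫ r⁻¹` -/
def rUnit (X : B) : 𝟙 (X ⊠ I B) ≅ r X ≫ rInv X where
  hom := (TensorStruct.rightUnitor (B := B)).unit.hom.as.app X
  inv := (TensorStruct.rightUnitor (B := B)).unit.inv.as.app X
  hom_inv_id :=
    congrArg (fun m => m.as.app X) (TensorStruct.rightUnitor (B := B)).unit.hom_inv_id
  inv_hom_id :=
    congrArg (fun m => m.as.app X) (TensorStruct.rightUnitor (B := B)).unit.inv_hom_id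

/-- Shows that `cancelUnit` really inverts whiskering with `r1`, so `midCell` can be computed from
its defining pasting. -/
theorem whiskerLeft_cancelUnit {R T X : B} {f g : T ⊠ R ⟶ X}
    (φ : (r T ⊠₁ 𝟙 R) ≫ f ⟶ (r T ⊠₁ 𝟙 R) ≫ g) : (r T ⊠₁ 𝟙 R) ◁ cancelUnit φ = φ := by
  have e : (r T ⊠₁ 𝟙 R) ≫ (rInv T ⊠₁ 𝟙 R) ≅ 𝟙 ((T ⊠ I B) ⊠ R) :=
    (compR _ _ R).symm ≪≫ tensorIso (rUnit T).symm (Iso.refl _) ≪≫ tensorId _ R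
  apply whiskerLeft_injective_of_equiv e
  have key : ∀ χ : (r T ⊠₁ 𝟙 R) ≫ f ⟶ (r T ⊠₁ 𝟙 R) ≫ g,
      cancelUnit χ = (λ_ f).inv ≫ (rCounitWhisker T R).inv ▷ f ≫ (α_ _ _ _).hom ≫
        (rInv T ⊠₁ 𝟙 R) ◁ χ ≫ (α_ _ _ _).inv ≫ (rCounitWhisker T R).hom ▷ g ≫ (λ_ g).hom :=
    fun _ => rfl
  -- That `cancelUnit` undoes whiskering is a direct computation. Stripping the isomorphisms from
  -- `h2` leaves an equation whiskered by `rInv T ⊠₁ 𝟙 R`, which `e` cancels; so the chosen unit and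
  -- counit need not be related.
  have h2 : cancelUnit ((r T ⊠₁ 𝟙 R) ◁ cancelUnit φ) = cancelUnit φ := by
    rw [key ((r T ⊠₁ 𝟙 R) ◁ cancelUnit φ)]
    rw [associator_inv_naturality_right_assoc, whisker_exchange_assoc]
    simp
  have h3 := (key _).symm.trans (h2.trans (key φ))
  simpa only [cancel_epi, cancel_mono] using h3

end Forms

end MonBicat

/-! ### The cell `⟨λ, α, ρ⟩` and its passage through a tetrahedron with `ζ` right unital -/

namespace MonBicat

section MiddleUnit

open MonoidalBicategory

variable {B : Type u} [Bicategory.{w, v} B] [MonoidalBicategory B]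

/-- The cell `⟨λ, α, ρ⟩ : t ⟶ v`. -/
def midCell {R T : B} {i : I B ⟶ R} {s : R ⊠ R ⟶ R} {t v : T ⊠ R ⟶ T}
    (lamb : l R ⟶ (i ⊠₁ 𝟙 R) ≫ s) (α : Square s t v) (rh : (𝟙 T ⊠₁ i) ≫ t ⟶ r T) : t ⟶ v :=
  cancelUnit (middleUnit lamb α rh)

theorem whiskerLeft_midCell {R T : B} {i : I B ⟶ R} {s : R ⊠ R ⟶ R} {t v : T ⊠ R ⟶ T}
    (lamb : l R ⟶ (i ⊠₁ 𝟙 R) ≫ s) (α : Square s t v) (rh : (𝟙 T ⊠₁ i) ≫ t ⟶ r T) :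
    (r T ⊠₁ 𝟙 R) ◁ midCell lamb α rh =
      t12 (μ T R).inv t ≫ a T (I B) R ◁ t12 (L12 T lamb) t ≫
        t22 (aNat₂ T i R).inv (𝟙 T ⊠₁ s ≫ t) ≫ ((𝟙 T ⊠₁ i) ⊠₁ 𝟙 R) ◁ α ≫
        t21 (R21 R rh) v := by
  rw [midCell, whiskerLeft_cancelUnit, middleUnit_eq]

theorem tensorLeft_midCell (U : B) {R T V : B} {i : I B ⟶ R} {s : R ⊠ R ⟶ R} {t v : T ⊠ R ⟶ T}
    (lamb : l R ⟶ (i ⊠₁ 𝟙 R) ≫ s) (α : Square s t v) (rh : (𝟙 T ⊠₁ i) ≫ t ⟶ r T)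
    (z : U ⊠ T ⟶ V) :
    (𝟙 U ⊠₁ (r T ⊠₁ 𝟙 R)) ◁ (𝟙 (𝟙 U) ⊠₂ midCell lamb α rh) ▷ z =
      t12 (L12 U (μ T R).inv) (𝟙 U ⊠₁ t ≫ z) ≫
        (𝟙 U ⊠₁ a T (I B) R) ◁ t12 (L12 U (L12 T lamb)) (𝟙 U ⊠₁ t ≫ z) ≫
        t22 (L22 U (aNat₂ T i R).inv) (𝟙 U ⊠₁ (𝟙 T ⊠₁ s) ≫ 𝟙 U ⊠₁ t ≫ z) ≫
        (𝟙 U ⊠₁ ((𝟙 T ⊠₁ i) ⊠₁ 𝟙 R)) ◁ t32 (L32 U α) z ≫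
        t21 (L21 U (R21 R rh)) (𝟙 U ⊠₁ v ≫ z) :=
  pf_middleUnit (leftTensor U) (whiskerLeft_midCell lamb α rh) z

theorem tensorRight_midCell (U : B) {R T V : B} {i : I B ⟶ R} {s : R ⊠ R ⟶ R} {t v : T ⊠ R ⟶ T}
    (lamb : l R ⟶ (i ⊠₁ 𝟙 R) ≫ s) (α : Square s t v) (rh : (𝟙 T ⊠₁ i) ≫ t ⟶ r T)
    (z : T ⊠ U ⟶ V) :
    ((r T ⊠₁ 𝟙 R) ⊠₁ 𝟙 U) ◁ (midCell lamb α rh ⊠₂ 𝟙 (𝟙 U)) ▷ z =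
      t12 (R12 U (μ T R).inv) (t ⊠₁ 𝟙 U ≫ z) ≫
        (a T (I B) R ⊠₁ 𝟙 U) ◁ t12 (R12 U (L12 T lamb)) (t ⊠₁ 𝟙 U ≫ z) ≫
        t22 (R22 U (aNat₂ T i R).inv) ((𝟙 T ⊠₁ s) ⊠₁ 𝟙 U ≫ t ⊠₁ 𝟙 U ≫ z) ≫
        (((𝟙 T ⊠₁ i) ⊠₁ 𝟙 R) ⊠₁ 𝟙 U) ◁ t32 (R32 U α) z ≫
        t21 (R21 U (R21 R rh)) (v ⊠₁ 𝟙 U ≫ z) :=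
  pf_middleUnit (rightTensor U) (whiskerLeft_midCell lamb α rh) z

theorem IsRightUnital.tensorRight {R S T : B} {i : I B ⟶ R} {s : S ⊠ R ⟶ S} {t : T ⊠ S ⟶ T}
    {v : T ⊠ R ⟶ T} {s₀ : (𝟙 S ⊠₁ i) ≫ s ⟶ r S} {v₀ : (𝟙 T ⊠₁ i) ≫ v ⟶ r T} {α : Square s t v}
    (h : IsRightUnital i s₀ v₀ α) (U : B) {V : B} (z : T ⊠ U ⟶ V) :
    t22 (R22 U (aNat₃ T S i).hom) ((𝟙 T ⊠₁ s) ⊠₁ 𝟙 U ≫ t ⊠₁ 𝟙 U ≫ z) ≫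
        (a T S (I B) ⊠₁ 𝟙 U) ◁ t21 (R21 U (L21 T s₀)) (t ⊠₁ 𝟙 U ≫ z) ≫
        t21 (R21 U (rho T S).hom) (t ⊠₁ 𝟙 U ≫ z) =
      ((𝟙 (T ⊠ S) ⊠₁ i) ⊠₁ 𝟙 U) ◁ t32 (R32 U α) z ≫
        t22 (R22 U (interchange t i).inv) (v ⊠₁ 𝟙 U ≫ z) ≫
        ((t ⊠₁ 𝟙 (I B)) ⊠₁ 𝟙 U) ◁ t21 (R21 U v₀) z ≫ t22 (R22 U (rNat t).hom) z :=
  pf_rightUnital (rightTensor U) ((isRightUnital_iff i s₀ v₀ α).1 h) z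

/-- In a tetrahedron whose edge `ζ` is right unital, `⟨λ, -, ρ⟩` may be moved from `α` to `β`. -/
theorem IsTetrahedron.midCell_comm {R T U : B} {i : I B ⟶ R} {s : R ⊠ R ⟶ R} {t : T ⊠ R ⟶ T}
    {u : U ⊠ T ⟶ U} {v : T ⊠ R ⟶ T} {x : U ⊠ R ⟶ U} {w : U ⊠ R ⟶ U}
    {α : Square s t v} {β : Square s x w} {γ : Square v u w} {ζ : Square t u x}
    (h : IsTetrahedron α β γ ζ) (lamb : l R ⟶ (i ⊠₁ 𝟙 R) ≫ s)
    {ρt : (𝟙 T ⊠₁ i) ≫ t ⟶ r T} {ρx : (𝟙 U ⊠₁ i) ≫ x ⟶ r U} (hζ : IsRightUnital i ρt ρx ζ) :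
    a U T R ◁ (𝟙 (𝟙 U) ⊠₂ midCell lamb α ρt) ▷ u ≫ γ = ζ ≫ (u ⊠₁ 𝟙 R) ◁ midCell lamb β ρx := by
  -- The comparison is made over `r1` for the object `U ⊠ T`, where the unit object has room to be
  -- inserted.
  apply r_whisker_injective
  have h' := (isTetrahedron_iff α β γ ζ).1 h
  have hζ' := hζ.tensorRight R w
  -- By `rho` the unit attached to `U ⊠ T` may be attached to `T` inside `U ⊠ -`, where the image of
  -- the defining pasting of `midCell` is available.
  have e₁ : (r (U ⊠ T) ⊠₁ 𝟙 R) ◁ a U T R ◁ (𝟙 (𝟙 U) ⊠₂ midCell lamb α ρt) ▷ u =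
      t12 (R12 R (rho U T).inv) (a U T R ≫ 𝟙 U ⊠₁ t ≫ u) ≫
        (a U T (I B) ⊠₁ 𝟙 R) ◁ t22 (aNat₂ U (r T) R).hom (𝟙 U ⊠₁ t ≫ u) ≫
        (a U T (I B) ⊠₁ 𝟙 R) ◁ a U (T ⊠ I B) R ◁
          ((𝟙 U ⊠₁ (r T ⊠₁ 𝟙 R)) ◁ (𝟙 (𝟙 U) ⊠₂ midCell lamb α ρt) ▷ u) ≫
        (a U T (I B) ⊠₁ 𝟙 R) ◁ t22 (aNat₂ U (r T) R).inv (𝟙 U ⊠₁ v ≫ u) ≫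
        t21 (R21 R (rho U T).hom) (a U T R ≫ 𝟙 U ⊠₁ v ≫ u) := by
    have h1 := congrArg ((a U T (I B) ⊠₁ 𝟙 R) ◁ ·)
      (t22_exchange ((𝟙 (𝟙 U) ⊠₂ midCell lamb α ρt) ▷ u) (aNat₂ U (r T) R).hom)
    have h2 := congrArg ((a U T (I B) ⊠₁ 𝟙 R) ◁ ·)
      (t22_hom_inv (aNat₂ U (r T) R) (𝟙 U ⊠₁ v ≫ u))
    simp only [whiskerLeft_comp, whiskerLeft_id] at h1 h2
    rw [reassoc_of% h1, reassoc_of% h2]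
    rw [reassoc_of% (t12_exchange (a U T R ◁ (𝟙 (𝟙 U) ⊠₂ midCell lamb α ρt) ▷ u)
      (R12 R (rho U T).inv)), t12_R12_inv_hom, Category.comp_id]
  have e₂ : (r (U ⊠ T) ⊠₁ 𝟙 R) ◁ (u ⊠₁ 𝟙 R) ◁ midCell lamb β ρx =
      t22 (R22 R (rNat u).inv) x ≫
        ((u ⊠₁ 𝟙 (I B)) ⊠₁ 𝟙 R) ◁ ((r U ⊠₁ 𝟙 R) ◁ midCell lamb β ρx) ≫
        t22 (R22 R (rNat u).hom) w := by
    rw [reassoc_of% (t22_exchange (midCell lamb β ρx) (R22 R (rNat u).inv)), t22_R22_inv_hom,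
      Category.comp_id]
  rw [whiskerLeft_comp, whiskerLeft_comp, e₁, e₂, tensorLeft_midCell, whiskerLeft_midCell]
  simp only [whiskerLeft_comp, Category.assoc]
  -- Right normalisation trades the `μ` of `T` for that of `U ⊠ T`, at the cost of a `π`. Then `λ`
  -- and `i` are moved outwards through the associators until `1α` appears as in the tetrahedron
  -- condition.
  rw [reassoc_of% right_normalisation_inv U T R (𝟙 U ⊠₁ t ≫ u),
    reassoc_of% t23_exchange (t12 (L12 U (L12 T lamb)) (𝟙 U ⊠₁ t ≫ u)) (π U T (I B) R).inv]
  have h₃ := congrArg (a (U ⊠ T) (I B) R ◁ ·) (aNat₃_nat U T lamb (𝟙 U ⊠₁ t ≫ u))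
  simp only [whiskerLeft_comp] at h₃
  rw [reassoc_of% h₃, reassoc_of% π_inv_third U T i R (𝟙 U ⊠₁ (𝟙 T ⊠₁ s) ≫ 𝟙 U ⊠₁ t ≫ u),
    ← reassoc_of% t22_exchange (t22 (aNat₃ U T s).hom (𝟙 U ⊠₁ t ≫ u)) (aNat₂ (U ⊠ T) i R).inv]
  have h₆ := congrArg ((a U T (I B) ⊠₁ 𝟙 R) ◁ ·)
    (t22_exchange (t32 (L32 U α) u) (aNat₂ U (𝟙 T ⊠₁ i) R).hom)
  simp only [whiskerLeft_comp] at h₆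
  rw [reassoc_of% h₆, reassoc_of% t22_exchange (a U (T ⊠ R) R ◁ t32 (L32 U α) u)
    (R22 R (aNat₃ U T i).hom)]
  have h₈ := congrArg ((a U T (I B) ⊠₁ 𝟙 R) ◁ ·) (aNat₂_nat_merge U ρt R (𝟙 U ⊠₁ v ≫ u))
  simp only [whiskerLeft_comp] at h₈
  rw [reassoc_of% h₈, reassoc_of% t22_exchange (t22 (aNat₂ U t R).inv (𝟙 U ⊠₁ v ≫ u))
    (R22 R (aNat₃ U T i).hom), t21_exchange γ (R21 R (rho U T).hom)]
  have h₁₀ := congrArg ((a U T (I B) ⊠₁ 𝟙 R) ◁ ·) (t21_exchange γ (R21 R (L21 U ρt)))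
  simp only [whiskerLeft_comp] at h₁₀
  -- With `γ` moved in front, `ρt` and `rho` stand last. Right unitality of `ζ` converts them into
  -- `ζ1` followed by `ρx`, and this `ζ1` completes the side `1α, γ, ζ1` of the tetrahedron.
  rw [reassoc_of% h₁₀, reassoc_of% t22_exchange (((𝟙 U ⊠₁ t) ⊠₁ 𝟙 R) ◁ γ)
    (R22 R (aNat₃ U T i).hom), hζ']
  have h₁₂ := congrArg (((𝟙 (U ⊠ T) ⊠₁ i) ⊠₁ 𝟙 R) ◁ ·) h'
  simp only [whiskerLeft_comp] at h₁₂
  rw [reassoc_of% h₁₂, reassoc_of% t22_exchange ((𝟙 (U ⊠ T) ⊠₁ s) ◁ ζ) (aNat₂ (U ⊠ T) i R).inv]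
  have h₁₃ := congrArg (a (U ⊠ T) (I B) R ◁ ·) (t12_exchange ζ (L12 (U ⊠ T) lamb))
  simp only [whiskerLeft_comp] at h₁₃
  rw [reassoc_of% h₁₃, reassoc_of% t12_exchange ζ (μ (U ⊠ T) R).inv]
  -- Both sides now begin with `ζ`. What remains compares inserting the unit before and after `u`, a
  -- matter of naturality.
  congr 1
  rw [reassoc_of% μ_inv_first u R x,
    reassoc_of% t22_exchange (t12 (L12 U lamb) x) (aNat₁ u (I B) R).inv]
  have h₁₅ := congrArg (a (U ⊠ T) (I B) R ◁ ·) (interchange_inv_second _ u lamb x)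
  simp only [whiskerLeft_comp] at h₁₅
  rw [reassoc_of% h₁₅, reassoc_of% aNat₁_aNat₂ u i R (𝟙 U ⊠₁ s ≫ x),
    ← reassoc_of% t22_exchange (t22 (interchange u s).inv x) (aNat₂ (U ⊠ T) i R).inv,
    reassoc_of% t22_exchange β (R22 R (interchange u i).inv)]

end MiddleUnit
end MonBicat

/-! ### Left unital squares in a tetrahedron -/

namespace MonBicat

section LeftUnital

open MonoidalBicategory

variable {B : Type u} [Bicategory.{w, v} B] [MonoidalBicategory B]

/-- The left unit condition for a square `α : (s, t) ⟹ s` with respect to `λ : 1 ⟹ t ∘ i1`. -/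
def IsLeftUnital {R S : B} (i : I B ⟶ S) {s : S ⊠ R ⟶ S} {t : S ⊠ S ⟶ S}
    (lamb : l S ⟶ (i ⊠₁ 𝟙 S) ≫ t) (α : Square s t s) : Prop :=
  a (I B) S R ◁ (lNat s).hom ≫ t21 (lam S R).hom s ≫ t12 (R12 R lamb) s =
    a (I B) S R ◁ (𝟙 (I B) ⊠₁ s) ◁ lamb ≫ a (I B) S R ◁ t22 (interchange i s).inv t ≫
      t22 (aNat₁ i S R).inv (𝟙 S ⊠₁ s ≫ t) ≫ ((i ⊠₁ 𝟙 S) ⊠₁ 𝟙 R) ◁ α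

theorem IsLeftUnital.tensorLeft {R S : B} {i : I B ⟶ S} {s : S ⊠ R ⟶ S} {t : S ⊠ S ⟶ S}
    {lamb : l S ⟶ (i ⊠₁ 𝟙 S) ≫ t} {α : Square s t s} (h : IsLeftUnital i lamb α) (U : B) {V : B}
    (z : U ⊠ S ⟶ V) :
    (𝟙 U ⊠₁ a (I B) S R) ◁ t22 (L22 U (lNat s).hom) z ≫
        t21 (L21 U (lam S R).hom) (𝟙 U ⊠₁ s ≫ z) ≫ t12 (L12 U (R12 R lamb)) (𝟙 U ⊠₁ s ≫ z) =
      (𝟙 U ⊠₁ a (I B) S R) ◁ (𝟙 U ⊠₁ (𝟙 (I B) ⊠₁ s)) ◁ t12 (L12 U lamb) z ≫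
        (𝟙 U ⊠₁ a (I B) S R) ◁ t22 (L22 U (interchange i s).inv) (𝟙 U ⊠₁ t ≫ z) ≫
        t22 (L22 U (aNat₁ i S R).inv) (𝟙 U ⊠₁ (𝟙 S ⊠₁ s) ≫ 𝟙 U ⊠₁ t ≫ z) ≫
        (𝟙 U ⊠₁ ((i ⊠₁ 𝟙 S) ⊠₁ 𝟙 R)) ◁ t32 (L32 U α) z :=
  pf_leftUnital (leftTensor U) h z

/-- In a tetrahedron whose edge `α` is left unital, `⟨λ, ζ, ρ⟩` intertwines `γ` and `β`. -/
theorem IsTetrahedron.comp_midCell {R S U : B} {i : I B ⟶ S} {s : S ⊠ R ⟶ S} {t : S ⊠ S ⟶ S}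
    {u : U ⊠ S ⟶ U} {x : U ⊠ S ⟶ U} {w : U ⊠ R ⟶ U}
    {α : Square s t s} {β : Square s x w} {γ : Square s u w} {ζ : Square t u x}
    (h : IsTetrahedron α β γ ζ) {lamb : l S ⟶ (i ⊠₁ 𝟙 S) ≫ t} (hα : IsLeftUnital i lamb α)
    (ρ : (𝟙 U ⊠₁ i) ≫ u ⟶ r U) :
    γ ≫ (midCell lamb ζ ρ ⊠₂ 𝟙 (𝟙 R)) ▷ w = a U S R ◁ (𝟙 U ⊠₁ s) ◁ midCell lamb ζ ρ ≫ β := by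
  apply r_whisker_whisker_injective
  -- Interchanging `r U` with `s` brings the whiskering next to `midCell`, whose defining pasting
  -- can then be substituted.
  have e₁ : ((r U ⊠₁ 𝟙 S) ⊠₁ 𝟙 R) ◁ a U S R ◁ (𝟙 U ⊠₁ s) ◁ midCell lamb ζ ρ =
      t22 (aNat₁ (r U) S R).hom (𝟙 U ⊠₁ s ≫ u) ≫
        a (U ⊠ I B) S R ◁ t22 (interchange (r U) s).hom u ≫
        a (U ⊠ I B) S R ◁ (𝟙 (U ⊠ I B) ⊠₁ s) ◁ ((r U ⊠₁ 𝟙 S) ◁ midCell lamb ζ ρ) ≫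
        a (U ⊠ I B) S R ◁ t22 (interchange (r U) s).inv x ≫
        t22 (aNat₁ (r U) S R).inv (𝟙 U ⊠₁ s ≫ x) := by
    have h₁ := congrArg (a (U ⊠ I B) S R ◁ ·)
      (t22_exchange (midCell lamb ζ ρ) (interchange (r U) s).hom)
    have h₂ := congrArg (a (U ⊠ I B) S R ◁ ·) (t22_hom_inv (interchange (r U) s) x)
    simp only [whiskerLeft_comp, whiskerLeft_id] at h₁ h₂
    rw [reassoc_of% h₁, reassoc_of% h₂, reassoc_of% t22_exchange
      ((𝟙 U ⊠₁ s) ◁ midCell lamb ζ ρ) (aNat₁ (r U) S R).hom, t22_hom_inv, Category.comp_id]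
  rw [whiskerLeft_comp, whiskerLeft_comp, e₁, tensorRight_midCell, whiskerLeft_midCell]
  simp only [whiskerLeft_comp, Category.assoc]
  have h₁ := congrArg (a (U ⊠ I B) S R ◁ ·) (interchange_inv_first ρ s x)
  simp only [whiskerLeft_comp] at h₁
  rw [reassoc_of% h₁, reassoc_of% aNat₁_inv_nat ρ S R (𝟙 U ⊠₁ s ≫ x),
    t21_exchange β (R21 R (R21 S ρ)),
    ← reassoc_of% t22_exchange (t22 (interchange u s).inv x) (aNat₁ (𝟙 U ⊠₁ i) S R).inv]
  have h₂ := congrArg (a (U ⊠ I B) S R ◁ ·) (t22_exchange ζ (interchange (𝟙 U ⊠₁ i) s).inv)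
  simp only [whiskerLeft_comp] at h₂
  rw [← reassoc_of% h₂,
    ← reassoc_of% t22_exchange ((𝟙 (U ⊠ S) ⊠₁ s) ◁ ζ) (aNat₁ (𝟙 U ⊠₁ i) S R).inv]
  -- The tetrahedron is used from right to left: the side `ζ, β` is replaced by `1α, γ, ζ1`.
  have h₃ := congrArg ((((𝟙 U ⊠₁ i) ⊠₁ 𝟙 S) ⊠₁ 𝟙 R) ◁ ·) ((isTetrahedron_iff α β γ ζ).1 h)
  simp only [whiskerLeft_comp] at h₃
  rw [← reassoc_of% h₃, reassoc_of% t22_exchange (t22 (aNat₃ U S s).hom (𝟙 U ⊠₁ t ≫ u))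
    (aNat₁ (𝟙 U ⊠₁ i) S R).inv]
  have h₄ := congrArg (a (U ⊠ I B) S R ◁ ·) (aNat₂_aNat₃ U i s (𝟙 U ⊠₁ t ≫ u))
  simp only [whiskerLeft_comp] at h₄
  rw [reassoc_of% h₄, reassoc_of% π_inv_second U i S R (𝟙 U ⊠₁ (𝟙 S ⊠₁ s) ≫ 𝟙 U ⊠₁ t ≫ u),
    ← reassoc_of% t23_exchange (t22 (L22 U (interchange i s).inv) (𝟙 U ⊠₁ t ≫ u))
      (π U (I B) S R).inv]
  have h₅ := congrArg (a (U ⊠ I B) S R ◁ ·)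
    (t22_exchange (t12 (L12 U lamb) u) (aNat₃ U (I B) s).hom)
  simp only [whiskerLeft_comp] at h₅
  rw [← reassoc_of% h₅,
    ← reassoc_of% t23_exchange ((𝟙 U ⊠₁ (𝟙 (I B) ⊠₁ s)) ◁ t12 (L12 U lamb) u) (π U (I B) S R).inv,
    reassoc_of% t22_exchange (a U (S ⊠ S) R ◁ t32 (L32 U α) u) (R22 R (aNat₂ U i S).inv)]
  have h₆ := congrArg ((a U (I B) S ⊠₁ 𝟙 R) ◁ ·)
    (t22_exchange (t32 (L32 U α) u) (aNat₂ U (i ⊠₁ 𝟙 S) R).inv)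
  simp only [whiskerLeft_comp] at h₆
  rw [reassoc_of% h₆]
  -- Left unitality removes `α`: `λ` followed by `1α` becomes `λ1` with unit constraints, which left
  -- normalisation then absorbs.
  have h₇ := congrArg ((a U (I B) S ⊠₁ 𝟙 R) ◁ a U (I B ⊠ S) R ◁ ·) (hα.tensorLeft U u)
  simp only [whiskerLeft_comp] at h₇
  rw [← reassoc_of% h₇,
    reassoc_of% t23_exchange (t22 (L22 U (lNat s).hom) u) (π U (I B) S R).inv]
  have h₈ := congrArg (a (U ⊠ I B) S R ◁ ·) (μ_inv_second U s u)
  simp only [whiskerLeft_comp] at h₈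
  rw [reassoc_of% h₈, reassoc_of% left_normalisation_inv U S R (𝟙 U ⊠₁ s ≫ u),
    reassoc_of% t22_exchange (t22 (aNat₂ U t R).inv (𝟙 U ⊠₁ s ≫ u)) (R22 R (aNat₂ U i S).inv)]
  have h₉ := congrArg ((a U (I B) S ⊠₁ 𝟙 R) ◁ ·) (aNat₂_nat_split U lamb R (𝟙 U ⊠₁ s ≫ u))
  simp only [whiskerLeft_comp] at h₉
  rw [reassoc_of% h₉,
    reassoc_of% t22_exchange (((𝟙 U ⊠₁ t) ⊠₁ 𝟙 R) ◁ γ) (R22 R (aNat₂ U i S).inv)]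
  have h₁₀ := congrArg ((a U (I B) S ⊠₁ 𝟙 R) ◁ ·) (t12_exchange γ (R12 R (L12 U lamb)))
  simp only [whiskerLeft_comp] at h₁₀
  rw [reassoc_of% h₁₀, reassoc_of% t12_exchange γ (R12 R (μ U S).inv)]

end LeftUnital

/-! ### Compatibility of the two unitors, up to `unitLoop` -/

section UnitUnit

open MonoidalBicategory

variable {B : Type u} [Bicategory.{w, v} B] [MonoidalBicategory B]

/-- The compatibility of `λ : 1 ⟹ s ∘ i1` and `ρ : s ∘ 1i ⟹ 1` up to an endomorphism `c` of
`r`. -/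
def UnitorsCompatible {R : B} (i : I B ⟶ R) {s : R ⊠ R ⟶ R} (lamb : l R ⟶ (i ⊠₁ 𝟙 R) ≫ s)
    (ρ : (𝟙 R ⊠₁ i) ≫ s ⟶ r R) : Prop :=
  (𝟙 (I B) ⊠₁ i) ◁ lamb ≫ t22 (interchange i i).inv s ≫ (i ⊠₁ 𝟙 (I B)) ◁ ρ =
    (lNat i).hom ≫ (unitIso B).hom ▷ i ≫ (rNat i).inv

/-- The automorphism of `r` comparing `1l` and `1r` by way of the unit constraints and of
`unitIso`. -/
def unitLoop (T : B) : r T ⟶ r T :=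
  cancelUnit (t12 (μ T (I B)).inv (r T) ≫
    a T (I B) (I B) ◁ (𝟙 (𝟙 T) ⊠₂ (unitIso B).hom) ▷ r T ≫ t21 (rho T (I B)).hom (r T) ≫
    (rNat (r T)).inv)

/-- After restriction along `1i`, right unitality of `α` leaves `λ` facing `s₀`; these cancel by
`hs`, and only `τ` and unit constraints survive. The constraints form `unitLoop T`, which depends on
`T` alone and not on `α`, `τ` or `v₀`. -/
theorem whiskerLeft_midCell_comp {R T : B} {i : I B ⟶ R} {s : R ⊠ R ⟶ R} {t v : T ⊠ R ⟶ T}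
    {lamb : l R ⟶ (i ⊠₁ 𝟙 R) ≫ s} {s₀ : (𝟙 R ⊠₁ i) ≫ s ⟶ r R} (hs : UnitorsCompatible i lamb s₀)
    {α : Square s t v} {v₀ : (𝟙 T ⊠₁ i) ≫ v ⟶ r T} (hα : IsRightUnital i s₀ v₀ α)
    (τ : (𝟙 T ⊠₁ i) ≫ t ⟶ r T) :
    (𝟙 T ⊠₁ i) ◁ midCell lamb α τ ≫ v₀ = τ ≫ unitLoop T := by
  apply r_whisker_injective
  have e₁ : (r T ⊠₁ 𝟙 (I B)) ◁ (𝟙 T ⊠₁ i) ◁ midCell lamb α τ =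
      t22 (interchange (r T) i).hom t ≫
        (𝟙 (T ⊠ I B) ⊠₁ i) ◁ ((r T ⊠₁ 𝟙 R) ◁ midCell lamb α τ) ≫
        t22 (interchange (r T) i).inv v := by
    rw [reassoc_of% t22_exchange (midCell lamb α τ) (interchange (r T) i).hom, t22_hom_inv,
      Category.comp_id]
  -- The compatibility of `lamb` and `s₀`, tensored with `T` on the left and given the tail `t`.
  have hL := pf_unitUnit (leftTensor T) hs t
  change (𝟙 T ⊠₁ (𝟙 (I B) ⊠₁ i)) ◁ t12 (L12 T lamb) t ≫
    t22 (L22 T (interchange i i).inv) (𝟙 T ⊠₁ s ≫ t) ≫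
    (𝟙 T ⊠₁ (i ⊠₁ 𝟙 (I B))) ◁ t21 (L21 T s₀) t =
      t22 (L22 T (lNat i).hom) t ≫ (𝟙 (𝟙 T) ⊠₂ (unitIso B).hom) ▷ (𝟙 T ⊠₁ i ≫ t) ≫
        t22 (L22 T (rNat i).inv) t at hL
  have hα' := (isRightUnital_iff i s₀ v₀ α).1 hα
  have hα'' : (𝟙 (T ⊠ R) ⊠₁ i) ◁ α ≫ t22 (interchange t i).inv v ≫ (t ⊠₁ 𝟙 (I B)) ◁ v₀ =
      t22 (aNat₃ T R i).hom (𝟙 T ⊠₁ s ≫ t) ≫ a T R (I B) ◁ t21 (L21 T s₀) t ≫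
      t21 (rho T R).hom t ≫ (rNat t).inv := by
    rw [reassoc_of% hα', Iso.hom_inv_id, Category.comp_id]
  rw [whiskerLeft_comp, whiskerLeft_comp, e₁, whiskerLeft_midCell, unitLoop,
    whiskerLeft_cancelUnit]
  simp only [whiskerLeft_comp, Category.assoc]
  rw [reassoc_of% interchange_inv_first τ i v, t21_exchange v₀ (R21 (I B) τ),
    ← reassoc_of% t22_exchange α (interchange (𝟙 T ⊠₁ i) i).inv]
  have h₁ := congrArg (((𝟙 T ⊠₁ i) ⊠₁ 𝟙 (I B)) ◁ ·) hα''
  simp only [whiskerLeft_comp] at h₁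
  rw [reassoc_of% h₁, reassoc_of% aNat₂_aNat₃ T i i (𝟙 T ⊠₁ s ≫ t),
    reassoc_of% t22_exchange (t21 (L21 T s₀) t) (aNat₂ T i (I B)).inv,
    ← reassoc_of% t22_exchange (t12 (L12 T lamb) t) (aNat₃ T (I B) i).hom]
  have h₂ := congrArg (a T (I B) (I B) ◁ ·) hL
  simp only [whiskerLeft_comp] at h₂
  rw [reassoc_of% h₂, reassoc_of% μ_inv_second T i t, reassoc_of% rho_second T i t,
    rNat_inv_nat τ, ← reassoc_of% t12_exchange τ (μ T (I B)).inv]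
  have h₃ := congrArg (a T (I B) (I B) ◁ ·)
    (whiskerRight_exchange τ (𝟙 (𝟙 T) ⊠₂ (unitIso B).hom))
  simp only [whiskerLeft_comp] at h₃
  rw [← reassoc_of% h₃, ← reassoc_of% t21_exchange τ (rho T (I B)).hom]

end UnitUnit
end MonBicat

/-! ### The right skew monoidale of an adjunction `i ⊣ i*` -/

namespace MonBicat

open MonoidalBicategory

variable {B : Type u} [Bicategory.{w, v} B]

theorem t12_whiskerLeft {X Y Z V : B} {f : X ⟶ Y} {g g' : Y ⟶ Z} {h : X ⟶ Z}
    (η : h ⟶ f ≫ g) (κ : g ⟶ g') (z : Z ⟶ V) :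
    t12 (η ≫ f ◁ κ) z = t12 η z ≫ f ◁ κ ▷ z := by
  simp [t12]

variable [MonoidalBicategory B]

theorem R12_t02 (U : B) {X Y V : B} {f : X ⟶ Y} {g : Y ⟶ X} (η : 𝟙 X ⟶ f ≫ g) (z : X ⟶ V) :
    R12 U (t02 η z) = t02 (R02 U η) (z ⊠₁ 𝟙 U) ≫ (f ⊠₁ 𝟙 U) ◁ (compR g z U).inv := by
  have h : ∀ F : B ⥤ᵖ B, pf12 F (t02 η z) = t02 (pf02 F η) (F.map z) ≫
      F.map f ◁ (F.mapComp g z).inv := by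
    intro F
    have h : F.map₂ (λ_ z).inv ≫ (F.mapComp (𝟙 X) z).hom =
        (λ_ (F.map z)).inv ≫ (F.mapId X).inv ▷ F.map z := by
      rw [F.mapComp_id_left_hom, ← PrelaxFunctor.map₂_comp_assoc]
      simp
    simp [pf12, t02, pf02, reassoc_of% h]
  exact h (rightTensor U)

theorem L12_whiskerLeft (U : B) {X Y Z : B} {f : X ⟶ Y} {g g' : Y ⟶ Z} {h : X ⟶ Z}
    (η : h ⟶ f ≫ g) (κ : g ⟶ g') :
    L12 U (η ≫ f ◁ κ) = L12 U η ≫ (𝟙 U ⊠₁ f) ◁ (𝟙 (𝟙 U) ⊠₂ κ) := by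
  have h : ∀ F : B ⥤ᵖ B, pf12 F (η ≫ f ◁ κ) = pf12 F η ≫ F.map f ◁ F.map₂ κ := by
    intro F
    simp [pf12]
  exact h (leftTensor U)

theorem R12_whiskerLeft (U : B) {X Y Z : B} {f : X ⟶ Y} {g g' : Y ⟶ Z} {h : X ⟶ Z}
    (η : h ⟶ f ≫ g) (κ : g ⟶ g') :
    R12 U (η ≫ f ◁ κ) = R12 U η ≫ (f ⊠₁ 𝟙 U) ◁ (κ ⊠₂ 𝟙 (𝟙 U)) := by
  have h : ∀ F : B ⥤ᵖ B, pf12 F (η ≫ f ◁ κ) = pf12 F η ≫ F.map f ◁ F.map₂ κ := by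
    intro F
    simp [pf12]
  exact h (rightTensor U)

namespace ZeroSimplex

variable (R : ZeroSimplex B)

theorem adjR_unit (X : B) : (R.adjR X).unit = R02 X R.adj.unit := by
  have : (R.adjR X).unit = ((tensorOnRight (TensorStruct.tensor (B := B)) X).mapId (I B)).inv ≫
      (R.adj.unit ⊠₂ 𝟙 (𝟙 X)) ≫
      ((tensorOnRight (TensorStruct.tensor (B := B)) X).mapComp R.i R.iStar).hom := rfl
  rw [this, tensorOnRight_mapId, tensorOnRight_mapComp]
  rfl

/-- The left unitor `λ* = η1`. -/
def lamStar : l R.obj ⟶ (R.i ⊠₁ 𝟙 R.obj) ≫ R.mul R.obj := t02 (R02 R.obj R.adj.unit) (l R.obj)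

theorem skew_leftUnitor : R.skew.leftUnitor = R.lamStar := by
  rw [lamStar, ← adjR_unit]
  rfl

theorem slide_eq {X : B} (t : R.obj ⊠ X ⟶ R.obj) :
    R.slide t = a R.obj R.obj X ◁ t22 (interchange R.iStar t).inv (l R.obj) ≫
      t22 (aNat₁ R.iStar R.obj X).inv (𝟙 (I B) ⊠₁ t ≫ l R.obj) ≫
      ((R.iStar ⊠₁ 𝟙 R.obj) ⊠₁ 𝟙 X) ◁ a (I B) R.obj X ◁ (lNat t).hom ≫
      ((R.iStar ⊠₁ 𝟙 R.obj) ⊠₁ 𝟙 X) ◁ t21 (lam R.obj X).hom t ≫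
      t21 (compR (R.iStar ⊠₁ 𝟙 R.obj) (l R.obj) X).inv t := by
  simp only [slide, t22, t21]
  bicategory

/-- The right unitor `ρ*`. -/
def rhoStar : (𝟙 R.obj ⊠₁ R.i) ≫ R.mul R.obj ⟶ r R.obj :=
    t22 (interchange R.iStar R.i).inv (l R.obj) ≫ (R.iStar ⊠₁ 𝟙 (I B)) ◁ (lNat R.i).hom ≫
      (R.iStar ⊠₁ 𝟙 (I B)) ◁ (unitIso B).hom ▷ R.i ≫ t22 (rNat R.iStar).hom R.i ≫
      r R.obj ◁ R.adj.counit ≫ (ρ_ (r R.obj)).hom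

theorem skew_rightUnitor : R.skew.rightUnitor = R.rhoStar := by
  simp only [skew, rhoStar, t22]
  bicategory

/-- `slide t` is pasted from naturality isomorphisms of `i*1`, and `λ*` from `η`. By naturality `η`
passes through the interchange and the associator, whose parts at `i` and at `i*` cancel, leaving
`η11`. -/
theorem slide_isLeftUnital {X : B} (t : R.obj ⊠ X ⟶ R.obj) :
    IsLeftUnital R.i R.lamStar (R.slide t) := by
  unfold IsLeftUnital lamStar
  rw [slide_eq, R12_t02]
  have h₁ : t12 (t02 (R02 X (R02 R.obj R.adj.unit)) (l R.obj ⊠₁ 𝟙 X) ≫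
      ((R.i ⊠₁ 𝟙 R.obj) ⊠₁ 𝟙 X) ◁ (compR (R.iStar ⊠₁ 𝟙 R.obj) (l R.obj) X).inv) t =
      t02 (R02 X (R02 R.obj R.adj.unit)) (l R.obj ⊠₁ 𝟙 X ≫ t) ≫
      ((R.i ⊠₁ 𝟙 R.obj) ⊠₁ 𝟙 X) ◁ t21 (compR (R.iStar ⊠₁ 𝟙 R.obj) (l R.obj) X).inv t := by
    simp only [t12, t02, t21]
    bicategory
  rw [h₁]
  simp only [whiskerLeft_comp]
  have h₂ := congrArg (a (I B) R.obj X ◁ ·) (interchange_inv_unit R.adj.unit t (l R.obj))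
  simp only [whiskerLeft_comp] at h₂
  rw [reassoc_of% t22_exchange (t22 (interchange R.iStar t).inv (l R.obj))
      (aNat₁ R.i R.obj X).inv, reassoc_of% h₂,
    reassoc_of% aNat₁_inv_unit R.adj.unit R.obj X (𝟙 (I B) ⊠₁ t ≫ l R.obj),
    reassoc_of% t02_exchange (a (I B) R.obj X ◁ (lNat t).hom) (R02 X (R02 R.obj R.adj.unit)),
    reassoc_of% t02_exchange (t21 (lam R.obj X).hom t) (R02 X (R02 R.obj R.adj.unit))]

/-- Once `η` has been moved past the unit constraints it meets `ε`, and the left triangle identity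
`h₂` cancels the two. -/
theorem unitorsCompatible : UnitorsCompatible R.i R.lamStar R.rhoStar := by
  unfold UnitorsCompatible lamStar rhoStar
  simp only [whiskerLeft_comp]
  rw [reassoc_of% interchange_inv_unit R.adj.unit R.i (l R.obj),
    reassoc_of% t02_exchange (lNat R.i).hom (R02 (I B) R.adj.unit),
    reassoc_of% t02_exchange ((unitIso B).hom ▷ R.i) (R02 (I B) R.adj.unit)]
  have h₁ : t02 (R02 (I B) R.adj.unit) (r (I B) ≫ R.i) ≫
      (R.i ⊠₁ 𝟙 (I B)) ◁ t22 (rNat R.iStar).hom R.i =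
      r (I B) ◁ t02 R.adj.unit R.i ≫ t22 (rNat R.i).inv (R.iStar ≫ R.i) := by
    rw [← rNat_unit R.adj.unit R.i]
    simp only [Category.assoc, t22_hom_inv, Category.comp_id]
  have h₂ : t02 R.adj.unit R.i ≫ R.i ◁ R.adj.counit ≫ (ρ_ R.i).hom = 𝟙 _ := by
    have := R.adj.left_triangle
    rw [leftZigzag] at this
    calc
      _ = (λ_ R.i).inv ≫ (R.adj.unit ▷ R.i ⊗≫ R.i ◁ R.adj.counit) ≫ (ρ_ R.i).hom := by
        simp only [t02]
        bicategory
      _ = _ := by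
        rw [this]
        simp
  have h₃ := congrArg (r (I B) ◁ ·) h₂
  simp only [whiskerLeft_comp, whiskerLeft_id] at h₃
  have h₄ : t22 (rNat R.i).inv (𝟙 R.obj) ≫ (R.i ⊠₁ 𝟙 (I B)) ◁ (ρ_ (r R.obj)).hom =
      r (I B) ◁ (ρ_ R.i).hom ≫ (rNat R.i).inv := by
    simp only [t22]
    bicategory
  rw [reassoc_of% h₁, reassoc_of% t22_exchange R.adj.counit (rNat R.i).inv, h₄, reassoc_of% h₃]

end ZeroSimplex

instance isIso_unitLoop (T : B) : IsIso (unitLoop T) := by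
  have : IsIso (𝟙 (𝟙 T) ⊠₂ (unitIso B).hom) :=
    inferInstanceAs (IsIso (tensorIso (Iso.refl _) (unitIso B)).hom)
  unfold unitLoop cancelUnit t12 t21
  dsimp only
  infer_instance

end MonBicat

/-! ### The comparison cell `κ` and the axioms involving `λ` -/

namespace MonBicat

open MonoidalBicategory

namespace ZeroSimplex

variable {B : Type u} [Bicategory.{w, v} B] [MonoidalBicategory B] (R : ZeroSimplex B)

theorem homEquiv_symm_eq {X : R.obj ⊠ R.obj ⟶ R.obj} (κ : R.mul R.obj ⟶ X) :
    (R.adjR R.obj).homEquiv₁.symm κ = R.lamStar ≫ (R.i ⊠₁ 𝟙 R.obj) ◁ κ := by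
  rw [lamStar, ← adjR_unit, Adjunction.homEquiv₁_symm_apply]
  simp [t02]

section Comparison

variable {m : R.obj ⊠ R.obj ⟶ R.obj} (r₀ : (𝟙 R.obj ⊠₁ R.i) ≫ m ⟶ r R.obj)
  (μ₀ : Square (R.mul R.obj) (R.mul R.obj) m)

/-- The cell `κ = ⟨λ*, μ₀, ρ*⟩`. -/
def comparison : R.mul R.obj ⟶ m := midCell R.lamStar μ₀ R.rhoStar

/-- The mate of `κ` under `i1 ⊣ i*1`. -/
def comparisonUnit : l R.obj ⟶ (R.i ⊠₁ 𝟙 R.obj) ≫ m :=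
  R.lamStar ≫ (R.i ⊠₁ 𝟙 R.obj) ◁ R.comparison μ₀

variable {r₀ μ₀} {r₂ : Square (R.mul R.obj) m m} {μ₂ : Square m m m}

theorem midCell_action (h : middleUnit R.lamStar r₂ r₀ = 𝟙 _) :
    midCell R.lamStar r₂ r₀ = 𝟙 _ := by
  apply r_whisker_injective
  rw [whiskerLeft_midCell, ← middleUnit_eq, h, whiskerLeft_id]

/-- `μ₂ ∘ 1κ = r²` -/
theorem comparison_comp (h_tri : middleUnit R.lamStar r₂ r₀ = 𝟙 _)
    (h_unital : IsRightUnital R.i R.rhoStar r₀ r₂) (h : IsTetrahedron μ₀ r₂ μ₂ r₂) :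
    a R.obj R.obj R.obj ◁ (𝟙 (𝟙 R.obj) ⊠₂ R.comparison μ₀) ▷ m ≫ μ₂ = r₂ := by
  -- On the right stands `⟨λ*, r², r⁰⟩`, an identity by the triangle axiom of the action.
  have := h.midCell_comm R.lamStar h_unital
  rw [R.midCell_action h_tri, whiskerLeft_id, Category.comp_id] at this
  exact this

/-- `IsTetrahedron.comp_midCell` with `α = γ = c_r`, `β = μ₂` and `ζ = μ₀`: `κ` exchanges the
canonical square `c_r` for `μ₂`. -/
theorem slide_comp_comparison (h : IsTetrahedron (R.slide m) μ₂ (R.slide m) μ₀) :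
    R.slide m ≫ (R.comparison μ₀ ⊠₂ 𝟙 (𝟙 R.obj)) ▷ m =
      a R.obj R.obj R.obj ◁ (𝟙 R.obj ⊠₁ m) ◁ R.comparison μ₀ ≫ μ₂ :=
  h.comp_midCell (R.slide_isLeftUnital m) R.rhoStar

/-- The factor `κ` of `λ` slides up to `μ₂`, where `comparison_comp` fuses the two into `r²`; the
action triangle concludes. -/
theorem middleUnit_comparisonUnit (h_tri : middleUnit R.lamStar r₂ r₀ = 𝟙 _)
    (h_unital : IsRightUnital R.i R.rhoStar r₀ r₂) (h : IsTetrahedron μ₀ r₂ μ₂ r₂) :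
    middleUnit (R.comparisonUnit μ₀) μ₂ r₀ = 𝟙 _ := by
  rw [← h_tri, middleUnit_eq, middleUnit_eq, comparisonUnit, L12_whiskerLeft,
    t12_whiskerLeft, ← R.comparison_comp h_tri h_unital h]
  simp only [whiskerLeft_comp, Category.assoc]
  rw [reassoc_of% t22_exchange ((𝟙 (𝟙 R.obj) ⊠₂ R.comparison μ₀) ▷ m)
    (aNat₂ R.obj R.i R.obj).inv]

/-- Start from left unitality of `c_r` for `λ*` and append `κ1`. By `slide_comp_comparison` it
passes through `c_r`, turning it into `μ₂`, and the resulting `κ` slides back to join `λ*`. -/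
theorem comparisonUnit_isLeftUnital (h : IsTetrahedron (R.slide m) μ₂ (R.slide m) μ₀) :
    IsLeftUnital R.i (R.comparisonUnit μ₀) μ₂ := by
  have h₀ := R.slide_isLeftUnital m
  unfold IsLeftUnital at h₀ ⊢
  rw [comparisonUnit, R12_whiskerLeft, t12_whiskerLeft, reassoc_of% h₀,
    ← whiskerLeft_comp ((R.i ⊠₁ 𝟙 R.obj) ⊠₁ 𝟙 R.obj), R.slide_comp_comparison h]
  have h₁ := congrArg (a (I B) R.obj R.obj ◁ ·)
    (t22_exchange (R.comparison μ₀) (interchange R.i m).inv)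
  simp only [whiskerLeft_comp, Category.assoc] at h₁ ⊢
  rw [reassoc_of% t22_exchange ((𝟙 R.obj ⊠₁ m) ◁ R.comparison μ₀)
    (aNat₁ R.i R.obj R.obj).inv, reassoc_of% h₁]

/-- `whiskerLeft_midCell_comp` is used twice. For `μ₀` it turns `κ` followed by `r⁰` into `ρ*`
followed by `unitLoop`, which reduces the claim to the compatibility of `λ*` and `ρ*`. For `r²`,
where `midCell` is an identity, it says that `r⁰` absorbs `unitLoop`. -/
theorem comparisonUnit_unitorsCompatible (h_tri : middleUnit R.lamStar r₂ r₀ = 𝟙 _)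
    (h_unital : IsRightUnital R.i R.rhoStar r₀ r₂) (h : IsRightUnital R.i R.rhoStar r₀ μ₀) :
    UnitorsCompatible R.i (R.comparisonUnit μ₀) r₀ := by
  have h₁ := whiskerLeft_midCell_comp R.unitorsCompatible h_unital r₀
  have h₂ : (𝟙 R.obj ⊠₁ R.i) ◁ R.comparison μ₀ ≫ r₀ = R.rhoStar ≫ unitLoop R.obj :=
    whiskerLeft_midCell_comp R.unitorsCompatible h R.rhoStar
  rw [R.midCell_action h_tri, whiskerLeft_id, Category.id_comp] at h₁
  have h₀ := R.unitorsCompatible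
  unfold UnitorsCompatible at h₀ ⊢
  have h₃ : (𝟙 (I B) ⊠₁ R.i) ◁ R.comparisonUnit μ₀ ≫
      t22 (interchange R.i R.i).inv m ≫ (R.i ⊠₁ 𝟙 (I B)) ◁ r₀ =
      ((lNat R.i).hom ≫ (unitIso B).hom ▷ R.i ≫ (rNat R.i).inv) ≫
        (R.i ⊠₁ 𝟙 (I B)) ◁ unitLoop R.obj := by
    rw [← h₀, comparisonUnit, whiskerLeft_comp]
    simp only [Category.assoc]
    rw [← reassoc_of% t22_exchange (R.comparison μ₀) (interchange R.i R.i).inv, ← whiskerLeft_comp,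
      h₂, whiskerLeft_comp]
  -- Substituting `h₁` into `h₃` makes the whiskered `unitLoop` idempotent; an invertible idempotent
  -- is an identity.
  have h₄ : (R.i ⊠₁ 𝟙 (I B)) ◁ unitLoop R.obj = 𝟙 _ := by
    have h₅ := h₃
    rw [h₁, whiskerLeft_comp, reassoc_of% h₃, Category.assoc, Category.assoc] at h₅
    simp only [cancel_epi] at h₅
    rwa [cancel_epi_id] at h₅
  rw [h₃, h₄, Category.comp_id]

end Comparison

end ZeroSimplex

section Skew

variable {B : Type u} [Bicategory.{w, v} B] [MonoidalBicategory B]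

/-- Returns from the right-bracketed form to the pasting in which the skew monoidale axiom is
expressed; likewise for the next lemma. -/
theorem IsLeftUnital.pasting {R S : B} {i : I B ⟶ S} {s : S ⊠ R ⟶ S} {t : S ⊠ S ⟶ S}
    {lamb : l S ⟶ (i ⊠₁ 𝟙 S) ≫ t} {α : Square s t s} (h : IsLeftUnital i lamb α) :
    (𝟙 _ ⊗≫
      a (I B) S R ◁ (lNat s).hom ⊗≫
      (lam S R).hom ▷ s ⊗≫
      ((lamb ⊠₂ 𝟙 (𝟙 R)) ≫ (compR _ _ R).hom) ▷ s ⊗≫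
      𝟙 _ :
        a (I B) S R ≫ (𝟙 (I B) ⊠₁ s) ≫ l S ⟶
        ((i ⊠₁ 𝟙 S) ⊠₁ 𝟙 R) ≫ (t ⊠₁ 𝟙 R) ≫ s) =
    (𝟙 _ ⊗≫
      (a (I B) S R ≫ (𝟙 (I B) ⊠₁ s)) ◁ lamb ⊗≫
      a (I B) S R ◁ (interchange i s).inv ▷ t ⊗≫
      (aNat₁ i S R).inv ▷ ((𝟙 S ⊠₁ s) ≫ t) ⊗≫
      ((i ⊠₁ 𝟙 S) ⊠₁ 𝟙 R) ◁ α) := by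
  refine Eq.trans ?_ (Eq.trans h ?_)
  · have e : R12 R lamb = (lamb ⊠₂ 𝟙 (𝟙 R)) ≫ (compR _ _ R).hom := rfl
    rw [e]
    simp only [t12, t21]
    bicategory
  · simp only [t22]
    bicategory

theorem UnitorsCompatible.pasting {R : B} {i : I B ⟶ R} {s : R ⊠ R ⟶ R}
    {lamb : l R ⟶ (i ⊠₁ 𝟙 R) ≫ s} {ρ : (𝟙 R ⊠₁ i) ≫ s ⟶ r R}
    (h : UnitorsCompatible i lamb ρ) :
    (𝟙 _ ⊗≫
      (𝟙 (I B) ⊠₁ i) ◁ lamb ⊗≫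
      (interchange i i).inv ▷ s ⊗≫
      (i ⊠₁ 𝟙 (I B)) ◁ ρ :
        (𝟙 (I B) ⊠₁ i) ≫ l R ⟶ (i ⊠₁ 𝟙 (I B)) ≫ r R) =
    (lNat i).hom ≫ (unitIso B).hom ▷ i ≫ (rNat i).inv := by
  refine Eq.trans ?_ h
  simp only [t22]
  bicategory

end Skew

namespace MonadOfOplaxActions

variable {B : Type u} [Bicategory.{w, v} B] [MonoidalBicategory B] (M : MonadOfOplaxActions B)

theorem κ_eq : M.κ = M.base.comparison M.μ₀ := by
  have h : M.base.comparison M.μ₀ = midCell M.base.lamStar M.μ₀ M.base.rhoStar := rfl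
  rw [h, ← M.base.skew_leftUnitor, ← M.base.skew_rightUnitor]
  rfl

theorem leftUnitor_eq : M.leftUnitor = M.base.comparisonUnit M.μ₀ := by
  exact (congrArg (M.base.adjR M.base.obj).homEquiv₁.symm M.κ_eq).trans
    (M.base.homEquiv_symm_eq (M.base.comparison M.μ₀))

end MonadOfOplaxActions

end MonBicat

theorem mainTheorem11 {B : Type u} [CategoryTheory.Bicategory.{w, v} B]
    [MonBicat.MonoidalBicategory B] (M : MonBicat.MonadOfOplaxActions B) :
    MonBicat.IsRightSkewMonoidale
      { obj := M.base.obj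
        mul := M.act.act
        unit := M.base.i
        assoc := M.μ₂
        leftUnitor := M.leftUnitor
        rightUnitor := M.act.unitor } := by
  have h_tri := M.isOplaxAction.triangle
  have h_unital := M.isOplaxAction.assoc_unitor
  have h₀ := M.isTwoSimplex₀.unital
  rw [M.base.skew_leftUnitor] at h_tri
  rw [M.base.skew_rightUnitor] at h_unital
  -- The unitor of the degenerate action is by definition the right unitor of the induced skew
  -- monoidale.
  change MonBicat.IsRightUnital M.base.i M.base.skew.rightUnitor M.act.unitor M.μ₀ at h₀
  rw [M.base.skew_rightUnitor] at h₀
  rw [M.leftUnitor_eq]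
  exact
    { pentagon := M.assoc
      triangle := M.base.middleUnit_comparisonUnit h_tri h_unital M.right_unit
      assoc_leftUnitor := (M.base.comparisonUnit_isLeftUnital M.left_unit).pasting
      assoc_rightUnitor := M.isTwoSimplex₂.unital
      leftUnitor_rightUnitor :=
        (M.base.comparisonUnit_unitorsCompatible h_tri h_unital h₀).pasting }
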